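/- **Conventions.** Let $[m]=\frac{q^{m/2}-q^{-m/2}}{q^{1/2}-q^{-1/2}}$, $[m]!=\prod_{i=1}^m[i]$ and $(q)_m=\prod_{i=1}^m(1-q^i)$. A triple $(i,j,k)\in\mathbb N^3$ is admissible if $i+j+k$ is even and $i\le j+k$, $j\le i+k$, $k\le i+j$. A coloring $\gamma=(a,b,c,d,e,f)\in\mathbb N^6$ of the edges of the planar tetrahedron graph, whose four vertices carry the triples $(a,b,e),(a,c,f),(c,d,e),(b,d,f)$, is admissible if these four triples are. Let $\langle\gamma\rangle$ be the Kauffman bracket (loop value $-q^{1/2}-q^{-1/2}$) of the planar tetrahedron in which an edge of color $m$ is replaced by $m$ parallel strands carrying the Jones–Wenzl projector, and at each vertex the strands are joined in the planar way, with $\frac{i+j-k}2,\frac{i+k-j}2,\frac{j+k-i}2$ strands running between the pairs of edges of a vertex $(i,j,k)$. The standard evaluation is $$J_\gamma(q)=\frac{\prod_{x\in\{a,b,c,d,e,f\}}[x]!}{\prod_{(i,j,k)}\left[\frac{i+j-k}2\right]!\left[\frac{i+k-j}2\right]!\left[\frac{j+k-i}2\right]!}\,\langle\gamma\rangle ,$$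 the lower product being over the four vertices, and $\hat J_\gamma$ denotes the quotient of $J_\gamma$ by its lowest monomial (including its coefficient). A sequence $f_n\in\mathbb Z[[q]]$ is *stable* if for every $k\ge 0$ there are $\Phi_0,\dots,\Phi_k\in\mathbb Z((q))$ with $\lim_{n\to\infty}q^{-k(n+1)}\bigl(f_n-\sum_{j=0}^k\Phi_jq^{j(n+1)}\bigr)=0$, where a limit in $\mathbb Z((q))$ means that the minimal degrees are uniformly bounded below and each coefficient converges. The $\Phi_j$ do not depend on $k$; $\Phi_0$ is the limit of the sequence, and $F(x,q)=\sum_{k\ge0}\Phi_k(q)x^k\in\mathbb Z((q))[[x]]$ its associated series. A *(generalized) Nahm sum* is a series $$\sum_{n\in C\cap\mathbb N^r}(-1)^{\alpha\cdot n}\,\frac{q^{\frac12n^tAn+\beta\cdot n}}{(q)_{n_1}\cdots(q)_{n_r}},$$ where $C\subset\mathbb R^r$ is a rational polyhedral cone, $A$ a symmetric (possibly indefinite) integer matrix, $\alpha\in\mathbb Z^r$, $\beta\in(\frac12\mathbb Z)^r$, and the exponent $\frac12n^tAn+\beta\cdot n$ takes integer values on $C\cap\mathbb N^r$. It is *regular*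 if the exponent is proper and bounded below on $C\cap\mathbb N^r$. **Theorem.** For every admissible coloring $\gamma$ of the tetrahedron, $\hat J_{n\gamma}(q)\in\mathbb Z[q]$ for all $n\ge0$, and the sequence $(\hat J_{n\gamma}(q))_{n\ge 0}$ is stable. Its limit $\Phi_0(q)$ equals a regular Nahm sum. Moreover its associated series is given by a Nahm sum: there are $r$, $C$, $A$, $\alpha$, $\beta$ as above and $w\in\mathbb N^r$ such that $$F(x,q)=\sum_{n\in C\cap\mathbb N^r}(-1)^{\alpha\cdot n}\,x^{w\cdot n}\,\frac{q^{\frac12n^tAn+\beta\cdot n}}{(q)_{n_1}\cdots(q)_{n_r}},$$ where for each $k$ the part of the sum with $w\cdot n=k$ (which is $\Phi_k(q)$) is regular, i.e. the exponent is proper and bounded below on $\{n\in C\cap\mathbb N^r: w\cdot n=k\}$. -/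

import Mathlib

namespace QSpin

section Skein

variable {K : Type*} [Field K]

/-- A map `V^{⊗m} → V^{⊗n}`, `V` two-dimensional with basis indexed by `Bool`, given by its matrix
entries: `M u v` is the entry at the source word `u` (of length `m`) and target word `v` (of
length `n`).  Only words of the relevant lengths are ever used. -/
abbrev Ker (K : Type*) := List Bool → List Bool → K

/-- The identity strands. -/
def idK : Ker K := fun u v => if u = v then 1 else 0

/-- `comp n M N` is `M` followed by `N`, glued along `n` strands. -/
def comp (n : ℕ) (M N : Ker K) : Ker K :=
  fun u v => ∑ w : Fin n → Bool, M u (List.ofFn w) * N (List.ofFn w) v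

/-- `tens m n M N` is `M` (with `m` source and `n` target strands) placed to the left of `N`. -/
def tens (m n : ℕ) (M N : Ker K) : Ker K :=
  fun u v => M (u.take m) (v.take n) * N (u.drop m) (v.drop n)

/-- Entries of the cup `1 → V ⊗ V`. -/
def cupEntry (t : K) : Bool → Bool → K
  | false, true => 1
  | true, false => -t⁻¹
  | _, _ => 0

/-- Entries of the cap `V ⊗ V → 1`. -/
def capEntry (t : K) : Bool → Bool → K
  | false, true => -t
  | true, false => 1
  | _, _ => 0

/-- A cup followed by a cap straightens to the identity strand. -/
theorem zigzag (t : K) (ht : t ≠ 0) (x z : Bool) :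
    ∑ y : Bool, capEntry t x y * cupEntry t y z = if x = z then 1 else 0 := by
  cases x <;> cases z <;> simp [capEntry, cupEntry, ht]

/-- The other way to straighten. -/
theorem zigzag' (t : K) (ht : t ≠ 0) (x z : Bool) :
    ∑ y : Bool, cupEntry t x y * capEntry t y z = if x = z then 1 else 0 := by
  cases x <;> cases z <;> simp [capEntry, cupEntry, ht]

/-- The value of a closed loop is `-t - t⁻¹`.  Together with the two straightening rules this says
that contracting the tensors of a closed planar diagram computes its Kauffman bracket, with
`t = A²`, i.e. loop value `-A² - A⁻²`. -/
theorem loop_value (t : K) :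
    ∑ x : Bool, ∑ y : Bool, cupEntry t x y * capEntry t x y = -t - t⁻¹ := by
  simp [capEntry, cupEntry]
  ring

/-- `n` nested cups. -/
def cups (t : K) (n : ℕ) : Ker K :=
  fun _ v => (List.zipWith (cupEntry t) (v.take n) (v.drop n).reverse).prod

/-- `n` nested caps. -/
def caps (t : K) (n : ℕ) : Ker K :=
  fun u _ => (List.zipWith (capEntry t) (u.take n) (u.drop n).reverse).prod

/-- The quantum integer `[n]`, with `t = q^{1/2}`. -/
def qInt (t : K) (n : ℕ) : K := (t ^ n - (t⁻¹) ^ n) / (t - t⁻¹)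

/-- The quantum factorial `[n]!`. -/
def qFact (t : K) (n : ℕ) : K := ∏ i ∈ Finset.range n, qInt t (i + 1)

/-- The Jones–Wenzl projector on `n` strands, by Wenzl's recursion
`p_{n+1} = p_n ⊗ 1 + [n]/[n+1] (p_n ⊗ 1) U_n (p_n ⊗ 1)` (loop value `-[2]`), where `U_n` is the
cap-cup on the last two of the `n + 1` strands. -/
def jonesWenzl (t : K) : ℕ → Ker K
  | 0 => idK
  | 1 => idK
  | n + 2 =>
    let p : Ker K := tens (n + 1) (n + 1) (jonesWenzl t (n + 1)) idK
    let U : Ker K := tens n n idK (comp 0 (caps t 1) (cups t 1))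
    fun u v => p u v +
      qInt t (n + 1) / qInt t (n + 2) * comp (n + 2) (comp (n + 2) p U) p u v

/-- The number of strands joining the edges colored `i` and `j` at a vertex `(i, j, k)`. -/
def strands (i j k : ℕ) : ℕ := (i + j - k) / 2

/-- The planar trivalent vertex as a map from `k` strands to `i + j` strands. -/
def split (t : K) (k i j : ℕ) : Ker K :=
  tens (strands i k j) (strands i k j) idK
    (tens 0 (2 * strands i j k) (cups t (strands i j k)) idK)

/-- The planar trivalent vertex as a map from `i + j` strands to `k` strands. -/
def merge (t : K) (i j k : ℕ) : Ker K :=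
  tens (strands i k j) (strands i k j) idK
    (tens (2 * strands i j k) 0 (caps t (strands i j k)) idK)

/-- The planar closure of an endomorphism of `n` strands. -/
def closure (t : K) (n : ℕ) (M : Ker K) : K :=
  comp (2 * n) (cups t n) (comp (2 * n) (tens n n M idK) (caps t n)) [] []

/-- The Kauffman bracket of the tetrahedral network with vertices
`(a, b, e)`, `(a, c, f)`, `(c, d, e)`, `(b, d, f)`: each edge carries a Jones–Wenzl projector, each
vertex is the planar trivalent vertex, and the network is drawn in the plane as the closure of
`e → a ⊗ b → a ⊗ f ⊗ d → c ⊗ d → e`. -/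
def tetBracket (t : K) (a b c d e f : ℕ) : K :=
  closure t e
    (comp e (jonesWenzl t e)
    (comp (a + b) (split t e a b)
    (comp (a + b) (tens a a (jonesWenzl t a) (jonesWenzl t b))
    (comp (a + (f + d)) (tens a a idK (split t b f d))
    (comp (a + (f + d)) (tens a a idK (tens f f (jonesWenzl t f) (jonesWenzl t d)))
    (comp (c + d) (tens (a + f) c (merge t a f c) idK)
    (comp (c + d) (tens c c (jonesWenzl t c) idK)
      (merge t c d e))))))))

/-- The product of the quantum factorials of the three strand numbers at a vertex. -/
def vertexFact (t : K) (i j k : ℕ) : K :=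
  qFact t (strands i j k) * qFact t (strands i k j) * qFact t (strands j k i)

/-- The standard (integral) normalization of the evaluation of the tetrahedral quantum spin
network: the bracket times the quantum factorials of the edge colors, divided by the quantum
factorials of the strand numbers at the vertices. -/
def tetEval (t : K) (a b c d e f : ℕ) : K :=
  (qFact t a * qFact t b * qFact t c * qFact t d * qFact t e * qFact t f) /
    (vertexFact t a b e * vertexFact t a c f * vertexFact t c d e * vertexFact t b d f) *
    tetBracket t a b c d e f

end Skein

/-- A triple of colors is admissible at a vertex: even sum and triangle inequalities. -/
def AdmissibleTriple (i j k : ℕ) : Prop :=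
  Even (i + j + k) ∧ i ≤ j + k ∧ j ≤ i + k ∧ k ≤ i + j

/-- Admissible colorings of the edges of the tetrahedron. -/
def Admissible (a b c d e f : ℕ) : Prop :=
  AdmissibleTriple a b e ∧ AdmissibleTriple a c f ∧ AdmissibleTriple c d e ∧
    AdmissibleTriple b d f

/-- The evaluation `J_γ` of the colored tetrahedron at generic `q`, as a rational function of the
variable `RatFunc.X = q^{1/2}`. -/
noncomputable def J (a b c d e f : ℕ) : RatFunc ℚ := tetEval RatFunc.X a b c d e f

/-- `P(q)` is the quotient of `g` by its lowest monomial: `g = κ q^{m/2} P(q)` with `κ ≠ 0` and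
`P(0) = 1`, where `RatFunc.X = q^{1/2}`. -/
def IsLowestMonomialQuotient (g : RatFunc ℚ) (P : Polynomial ℤ) : Prop :=
  P.coeff 0 = 1 ∧ ∃ (κ : ℤ) (m : ℤ), κ ≠ 0 ∧
    g = (κ : RatFunc ℚ) * RatFunc.X ^ m * Polynomial.aeval (RatFunc.X ^ 2 : RatFunc ℚ) P

/-- `lim f_n = f` in `ℤ((q))`: minimal degrees uniformly bounded below, and convergence of each
coefficient. -/
def LimIs (f : ℕ → LaurentSeries ℤ) (g : LaurentSeries ℤ) : Prop :=
  (∃ C : ℤ, ∀ n, ∀ j < C, (f n).coeff j = 0) ∧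
    ∀ j : ℤ, Filter.Tendsto (fun n => (f n).coeff j) Filter.atTop (nhds (g.coeff j))

/-- The monomial `q^m`. -/
noncomputable def qPow (m : ℤ) : LaurentSeries ℤ := HahnSeries.single m 1

/-- `Φ 0, …, Φ k` witness the `k`-stability of `f`. -/
def HasStableLimits (f : ℕ → PowerSeries ℤ) (k : ℕ) (Φ : ℕ → LaurentSeries ℤ) : Prop :=
  LimIs (fun n => qPow (-((k : ℤ) * (n + 1))) *
    (HahnSeries.ofPowerSeries ℤ ℤ (f n) -
      ∑ j ∈ Finset.range (k + 1), Φ j * qPow ((j : ℤ) * (n + 1)))) 0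

/-- `k`-stable sequences. -/
def IsKStable (f : ℕ → PowerSeries ℤ) (k : ℕ) : Prop := ∃ Φ, HasStableLimits f k Φ

/-- Stable sequences. -/
def IsStable (f : ℕ → PowerSeries ℤ) : Prop := ∀ k, IsKStable f k

/-- `F(x, q) = ∑ Φ_k(q) x^k ∈ ℤ((q))[[x]]` is the series associated to a stable sequence. -/
def IsAssociatedSeries (f : ℕ → PowerSeries ℤ) (F : PowerSeries (LaurentSeries ℤ)) : Prop :=
  ∀ k, HasStableLimits f k (fun j => PowerSeries.coeff j F)

/-- The quantum factorial `(q)_n = (1 - q) ⋯ (1 - q^n)`. -/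
noncomputable def poch (n : ℕ) : PowerSeries ℤ :=
  ∏ i ∈ Finset.range n, (1 - PowerSeries.X ^ (i + 1))

/-- `1 / (q)_n`. -/
noncomputable def invPoch (n : ℕ) : PowerSeries ℤ := PowerSeries.invOfUnit (poch n) 1

theorem poch_mul_invPoch (n : ℕ) : poch n * invPoch n = 1 := by
  refine PowerSeries.mul_invOfUnit _ _ ?_
  simp [poch, map_prod]

/-- The data of a generalized Nahm sum of rank `r`: a sign vector `a`, a symmetric (possibly
indefinite) integral matrix `A`, a half-integral linear form `b / 2`, and a rational polyhedral cone
`{n | ineq n ≥ 0}`, such that the exponent `(nᵗ A n + b · n) / 2` is an integer at every lattice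
point of the cone in the orthant. -/
structure NahmData (r : ℕ) where
  a : Fin r → ℤ
  A : Matrix (Fin r) (Fin r) ℤ
  symm : A.IsSymm
  b : Fin r → ℤ
  s : ℕ
  ineq : Matrix (Fin s) (Fin r) ℤ
  even_exponent : ∀ n : Fin r → ℕ, (∀ i, 0 ≤ ∑ j, ineq i j * (n j : ℤ)) →
    Even ((∑ i, ∑ j, (n i : ℤ) * A i j * n j) + ∑ i, b i * (n i : ℤ))

namespace NahmData

variable {r : ℕ} (D : NahmData r)

/-- The points of `ℕ^r` in the cone. -/
def cone : Set (Fin r → ℕ) := {n | ∀ i, 0 ≤ ∑ j, D.ineq i j * (n j : ℤ)}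

/-- The exponent `½ nᵗ A n + ½ b · n`. -/
def exponent (n : Fin r → ℕ) : ℤ :=
  ((∑ i, ∑ j, (n i : ℤ) * D.A i j * n j) + ∑ i, D.b i * (n i : ℤ)) / 2

/-- The summand `(-1)^{a·n} q^{½ nᵗ A n + ½ b·n} / ((q)_{n_1} ⋯ (q)_{n_r})`. -/
noncomputable def term (n : Fin r → ℕ) : LaurentSeries ℤ :=
  (((-1 : ℤˣ) ^ (∑ i, D.a i * (n i : ℤ)) : ℤˣ) : ℤ) •
    (qPow (D.exponent n) * HahnSeries.ofPowerSeries ℤ ℤ (∏ i, invPoch (n i)))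

/-- The exponent is proper and bounded below on `S`. -/
def RegularOn (S : Set (Fin r → ℕ)) : Prop :=
  (∃ C : ℤ, ∀ n ∈ S, C ≤ D.exponent n) ∧ ∀ N : ℤ, {n ∈ S | D.exponent n = N}.Finite

/-- `Φ` is the sum of the summands over `S`, and the sum is regular (so that every coefficient is a
sum with finitely many nonzero terms). -/
def HasSumOn (S : Set (Fin r → ℕ)) (Φ : LaurentSeries ℤ) : Prop :=
  D.RegularOn S ∧ ∀ j : ℤ, Φ.coeff j = ∑ᶠ n ∈ S, (D.term n).coeff j

end NahmData

/-- `Φ` is given by a regular generalized Nahm sum. -/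
def IsNahmSum (Φ : LaurentSeries ℤ) : Prop :=
  ∃ (r : ℕ) (D : NahmData r), D.HasSumOn D.cone Φ

/-- `F(x, q)` is given by a Nahm sum with an additional grading: for some weights `c ∈ ℕ^r`,
`F(x, q) = ∑_n (-1)^{a·n} x^{c·n} q^{½ nᵗ A n + ½ b·n} / ((q)_{n_1} ⋯ (q)_{n_r})` over the lattice
points of the cone, the sum being regular in every `x`-degree. -/
def IsNahmSeries (F : PowerSeries (LaurentSeries ℤ)) : Prop :=
  ∃ (r : ℕ) (D : NahmData r) (c : Fin r → ℕ), ∀ k : ℕ,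
    D.HasSumOn {n ∈ D.cone | ∑ i, c i * n i = k} (PowerSeries.coeff k F)

end QSpin

/-! The tensors contracted in a planar diagram are morphisms for the quantum group of sl₂, acting on
functions of two-letter words. The projector on n strands projects onto the string of weight vectors
`sym t k`, 0 ≤ k ≤ n (`jonesWenzl_apply`), so the network can be evaluated with weight vectors. Cut
the edge e open: what remains commutes with the raising operator (`Equi`), and by Schur's lemma its
closure is ±[e+1] times its value at the highest weight vector (`closure_jonesWenzl_comp`). The
vertex coefficients have a closed form (`mergeCoeff_eq`). The highest weight condition and two
q-Chu–Vandermonde summations then leave a single balanced sum (`tetEval_eq_tetTerm`).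

This sum equals the Racah sum of (-1)^z [z+1]! / (∏ [z - T_i]! ∏ [S_j - z]!), where T_i and S_j are
the half sums of the colors over triangles and quadrilaterals (`sum_racahTerm_eq`, `tetEval_eq`).
Both sides obey the same contiguous relation, and the initial case is the q-Saalschütz sum.

Let S be the smallest S_j, let A_1, A_2 be the distances to the other two and B_i = S - T_i. For the
coloring nγ put z = nS - k. Up to a sign and a monomial common to all terms, the term k is (-1)^k
q^{k(3k+1)/2 + n(A_1+A_2)k} times a q-multinomial coefficient, which is a polynomial with constant
term 1 (`TetShape.sum_racahTerm`). Only k = 0 reaches the lowest degree, so the sum over k is the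
required polynomial.

Each factor (q)_m^{±1} with m linear in n and k is a quotient of infinite products, and Euler's two
series expand these. The result is a multiple sum whose exponent is quadratic in the summation
variables, while n enters only through n times a nonnegative linear form, the weight. The points of
weight d contribute q^{d(n+1)} Φ_d with Φ_d independent of n. This yields stability, the associated
series and its Nahm form at once (`LayerData.Represents.coeff_eq`). Two points need estimates: the
restriction of k to a finite range, and the coupling -kx to some of the new variables. The term
3k²/2 settles both, since for B_i > 0 the variables x with negative coupling have positive weight.
If some B_i = 0, then k = 0 and the cone degenerates to a face. -/

namespace QSpin

/-! ### Functions of words, weight vectors and the raising operator -/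

section Words

variable {K : Type*} [Field K]

/-- The sum of `f` over all words of length `n`. -/
def wsum (n : ℕ) (f : List Bool → K) : K := ∑ w : Fin n → Bool, f (List.ofFn w)

theorem wsum_zero (f : List Bool → K) : wsum 0 f = f [] := by
  simp [wsum]

theorem wsum_succ (n : ℕ) (f : List Bool → K) :
    wsum (n + 1) f = ∑ x : Bool, wsum n (fun u => f (x :: u)) := by
  unfold wsum
  rw [← Fintype.sum_prod_type' (f := fun (x : Bool) (w : Fin n → Bool) => f (x :: List.ofFn w))]
  refine (Fintype.sum_equiv (Fin.consEquiv (fun _ => Bool)) _ _ ?_).symm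
  rintro ⟨x, w⟩
  simp [Fin.consEquiv, List.ofFn_succ]

theorem wsum_congr {n : ℕ} {f g : List Bool → K} (h : ∀ u : List Bool, u.length = n → f u = g u) :
    wsum n f = wsum n g :=
  Finset.sum_congr rfl fun w _ => h _ (by simp)

theorem wsum_const_zero (n : ℕ) : wsum n (fun _ => (0 : K)) = 0 := by simp [wsum]

theorem wsum_eq_zero {n : ℕ} {f : List Bool → K} (h : ∀ u : List Bool, u.length = n → f u = 0) :
    wsum n f = 0 := by
  rw [wsum_congr h, wsum_const_zero]

theorem wsum_add (n : ℕ) (f g : List Bool → K) :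
    wsum n (fun u => f u + g u) = wsum n f + wsum n g := Finset.sum_add_distrib

theorem wsum_mul_left (n : ℕ) (c : K) (f : List Bool → K) :
    wsum n (fun u => c * f u) = c * wsum n f := by
  simp [wsum, Finset.mul_sum]

theorem wsum_mul_right (n : ℕ) (c : K) (f : List Bool → K) :
    wsum n (fun u => f u * c) = wsum n f * c := by
  simp [wsum, Finset.sum_mul]

theorem wsum_sum {ι : Type*} (n : ℕ) (s : Finset ι) (f : ι → List Bool → K) :
    wsum n (fun u => ∑ i ∈ s, f i u) = ∑ i ∈ s, wsum n (f i) := Finset.sum_comm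

theorem wsum_comm (m n : ℕ) (f : List Bool → List Bool → K) :
    wsum m (fun u => wsum n (fun v => f u v)) = wsum n (fun v => wsum m (fun u => f u v)) :=
  Finset.sum_comm

theorem wsum_add_length (m n : ℕ) (f : List Bool → K) :
    wsum (m + n) f = wsum m (fun u => wsum n (fun v => f (u ++ v))) := by
  induction m generalizing f with
  | zero => simp [wsum_zero]
  | succ m ih =>
    rw [show m + 1 + n = (m + n) + 1 by ring, wsum_succ, wsum_succ]
    refine Finset.sum_congr rfl fun x _ => ?_
    rw [ih]
    rfl

theorem wsum_one (f : List Bool → K) : wsum 1 f = ∑ x : Bool, f [x] := by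
  rw [wsum_succ]
  simp [wsum_zero]

theorem wsum_snoc (n : ℕ) (f : List Bool → K) :
    wsum (n + 1) f = wsum n (fun u => ∑ x : Bool, f (u ++ [x])) := by
  rw [wsum_add_length]
  exact wsum_congr fun u _ => wsum_one _

theorem wsum_ite_eq {n : ℕ} (u : List Bool) (hu : u.length = n) (f : List Bool → K) :
    wsum n (fun w => if w = u then f w else 0) = f u := by
  subst hu
  unfold wsum
  rw [Finset.sum_eq_single (fun i : Fin u.length => u.get i)]
  · simp
  · intro w _ hw
    refine if_neg ?_
    intro h
    apply hw
    have : List.ofFn w = List.ofFn (fun i : Fin u.length => u.get i) := by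
      rw [h]; simp
    exact List.ofFn_injective this
  · simp

theorem comp_apply (n : ℕ) (M N : Ker K) (u v : List Bool) :
    comp n M N u v = wsum n (fun w => M u w * N w v) := rfl

/-- The operator on functions of words given by a matrix. -/
def opK (n : ℕ) (M : Ker K) (φ : List Bool → K) : List Bool → K :=
  fun u => wsum n (fun v => M u v * φ v)

theorem opK_congr {n : ℕ} (M : Ker K) {φ ψ : List Bool → K}
    (h : ∀ v : List Bool, v.length = n → φ v = ψ v) : opK n M φ = opK n M ψ := by
  funext u
  exact wsum_congr fun v hv => by rw [h v hv]

theorem opK_comp (n p : ℕ) (M N : Ker K) (φ : List Bool → K) :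
    opK p (comp n M N) φ = opK n M (opK p N φ) := by
  funext u
  simp only [opK, comp_apply]
  simp_rw [← wsum_mul_right, ← wsum_mul_left]
  rw [wsum_comm]
  refine wsum_congr fun v _ => wsum_congr fun w _ => ?_
  ring

theorem opK_sum {ι : Type*} (n : ℕ) (M : Ker K) (s : Finset ι) (φ : ι → List Bool → K)
    (u : List Bool) :
    opK n M (fun v => ∑ i ∈ s, φ i v) u = ∑ i ∈ s, opK n M (φ i) u := by
  simp only [opK, Finset.mul_sum, wsum_sum]

theorem opK_add (n : ℕ) (M : Ker K) (φ ψ : List Bool → K) (u : List Bool) :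
    opK n M (fun v => φ v + ψ v) u = opK n M φ u + opK n M ψ u := by
  simp only [opK, mul_add, wsum_add]

theorem opK_mul_left (n : ℕ) (M : Ker K) (c : K) (φ : List Bool → K) (u : List Bool) :
    opK n M (fun v => c * φ v) u = c * opK n M φ u := by
  simp only [opK, ← wsum_mul_left]
  exact wsum_congr fun v _ => by ring

theorem opK_mul_right (n : ℕ) (M : Ker K) (c : K) (φ : List Bool → K) (u : List Bool) :
    opK n M (fun v => φ v * c) u = opK n M φ u * c := by
  simp only [mul_comm _ c, opK_mul_left]

theorem opK_id {n : ℕ} (φ : List Bool → K) (u : List Bool) (hu : u.length = n) :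
    opK n idK φ u = φ u := by
  have : ∀ v : List Bool, idK u v * φ v = if v = u then φ v else 0 := by
    intro v
    by_cases h : v = u
    · simp [idK, h]
    · have : ¬ u = v := fun h' => h h'.symm
      simp [idK, h, this]
  simp only [opK, this]
  exact wsum_ite_eq u hu φ

theorem tens_append {m m' : ℕ} (M N : Ker K) {u v u' v' : List Bool}
    (hu : u.length = m) (hv : v.length = m') :
    tens m m' M N (u ++ u') (v ++ v') = M u v * N u' v' := by
  subst hu hv
  simp [tens]

theorem opK_tens {m m' n' : ℕ} (M N : Ker K) (φ : List Bool → K) {u u' : List Bool}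
    (hu : u.length = m) :
    opK (m' + n') (tens m m' M N) φ (u ++ u') =
      opK m' M (fun v => opK n' N (fun v' => φ (v ++ v')) u') u := by
  simp only [opK, wsum_add_length]
  refine wsum_congr fun v hv => ?_
  rw [← wsum_mul_left]
  refine wsum_congr fun v' _ => ?_
  rw [tens_append M N hu hv]
  ring

/-- The number of inversions of a word. -/
def inversions : List Bool → ℕ
  | [] => 0
  | x :: u => (if x then u.count false else 0) + inversions u

theorem inversions_append (u v : List Bool) :
    inversions (u ++ v) = inversions u + inversions v + u.count true * v.count false := by
  induction u with
  | nil => simp [inversions]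
  | cons x u ih =>
    cases x <;> simp [inversions, ih] <;> ring

theorem count_false_add_count_true (u : List Bool) :
    u.count false + u.count true = u.length := by
  induction u with
  | nil => simp
  | cons x u ih => cases x <;> simp <;> omega

theorem count_true_le (u : List Bool) : u.count true ≤ u.length := List.count_le_length

/-- The weight vectors of the symmetric part of the tensor power. -/
def sym (t : K) (k : ℕ) (u : List Bool) : K :=
  if u.count true = k then t ^ inversions u else 0

/-- The weight `t ^ (#false - #true)`. -/
def kap (t : K) (u : List Bool) : K := (u.map fun x => if x then t⁻¹ else t).prod

theorem kap_nil (t : K) : kap t [] = 1 := rfl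

theorem kap_cons (t : K) (x : Bool) (u : List Bool) :
    kap t (x :: u) = (if x then t⁻¹ else t) * kap t u := by simp [kap]

theorem kap_append (t : K) (u v : List Bool) : kap t (u ++ v) = kap t u * kap t v := by
  simp [kap]

theorem kap_eq (t : K) (ht : t ≠ 0) (u : List Bool) :
    kap t u = t ^ ((u.length : ℤ) - 2 * (u.count true : ℤ)) := by
  induction u with
  | nil => simp [kap]
  | cons x u ih =>
    rw [kap_cons, ih]
    cases x
    · simp only [Bool.false_eq_true, if_false, List.length_cons, List.count_cons]
      rw [← zpow_one_add₀ ht]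
      congr 1
      push_cast
      simp
      ring
    · simp only [if_true, List.length_cons, List.count_cons]
      rw [← zpow_neg_one, ← zpow_add₀ ht]
      congr 1
      push_cast
      simp
      ring

/-- The raising operator of `U_q(sl₂)`. -/
def raise (t : K) : List Bool → (List Bool → K) → K
  | [], _ => 0
  | x :: u, φ => (if x then kap t u * φ (false :: u) else 0) + raise t u (fun v => φ (x :: v))

theorem raise_congr (t : K) (u : List Bool) {φ ψ : List Bool → K}
    (h : ∀ v : List Bool, v.length = u.length → φ v = ψ v) : raise t u φ = raise t u ψ := by
  induction u generalizing φ ψ with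
  | nil => rfl
  | cons x u ih =>
    rw [raise, raise, h (false :: u) (by simp), ih fun v hv => h (x :: v) (by simp [hv])]

theorem raise_add (t : K) (u : List Bool) (φ ψ : List Bool → K) :
    raise t u (fun v => φ v + ψ v) = raise t u φ + raise t u ψ := by
  induction u generalizing φ ψ with
  | nil => simp [raise]
  | cons x u ih =>
    rw [raise, raise, raise, ih]
    split_ifs <;> ring

theorem raise_mul_left (t : K) (u : List Bool) (c : K) (φ : List Bool → K) :
    raise t u (fun v => c * φ v) = c * raise t u φ := by
  induction u generalizing φ with
  | nil => simp [raise]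
  | cons x u ih =>
    rw [raise, raise, ih]
    split_ifs <;> ring

theorem raise_mul_right (t : K) (u : List Bool) (c : K) (φ : List Bool → K) :
    raise t u (fun v => φ v * c) = raise t u φ * c := by
  simp only [mul_comm _ c, raise_mul_left]

theorem raise_zero (t : K) (u : List Bool) : raise t u (fun _ => 0) = 0 := by
  simpa using raise_mul_left t u 0 (fun _ => 0)

theorem raise_sum {ι : Type*} (t : K) (u : List Bool) (s : Finset ι) (φ : ι → List Bool → K) :
    raise t u (fun v => ∑ i ∈ s, φ i v) = ∑ i ∈ s, raise t u (φ i) := by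
  classical
  induction s using Finset.induction_on with
  | empty => simp [raise_zero]
  | insert i s hi ih => simp only [Finset.sum_insert hi, raise_add, ih]

theorem raise_wsum (t : K) (u : List Bool) (n : ℕ) (φ : List Bool → List Bool → K) :
    raise t u (fun v => wsum n (φ v)) = wsum n (fun w => raise t u (fun v => φ v w)) :=
  raise_sum t u _ fun (w : Fin n → Bool) v => φ v (List.ofFn w)

/-- The coproduct rule. Changing a letter `true` to `false` costs the weight `kap` of the letters to
its right, so only the action on the left word acquires a factor. -/
theorem raise_append (t : K) (u v : List Bool) (φ : List Bool → K) :
    raise t (u ++ v) φ = kap t v * raise t u (fun u' => φ (u' ++ v)) +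
      raise t v (fun v' => φ (u ++ v')) := by
  induction u generalizing φ with
  | nil => simp [raise]
  | cons x u ih =>
    rw [List.cons_append, raise, raise, ih, kap_append]
    split_ifs <;> simp <;> ring_nf

theorem raise_replicate_false (t : K) (n : ℕ) (φ : List Bool → K) :
    raise t (List.replicate n false) φ = 0 := by
  induction n generalizing φ with
  | zero => rfl
  | succ n ih => rw [List.replicate_succ, raise, ih]; simp

/-- The quantum integer `[n]` for integral `n`. -/
def qi (t : K) (n : ℤ) : K := (t ^ n - t ^ (-n)) / (t - t⁻¹)

theorem qInt_eq_qi (t : K) (n : ℕ) : qInt t n = qi t n := by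
  simp [qInt, qi]

theorem qi_zero (t : K) : qi t 0 = 0 := by simp [qi]

theorem qi_neg (t : K) (n : ℤ) : qi t (-n) = -qi t n := by
  simp only [qi, neg_neg]; ring

/-- `t` is nonzero and not a root of unity. -/
structure Generic (t : K) : Prop where
  ne_zero : t ≠ 0
  pow_ne_one : ∀ n : ℕ, n ≠ 0 → t ^ n ≠ 1

theorem Generic.zpow_ne_one {t : K} (h : Generic t) {n : ℤ} (hn : n ≠ 0) : t ^ n ≠ 1 := by
  intro h1
  have h2 : t ^ n.natAbs = 1 := by
    rcases Int.natAbs_eq n with h3 | h3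
    · rw [h3, zpow_natCast] at h1; exact h1
    · rw [h3, zpow_neg, zpow_natCast, inv_eq_one] at h1; exact h1
  exact h.pow_ne_one _ (by omega) h2

theorem Generic.sub_inv_ne_zero {t : K} (h : Generic t) : t - t⁻¹ ≠ 0 := by
  intro h1
  apply h.pow_ne_one 2 (by norm_num)
  have := sub_eq_zero.mp h1
  have h0 := h.ne_zero
  field_simp at this
  exact this

theorem Generic.qi_ne_zero {t : K} (h : Generic t) {n : ℤ} (hn : n ≠ 0) : qi t n ≠ 0 := by
  unfold qi
  refine div_ne_zero ?_ h.sub_inv_ne_zero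
  intro h1
  have h2 : t ^ n = t ^ (-n) := sub_eq_zero.mp h1
  have h3 : t ^ (2 * n) = 1 := by
    rw [two_mul, zpow_add₀ h.ne_zero]
    nth_rewrite 2 [h2]
    rw [← zpow_add₀ h.ne_zero]
    simp
  exact h.zpow_ne_one (by omega) h3

theorem Generic.qi_one {t : K} (h : Generic t) : qi t 1 = 1 := by
  simp [qi, div_self h.sub_inv_ne_zero]

/-- `[m + n] = t ^ n [m] + t ^ (-m) [n]`. -/
theorem qi_add {t : K} (h : Generic t) (m n : ℤ) :
    qi t (m + n) = t ^ n * qi t m + t ^ (-m) * qi t n := by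
  have h0 := h.ne_zero
  have h1 := h.sub_inv_ne_zero
  simp only [qi]
  rw [mul_div_assoc', mul_div_assoc', ← add_div]
  congr 1
  rw [mul_sub, mul_sub, ← zpow_add₀ h0, ← zpow_add₀ h0, ← zpow_add₀ h0, ← zpow_add₀ h0]
  rw [show -(m + n) = -m + -n by ring, show n + m = m + n by ring, show n + -m = -m + n by ring]
  ring

/-- Peel off the first letter. If it is `true`, the contributions of that letter and of the tail
combine by `qi_add` into one quantum integer. Thus the weight vectors form a single string under
`raise`. -/
theorem raise_sym {t : K} (h : Generic t) (k : ℕ) (u : List Bool) :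
    raise t u (sym t k) = qi t (k + 1) * sym t (k + 1) u := by
  have h0 := h.ne_zero
  induction u generalizing k with
  | nil => simp [raise, sym]
  | cons x u ih =>
    cases x
    · rw [raise]
      have h1 : (fun v => sym t k (false :: v)) = sym t k := by
        funext v; simp [sym, inversions]
      rw [h1, ih]
      simp [sym, inversions]
    · rw [raise]
      have h2 : sym t (k + 1) (true :: u) = t ^ u.count false * sym t k u := by
        by_cases hk : u.count true = k
        · simp [sym, inversions, hk, pow_add]
        · simp [sym, hk]
      rw [h2, if_pos rfl]
      have h3 : sym t k (false :: u) = sym t k u := by simp [sym, inversions]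
      rw [h3]
      have hc := count_false_add_count_true u
      cases k with
      | zero =>
        have h4 : raise t u (fun v => sym t 0 (true :: v)) = 0 := by
          rw [raise_congr (ψ := fun _ => 0), raise_zero]
          intro v _
          simp [sym]
        rw [h4, add_zero]
        by_cases hu : u.count true = 0
        · rw [kap_eq t h0, hu, ← hc, hu]
          simp [h.qi_one]
        · simp [sym, hu]
      | succ k =>
        have h4 : raise t u (fun v => sym t (k + 1) (true :: v)) =
            t ^ ((u.length : ℤ) - k) * (qi t (k + 1) * sym t (k + 1) u) := by
          rw [← ih, ← raise_mul_left]
          refine raise_congr t u fun v hv => ?_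
          by_cases hk : v.count true = k
          · have := count_false_add_count_true v
            have h5 : (u.length : ℤ) - k = (v.count false : ℤ) := by omega
            rw [h5]
            simp [sym, inversions, hk, pow_add]
          · simp [sym, hk]
        rw [h4]
        by_cases hu : u.count true = k + 1
        · have h5 : t ^ u.count false = t ^ ((u.length : ℤ) - k - 1) := by
            rw [← zpow_natCast]; congr 1; omega
          rw [kap_eq t h0, hu, h5]
          have h6 := qi_add h ((k : ℤ) + 1) 1
          push_cast
          rw [h6, h.qi_one]
          rw [show (u.length : ℤ) - 2 * (k + 1) = ((u.length : ℤ) - k - 1) + (-(k + 1)) by ring,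
            show (u.length : ℤ) - k = ((u.length : ℤ) - k - 1) + 1 by ring]
          rw [zpow_add₀ h0, zpow_add₀ h0 _ 1]
          ring
        · simp [sym, hu]

end Words

end QSpin


namespace QSpin

/-! ### Commutation with the quantum group -/

section Equivariance

variable {K : Type*} [Field K]

theorem sym_nil (t : K) (k : ℕ) : sym t k [] = if k = 0 then 1 else 0 := by
  cases k <;> simp [sym, inversions]

theorem sym_cons_false (t : K) (k : ℕ) (u : List Bool) : sym t k (false :: u) = sym t k u := by
  simp [sym, inversions]

theorem sym_zero_cons_true (t : K) (u : List Bool) : sym t 0 (true :: u) = 0 := by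
  simp [sym]

theorem sym_succ_cons_true (t : K) (k : ℕ) (u : List Bool) :
    sym t (k + 1) (true :: u) = t ^ u.count false * sym t k u := by
  by_cases hk : u.count true = k
  · simp [sym, inversions, hk, pow_add]
  · simp [sym, hk]

theorem sym_mul_congr (t : K) (k : ℕ) (u : List Bool) {x y : K}
    (h : u.count true = k → x = y) : sym t k u * x = sym t k u * y := by
  by_cases hk : u.count true = k
  · rw [h hk]
  · simp [sym, hk]

theorem sym_eq_zero (t : K) {n k : ℕ} (hk : n < k) (u : List Bool) (hu : u.length = n) :
    sym t k u = 0 := by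
  have := count_true_le u
  exact if_neg (by omega)

theorem wsum_sym_zero_mul (t : K) (n : ℕ) (φ : List Bool → K) :
    wsum n (fun u => sym t 0 u * φ u) = φ (List.replicate n false) := by
  induction n generalizing φ with
  | zero => simp [wsum_zero, sym_nil]
  | succ n ih =>
    rw [wsum_succ]
    simp only [Fintype.sum_bool, sym_zero_cons_true, sym_cons_false, zero_mul, wsum_const_zero,
      zero_add, ih, List.replicate_succ]

theorem wsum_sym_zero_raise (t : K) (n : ℕ) (φ : List Bool → K) :
    wsum n (fun u => sym t 0 u * raise t u φ) = 0 := by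
  rw [wsum_sym_zero_mul, raise_replicate_false]

/-- The transpose of `raise` acts on weight vectors as a lowering operator. This replaces a separate
treatment of the lowering generator: norms, Schur's lemma and the recursion for vertices all come
from it together with `raise_sym`. -/
theorem wsum_sym_succ_raise {t : K} (h : Generic t) (n k : ℕ) (φ : List Bool → K) :
    wsum n (fun u => sym t (k + 1) u * raise t u φ) =
      t ^ ((n : ℤ) - 1 - 2 * k) * qi t ((n : ℤ) - k) * wsum n (fun u => sym t k u * φ u) := by
  have h0 := h.ne_zero
  induction n generalizing k φ with
  | zero =>
    rw [wsum_zero, wsum_zero, sym_nil, sym_nil]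
    cases k <;> simp [qi_zero]
  | succ n ih =>
    rw [wsum_succ, wsum_succ]
    simp only [Fintype.sum_bool, sym_cons_false, sym_succ_cons_true, raise, if_true,
      Bool.false_eq_true, if_false, zero_add]
    rw [ih]
    have e1 : wsum n (fun u => t ^ u.count false * sym t k u *
        (kap t u * φ (false :: u) + raise t u fun v => φ (true :: v))) =
        t ^ (2 * (n : ℤ) - 3 * k) * wsum n (fun u => sym t k u * φ (false :: u)) +
        t ^ ((n : ℤ) - k) * wsum n (fun u => sym t k u * raise t u fun v => φ (true :: v)) := by
      rw [← wsum_mul_left, ← wsum_mul_left, ← wsum_add]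
      refine wsum_congr fun u hu => ?_
      have hc := count_false_add_count_true u
      rw [mul_comm (t ^ _) (sym t k u), mul_assoc, mul_left_comm _ (sym t k u),
        mul_left_comm _ (sym t k u), ← mul_add]
      refine sym_mul_congr t k u fun hk => ?_
      rw [kap_eq t h0, ← zpow_natCast, hk, show ((u.count false : ℕ) : ℤ) = (n : ℤ) - k by omega,
        hu, mul_add, ← mul_assoc, ← zpow_add₀ h0]
      congr 3
      ring
    rw [e1]
    have e2 : t ^ ((n : ℤ) - 1 - 2 * k) * qi t ((n : ℤ) - k) + t ^ (2 * (n : ℤ) - 3 * k) =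
        t ^ ((n : ℤ) - 2 * k) * qi t ((n : ℤ) + 1 - k) := by
      have := qi_add h 1 ((n : ℤ) - k)
      rw [h.qi_one] at this
      rw [show (n : ℤ) + 1 - k = 1 + (n - k) by ring, this, mul_add, mul_one, ← mul_assoc,
        ← zpow_add₀ h0, ← zpow_add₀ h0, add_comm]
      congr 2 <;> ring_nf
    push_cast
    rw [show (n : ℤ) + 1 - 1 - 2 * k = n - 2 * k by ring, mul_add, ← e2]
    cases k with
    | zero =>
      rw [wsum_sym_zero_raise]
      simp only [sym_zero_cons_true, zero_mul, wsum_const_zero]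
      ring
    | succ k =>
      rw [ih k]
      have e3 : wsum n (fun u => sym t (k + 1) (true :: u) * φ (true :: u)) =
          t ^ ((n : ℤ) - k) * wsum n (fun u => sym t k u * φ (true :: u)) := by
        rw [← wsum_mul_left]
        refine wsum_congr fun u hu => ?_
        have hc := count_false_add_count_true u
        rw [sym_succ_cons_true, mul_comm (t ^ _) (sym t k u), mul_assoc,
          mul_left_comm _ (sym t k u)]
        refine sym_mul_congr t k u fun hk => ?_
        rw [← zpow_natCast, show ((u.count false : ℕ) : ℤ) = (n : ℤ) - k by omega]
      rw [e3, e2]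
      push_cast
      rw [show (n : ℤ) + 1 - (k + 1) = n - k by ring]
      have e4 : t ^ ((n : ℤ) - (k + 1)) * t ^ ((n : ℤ) - 1 - 2 * k) =
          t ^ ((n : ℤ) - 2 * (k + 1)) * t ^ ((n : ℤ) - k) := by
        rw [← zpow_add₀ h0, ← zpow_add₀ h0]
        congr 1
        ring
      have e5 := e2
      push_cast at e5
      rw [show (n : ℤ) + 1 - (k + 1) = n - k by ring] at e5
      linear_combination (qi t ((n : ℤ) - k) * wsum n (fun u => sym t k u * φ (true :: u))) * e4 +
        (wsum n (fun u => sym t (k + 1) u * φ (false :: u))) * e5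

theorem qFact_zero (t : K) : qFact t 0 = 1 := by simp [qFact]

theorem qFact_succ (t : K) (n : ℕ) : qFact t (n + 1) = qFact t n * qi t (n + 1) := by
  rw [qFact, Finset.prod_range_succ, ← qFact, qInt_eq_qi]
  push_cast
  rfl

theorem Generic.qFact_ne_zero {t : K} (h : Generic t) (n : ℕ) : qFact t n ≠ 0 := by
  induction n with
  | zero => simp [qFact_zero]
  | succ n ih =>
    rw [qFact_succ]
    exact mul_ne_zero ih (h.qi_ne_zero (by omega))

/-- The Gaussian binomial at `t²`: the square length of a weight vector. -/
def gb (t : K) (n k : ℕ) : K := wsum n (fun u => sym t k u * sym t k u)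

theorem gb_zero_right (t : K) (n : ℕ) : gb t n 0 = 1 := by
  rw [gb, wsum_sym_zero_mul]
  induction n with
  | zero => simp [sym_nil]
  | succ n ih => rw [List.replicate_succ, sym_cons_false, ih]

/-- Pair `raise` of `sym t k` with `sym t (k + 1)` and evaluate once by `raise_sym`, once by the
transpose relation. -/
theorem gb_succ_right {t : K} (h : Generic t) (n k : ℕ) :
    qi t (k + 1) * gb t n (k + 1) = t ^ ((n : ℤ) - 1 - 2 * k) * qi t ((n : ℤ) - k) * gb t n k := by
  unfold gb
  rw [← wsum_sym_succ_raise h, ← wsum_mul_left]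
  refine wsum_congr fun u _ => ?_
  rw [raise_sym h]
  ring

theorem gb_add {t : K} (h : Generic t) (k m : ℕ) :
    gb t (k + m) k = t ^ (k * m) * qFact t (k + m) / (qFact t k * qFact t m) := by
  have h0 := h.ne_zero
  induction k generalizing m with
  | zero => simp [gb_zero_right, qFact_zero, h.qFact_ne_zero]
  | succ k ih =>
    have h1 := gb_succ_right h (k + (m + 1)) k
    rw [ih] at h1
    have h2 : qi t ((k : ℤ) + 1) ≠ 0 := h.qi_ne_zero (by omega)
    have h3 : qi t ((m : ℤ) + 1) ≠ 0 := h.qi_ne_zero (by omega)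
    have h4 := h.qFact_ne_zero m
    have h5 := h.qFact_ne_zero k
    rw [show k + 1 + m = k + (m + 1) by ring]
    apply mul_left_cancel₀ h2
    rw [h1]
    push_cast
    rw [show (k : ℤ) + (m + 1) - k = m + 1 by ring, qFact_succ t m, qFact_succ t k]
    have h6 : t ^ ((k : ℤ) + (m + 1) - 1 - 2 * k) * t ^ (k * (m + 1)) = t ^ ((k + 1) * m) := by
      rw [← zpow_natCast, ← zpow_natCast, ← zpow_add₀ h0]
      congr 1
      push_cast
      ring
    rw [← h6]
    field_simp

theorem gb_ne_zero {t : K} (h : Generic t) {n k : ℕ} (hk : k ≤ n) : gb t n k ≠ 0 := by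
  obtain ⟨m, rfl⟩ := Nat.exists_eq_add_of_le hk
  rw [gb_add h]
  have := h.ne_zero
  have h1 := h.qFact_ne_zero
  exact div_ne_zero (mul_ne_zero (pow_ne_zero _ this) (h1 _)) (mul_ne_zero (h1 _) (h1 _))

theorem gb_eq_zero (t : K) {n k : ℕ} (hk : n < k) : gb t n k = 0 :=
  wsum_eq_zero fun u hu => by rw [sym_eq_zero t hk u hu, zero_mul]

theorem wsum_sym_mul_sym (t : K) (n k l : ℕ) :
    wsum n (fun u => sym t k u * sym t l u) = if k = l then gb t n k else 0 := by
  split_ifs with hkl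
  · subst hkl; rfl
  · refine wsum_eq_zero fun u _ => ?_
    unfold sym
    split_ifs <;> first | omega | simp

/-- Maps commuting with the quantum group: they preserve weights and commute with `raise`. -/
structure Equi (t : K) (m n : ℕ) (M : Ker K) : Prop where
  kap : ∀ u v : List Bool, u.length = m → v.length = n → M u v * kap t v = kap t u * M u v
  raise : ∀ (φ : List Bool → K) (u : List Bool), u.length = m →
    raise t u (opK n M φ) = opK n M (fun v => raise t v φ) u

theorem equi_id (t : K) (n : ℕ) : Equi t n n (idK : Ker K) where
  kap u v _ _ := by
    unfold idK
    split_ifs with h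
    · rw [h]; ring
    · ring
  raise φ u hu := by
    rw [opK_id _ u hu]
    exact raise_congr t u fun v hv => opK_id φ v (hv.trans hu)

theorem Equi.opK_kap {t : K} {m n : ℕ} {M : Ker K} (hM : Equi t m n M) (φ : List Bool → K)
    (u : List Bool) (hu : u.length = m) :
    opK n M (fun v => QSpin.kap t v * φ v) u = QSpin.kap t u * opK n M φ u := by
  simp only [opK, ← wsum_mul_left]
  refine wsum_congr fun v hv => ?_
  rw [← mul_assoc, hM.kap u v hu hv, mul_assoc]

theorem Equi.comp {t : K} {m n p : ℕ} {M N : Ker K} (hM : Equi t m n M) (hN : Equi t n p N) :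
    Equi t m p (comp n M N) where
  kap u v hu hv := by
    rw [comp_apply, ← wsum_mul_right, ← wsum_mul_left]
    refine wsum_congr fun w hw => ?_
    rw [mul_assoc, hN.kap w v hw hv, ← mul_assoc, hM.kap u w hu hw, mul_assoc]
  raise φ u hu := by
    rw [opK_comp, hM.raise _ u hu, opK_comp]
    exact congrFun (opK_congr M fun v hv => hN.raise φ v hv) u

theorem Equi.add {t : K} {m n : ℕ} {M N : Ker K} (hM : Equi t m n M) (hN : Equi t m n N) (c : K) :
    Equi t m n (fun u v => M u v + c * N u v) := by
  have key : ∀ φ : List Bool → K, opK n (fun u v => M u v + c * N u v) φ =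
      fun u => opK n M φ u + c * opK n N φ u := by
    intro φ
    funext u
    simp only [opK, ← wsum_mul_left, ← wsum_add]
    exact wsum_congr fun v _ => by ring
  constructor
  · intro u v hu hv
    rw [add_mul, hM.kap u v hu hv, mul_assoc, hN.kap u v hu hv]
    ring
  · intro φ u hu
    rw [key, key, raise_add, raise_mul_left, hM.raise φ u hu, hN.raise φ u hu]

theorem exists_append_of_length {m n : ℕ} (u : List Bool) (hu : u.length = m + n) :
    ∃ v w : List Bool, u = v ++ w ∧ v.length = m ∧ w.length = n :=
  ⟨u.take m, u.drop m, (List.take_append_drop m u).symm, by simp [hu], by simp [hu]⟩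

/-- By the coproduct rule, raising the left word multiplies by the weight of the right word.
Carrying this factor through `N` is where preservation of weights is needed in addition to
commutation with `raise`. -/
theorem Equi.tens {t : K} {m m' n n' : ℕ} {M N : Ker K} (hM : Equi t m m' M)
    (hN : Equi t n n' N) : Equi t (m + n) (m' + n') (tens m m' M N) where
  kap u v hu hv := by
    obtain ⟨u, u', rfl, hu, hu'⟩ := exists_append_of_length u hu
    obtain ⟨v, v', rfl, hv, hv'⟩ := exists_append_of_length v hv
    rw [tens_append M N hu hv, kap_append, kap_append,
      show M u v * N u' v' * (QSpin.kap t v * QSpin.kap t v') =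
        (M u v * QSpin.kap t v) * (N u' v' * QSpin.kap t v') by ring,
      hM.kap u v hu hv, hN.kap u' v' hu' hv']
    ring
  raise φ u hu := by
    obtain ⟨u, u', rfl, hu, hu'⟩ := exists_append_of_length u hu
    rw [raise_append, opK_tens M N _ hu]
    have e1 : QSpin.raise t u (fun w => opK (m' + n') (QSpin.tens m m' M N) φ (w ++ u')) =
        opK m' M (fun v => opK n' N (fun v' => QSpin.raise t v (fun w => φ (w ++ v'))) u') u := by
      rw [raise_congr t u (ψ := opK m' M (fun v => opK n' N (fun v' => φ (v ++ v')) u')) (fun v hv =>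
        opK_tens M N φ (hv.trans hu)), hM.raise _ u hu]
      congr 1
      funext v
      simp only [opK, raise_wsum, raise_mul_left]
    have e2 : QSpin.raise t u' (fun w => opK (m' + n') (QSpin.tens m m' M N) φ (u ++ w)) =
        opK m' M (fun v => opK n' N (fun v' => QSpin.raise t v' (fun w => φ (v ++ w))) u') u := by
      have : (fun w => opK (m' + n') (QSpin.tens m m' M N) φ (u ++ w)) =
          fun w => opK m' M (fun v => opK n' N (fun v' => φ (v ++ v')) w) u := by
        funext w; exact opK_tens M N φ hu
      rw [this]
      simp only [opK, raise_wsum, raise_mul_left]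
      refine wsum_congr fun v _ => ?_
      congr 1
      have := hN.raise (fun w => φ (v ++ w)) u' hu'
      rw [show opK n' N (fun w => φ (v ++ w)) = fun u => wsum n' (fun w => N u w * φ (v ++ w))
        from rfl] at this
      simp only [raise_wsum, raise_mul_left] at this
      exact this
    rw [e1, e2, ← opK_mul_left, ← opK_add]
    congr 1
    funext v
    rw [← hN.opK_kap _ u' hu', ← opK_add]
    congr 1
    funext v'
    rw [raise_append]

theorem zipWith_prod_snoc (g : Bool → Bool → K) (n : ℕ) (x y : Bool) (m : List Bool)
    (hm : m.length = 2 * n) :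
    (List.zipWith g ((x :: (m ++ [y])).take (n + 1))
      ((x :: (m ++ [y])).drop (n + 1)).reverse).prod =
    g x y * (List.zipWith g (m.take n) (m.drop n).reverse).prod := by
  have h1 : (m ++ [y]).take n = m.take n := by
    rw [List.take_append_of_le_length (by omega)]
  have h2 : (m ++ [y]).drop n = m.drop n ++ [y] := by
    rw [List.drop_append_of_le_length (by omega)]
  rw [List.take_succ_cons, List.drop_succ_cons, h1, h2]
  simp

theorem caps_succ (t : K) (n : ℕ) (x y : Bool) (m : List Bool) (hm : m.length = 2 * n)
    (v : List Bool) : caps t (n + 1) (x :: (m ++ [y])) v = capEntry t x y * caps t n m [] :=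
  zipWith_prod_snoc _ n x y m hm

theorem cups_succ (t : K) (n : ℕ) (x y : Bool) (m : List Bool) (hm : m.length = 2 * n)
    (u : List Bool) : cups t (n + 1) u (x :: (m ++ [y])) = cupEntry t x y * cups t n [] m :=
  zipWith_prod_snoc _ n x y m hm

theorem exists_cons_snoc_of_length {n : ℕ} (u : List Bool) (hu : u.length = 2 * (n + 1)) :
    ∃ x y m, u = x :: (m ++ [y]) ∧ m.length = 2 * n := by
  obtain ⟨v, w, rfl, hv, hw⟩ := exists_append_of_length (m := 1) (n := 2 * n + 1) u (by omega)
  obtain ⟨m, z, rfl, hm, hz⟩ := exists_append_of_length (m := 2 * n) (n := 1) w hw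
  obtain ⟨x, rfl⟩ := List.length_eq_one_iff.mp hv
  obtain ⟨y, rfl⟩ := List.length_eq_one_iff.mp hz
  exact ⟨x, y, m, rfl, hm⟩

theorem caps_mul_kap {t : K} (ht : t ≠ 0) (n : ℕ) (u v : List Bool) (hu : u.length = 2 * n) :
    kap t u * caps t n u v = caps t n u v := by
  induction n generalizing u v with
  | zero => simp at hu; subst hu; simp [kap]
  | succ n ih =>
    obtain ⟨x, y, m, rfl, hm⟩ := exists_cons_snoc_of_length u hu
    rw [caps_succ t n x y m hm, kap_cons, kap_append, kap_cons]
    have := ih m [] hm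
    cases x <;> cases y <;> simp [capEntry, kap_nil]
    · linear_combination t * t * t⁻¹ * this + (t * caps t n m []) * mul_inv_cancel₀ ht
    · linear_combination t * t⁻¹ * this + (caps t n m []) * mul_inv_cancel₀ ht

/-- Induct on the outermost cap. Raising an inner letter gives zero by induction. The two outer
letters contribute only when both are `true`, and then the terms cancel because t⁻¹ · (-t) + 1 = 0.
-/
theorem raise_caps {t : K} (ht : t ≠ 0) (n : ℕ) (u v : List Bool) (hu : u.length = 2 * n) :
    raise t u (fun w => caps t n w v) = 0 := by
  induction n generalizing u v with
  | zero => simp at hu; subst hu; rfl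
  | succ n ih =>
    obtain ⟨x, y, m, rfl, hm⟩ := exists_cons_snoc_of_length u hu
    have e1 : raise t m (fun w => caps t (n + 1) (x :: (w ++ [y])) v) = 0 := by
      rw [raise_congr t m (ψ := fun w => capEntry t x y * caps t n w []) fun w hw =>
        caps_succ t n x y w (hw.trans hm) v, raise_mul_left, ih m [] hm, mul_zero]
    rw [raise, raise_append, e1, mul_zero, zero_add, raise, raise, kap_append, kap_cons, kap_nil,
      caps_succ t n false y m hm, caps_succ t n x false m hm]
    have := caps_mul_kap ht n m [] hm
    cases x <;> cases y <;> simp [capEntry]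
    linear_combination (-t * t⁻¹) * this + (- caps t n m []) * mul_inv_cancel₀ ht

theorem cups_mul_kap {t : K} (ht : t ≠ 0) (n : ℕ) (u v : List Bool) (hv : v.length = 2 * n) :
    cups t n u v * kap t v = cups t n u v := by
  induction n generalizing u v with
  | zero => simp at hv; subst hv; simp [kap]
  | succ n ih =>
    obtain ⟨x, y, m, rfl, hm⟩ := exists_cons_snoc_of_length v hv
    rw [cups_succ t n x y m hm, kap_cons, kap_append, kap_cons]
    have := ih [] m hm
    cases x <;> cases y <;> simp [cupEntry, kap_nil]
    · linear_combination t * t⁻¹ * this + (cups t n [] m) * mul_inv_cancel₀ ht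
    · linear_combination t⁻¹ * t * t⁻¹ * this + (t⁻¹ * cups t n [] m) * mul_inv_cancel₀ ht

theorem wsum_cups_succ (t : K) (n : ℕ) (u : List Bool) (φ : List Bool → K) :
    wsum (2 * (n + 1)) (fun v => cups t (n + 1) u v * φ v) =
      wsum (2 * n) (fun m => cups t n [] m * φ (false :: (m ++ [true]))) -
      t⁻¹ * wsum (2 * n) (fun m => cups t n [] m * φ (true :: (m ++ [false]))) := by
  rw [show 2 * (n + 1) = (2 * n + 1) + 1 by ring, wsum_succ]
  simp only [wsum_snoc]
  rw [Fintype.sum_bool, ← wsum_mul_left, ← wsum_add, sub_eq_add_neg, ← neg_one_mul, ← wsum_mul_left,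
    ← wsum_add]
  refine wsum_congr fun m hm => ?_
  simp only [Fintype.sum_bool, cups_succ t n _ _ m hm, cupEntry]
  ring

/-- The dual of `raise_caps`: nested cups, read as functionals, annihilate the image of `raise`. -/
theorem wsum_cups_raise {t : K} (ht : t ≠ 0) (n : ℕ) (u : List Bool) (φ : List Bool → K) :
    wsum (2 * n) (fun v => cups t n u v * raise t v φ) = 0 := by
  induction n generalizing u φ with
  | zero => simp [wsum_zero, raise]
  | succ n ih =>
    rw [wsum_cups_succ]
    have e1 : ∀ x y : Bool, wsum (2 * n) (fun m => cups t n [] m *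
        raise t (x :: (m ++ [y])) φ) =
        (if x then (kap t [y]) * wsum (2 * n) (fun m => cups t n [] m * φ (false :: (m ++ [y])))
          else 0) + if y then wsum (2 * n) (fun m => cups t n [] m * φ (x :: (m ++ [false])))
          else 0 := by
      intro x y
      have e2 := ih [] (fun v => φ (x :: (v ++ [y])))
      have e3 : wsum (2 * n) (fun m => cups t n [] m * raise t (x :: (m ++ [y])) φ) =
          wsum (2 * n) (fun m => (if x then kap t [y] * (cups t n [] m * φ (false :: (m ++ [y])))
          else 0)) + (wsum (2 * n) (fun m => kap t [y] * (cups t n [] m *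
            raise t m (fun v => φ (x :: (v ++ [y]))))) +
          wsum (2 * n) (fun m => if y then cups t n [] m * φ (x :: (m ++ [false])) else 0)) := by
        rw [← wsum_add, ← wsum_add]
        refine wsum_congr fun m hm => ?_
        have h1 := cups_mul_kap ht n [] m hm
        rw [raise, raise_append, raise, raise, kap_append, kap_nil]
        cases x <;> cases y <;> simp
        · ring
        · ring
        · linear_combination (kap t [false] * φ (false :: (m ++ [false]))) * h1
        · linear_combination (kap t [true] * φ (false :: (m ++ [true]))) * h1
      rw [e3, wsum_mul_left, e2, mul_zero, zero_add]
      cases x <;> cases y <;> simp [wsum_const_zero, wsum_mul_left]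
    rw [e1, e1]
    simp [kap_cons, kap_nil, ht]

theorem equi_caps {t : K} (ht : t ≠ 0) (n : ℕ) : Equi t (2 * n) 0 (caps t n) where
  kap u v hu hv := by
    rw [List.length_eq_zero_iff] at hv
    subst hv
    rw [caps_mul_kap ht n u [] hu, kap_nil, mul_one]
  raise φ u hu := by
    have h1 : opK 0 (caps t n) φ = fun w => caps t n w [] * φ [] := by
      funext w; rw [opK, wsum_zero]
    rw [h1, raise_mul_right, raise_caps ht n u [] hu, opK, wsum_zero, raise, zero_mul, mul_zero]

theorem equi_cups {t : K} (ht : t ≠ 0) (n : ℕ) : Equi t 0 (2 * n) (cups t n) where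
  kap u v hu hv := by
    rw [List.length_eq_zero_iff] at hu
    subst hu
    rw [cups_mul_kap ht n [] v hv, kap_nil, one_mul]
  raise φ u hu := by
    rw [List.length_eq_zero_iff] at hu
    subst hu
    rw [raise]
    exact (wsum_cups_raise ht n [] φ).symm

theorem equi_jonesWenzl {t : K} (ht : t ≠ 0) (n : ℕ) : Equi t n n (jonesWenzl t n) := by
  induction n using Nat.strong_induction_on with
  | _ n ih =>
    match n, ih with
    | 0, _ => exact equi_id t 0
    | 1, _ => exact equi_id t 1
    | n + 2, ih =>
      have hp : Equi t (n + 2) (n + 2) (tens (n + 1) (n + 1) (jonesWenzl t (n + 1)) idK) :=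
        (ih (n + 1) (by omega)).tens (equi_id t 1)
      have hU : Equi t (n + 2) (n + 2)
          (tens n n idK (comp 0 (caps t 1) (cups t 1)) : Ker K) :=
        (equi_id t n).tens ((equi_caps ht 1).comp (equi_cups ht 1))
      exact hp.add ((hp.comp hU).comp hp) _

theorem equi_split {t : K} (ht : t ≠ 0) {k i j : ℕ} (hk : k = strands i k j + strands j k i)
    (hi : i = strands i k j + strands i j k) (hj : j = strands i j k + strands j k i) :
    Equi t k (i + j) (split t k i j) := by
  have := (equi_id t (strands i k j)).tens ((equi_cups ht (strands i j k)).tens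
    (equi_id t (strands j k i)))
  rw [zero_add, ← hk, show strands i k j + (2 * strands i j k + strands j k i) = i + j by omega]
    at this
  exact this

theorem equi_merge {t : K} (ht : t ≠ 0) {k i j : ℕ} (hk : k = strands i k j + strands j k i)
    (hi : i = strands i k j + strands i j k) (hj : j = strands i j k + strands j k i) :
    Equi t (i + j) k (merge t i j k) := by
  have := (equi_id t (strands i k j)).tens ((equi_caps ht (strands i j k)).tens
    (equi_id t (strands j k i)))
  rw [zero_add, ← hk, show strands i k j + (2 * strands i j k + strands j k i) = i + j by omega]
    at this
  exact this

end Equivariance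

end QSpin


namespace QSpin

/-! ### Explicit entries of the Jones–Wenzl projector -/

section JonesWenzl

variable {K : Type*} [Field K]

theorem idK_comm (u v : List Bool) : (idK u v : K) = idK v u := by
  unfold idK
  by_cases h : u = v
  · rw [if_pos h, if_pos h.symm]
  · rw [if_neg h, if_neg fun h' => h h'.symm]

theorem wsum_mul_idK {n : ℕ} (f : List Bool → K) (u : List Bool) (hu : u.length = n) :
    wsum n (fun w => f w * idK w u) = f u := by
  have h1 := opK_id f u hu
  rw [opK] at h1
  rw [← h1]
  exact wsum_congr fun v _ => by rw [idK_comm]; ring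

theorem caps_one (t : K) (x y : Bool) (v : List Bool) : caps t 1 [x, y] v = capEntry t x y := by
  simp [caps]

theorem cups_one (t : K) (x y : Bool) (u : List Bool) : cups t 1 u [x, y] = cupEntry t x y := by
  simp [cups]

theorem wsum_two (f : List Bool → K) : wsum 2 f = ∑ x : Bool, ∑ y : Bool, f [x, y] := by
  rw [wsum_succ]
  refine Finset.sum_congr rfl fun x _ => ?_
  rw [wsum_one]

theorem tens_snoc_idK (n : ℕ) (A : Ker K) {u v : List Bool} (hu : u.length = n)
    (hv : v.length = n) (x y : Bool) :
    tens n n A idK (u ++ [x]) (v ++ [y]) = if x = y then A u v else 0 := by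
  rw [tens_append A idK hu hv]
  simp [idK]

/-- Sums out all identity strands. The turn-back on the last two strands separates the two copies of
`A`, which stay linked only through the first `n` strands. -/
theorem comp_capcup_comp (t : K) (n : ℕ) (A : Ker K) {u v : List Bool} (hu : u.length = n + 1)
    (hv : v.length = n + 1) (x y : Bool) :
    comp (n + 2) (comp (n + 2) (tens (n + 1) (n + 1) A idK)
      (tens n n idK (comp 0 (caps t 1) (cups t 1)))) (tens (n + 1) (n + 1) A idK)
      (u ++ [x]) (v ++ [y]) =
    wsum n (fun s => (∑ z : Bool, A u (s ++ [z]) * capEntry t z x) *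
      (∑ z : Bool, cupEntry t z y * A (s ++ [z]) v)) := by
  have e1 : ∀ s q : List Bool, s.length = n → q.length = 2 →
      comp (n + 2) (tens (n + 1) (n + 1) A idK)
        (tens n n idK (comp 0 (caps t 1) (cups t 1))) (u ++ [x]) (s ++ q) =
      (∑ z : Bool, A u (s ++ [z]) * capEntry t z x) * cups t 1 [] q := by
    intro s q hs hq
    rw [comp_apply, wsum_add_length]
    rw [wsum_congr (g := fun w => (∑ z : Bool, A u (w ++ [z]) * capEntry t z x) * cups t 1 [] q *
      idK w s)]
    · exact wsum_mul_idK _ s hs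
    · intro w hw
      rw [wsum_two, Finset.sum_mul, Finset.sum_mul]
      refine Finset.sum_congr rfl fun z _ => ?_
      have e2 : ∀ x' : Bool, tens (n + 1) (n + 1) A idK (u ++ [x]) (w ++ [z, x']) *
          tens n n idK (comp 0 (caps t 1) (cups t 1)) (w ++ [z, x']) (s ++ q) =
          if x' = x then A u (w ++ [z]) * capEntry t z x * cups t 1 [] q * idK w s else 0 := by
        intro x'
        rw [tens_append _ _ hw hs, show w ++ [z, x'] = (w ++ [z]) ++ [x'] by simp,
          tens_snoc_idK (n + 1) A hu (by simp [hw]), comp_apply, wsum_zero, caps_one]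
        by_cases hx : x' = x
        · subst hx; simp; ring
        · rw [if_neg hx, if_neg fun h => hx h.symm, zero_mul]
      simp only [e2, Finset.sum_ite_eq', Finset.mem_univ, if_true]
  rw [comp_apply, wsum_add_length]
  refine wsum_congr fun s hs => ?_
  rw [wsum_two]
  have e3 : ∀ z y' : Bool, comp (n + 2) (tens (n + 1) (n + 1) A idK)
      (tens n n idK (comp 0 (caps t 1) (cups t 1))) (u ++ [x]) (s ++ [z, y']) *
      tens (n + 1) (n + 1) A idK (s ++ [z, y']) (v ++ [y]) =
      if y' = y then (∑ z : Bool, A u (s ++ [z]) * capEntry t z x) *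
        (cupEntry t z y * A (s ++ [z]) v) else 0 := by
    intro z y'
    rw [e1 s _ hs rfl, show s ++ [z, y'] = (s ++ [z]) ++ [y'] by simp,
      tens_snoc_idK (n + 1) A (by simp [hs]) hv, cups_one]
    by_cases hy : y' = y
    · subst hy; simp; ring
    · rw [if_neg hy, if_neg hy, mul_zero]
  simp only [e3, Finset.sum_ite_eq', Finset.mem_univ, if_true]
  rw [Finset.mul_sum]

theorem sym_snoc_false (t : K) (k : ℕ) (u : List Bool) :
    sym t k (u ++ [false]) = t ^ k * sym t k u := by
  by_cases hk : u.count true = k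
  · simp [sym, inversions_append, hk, inversions, pow_add, mul_comm]
  · simp [sym, hk]

theorem sym_zero_snoc_true (t : K) (u : List Bool) : sym t 0 (u ++ [true]) = 0 := by
  simp [sym]

theorem sym_succ_snoc_true (t : K) (k : ℕ) (u : List Bool) :
    sym t (k + 1) (u ++ [true]) = sym t k u := by
  simp [sym, inversions_append, inversions]

/-- This identity and the next two are Wenzl's recursion for a single matrix entry, when the last
letters of the two words are different, both `false`, or both `true`. -/
theorem gb_identity_mixed {t : K} (h : Generic t) (k r : ℕ) :
    t ^ (k + 1) / gb t (k + r + 2) (k + 1) =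
      qi t ((k : ℤ) + r + 1) / qi t ((k : ℤ) + r + 2) *
        (t ^ k * gb t (k + r) k / (gb t (k + r + 1) (k + 1) * gb t (k + r + 1) k)) := by
  have h0 := h.ne_zero
  have hf := h.qFact_ne_zero
  rw [show k + r + 2 = (k + 1) + (r + 1) by ring, gb_add h,
    show k + r + 1 = k + (r + 1) by ring, gb_add h k (r + 1),
    show k + (r + 1) = (k + 1) + r by ring, gb_add h (k + 1) r, gb_add h k r,
    show k + 1 + (r + 1) = (k + r + 1) + 1 by ring, show k + 1 + r = k + r + 1 by ring,
    qFact_succ t (k + r + 1), qFact_succ t (k + r), qFact_succ t k, qFact_succ t r]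
  have h1 : qi t ((k : ℤ) + 1) ≠ 0 := h.qi_ne_zero (by omega)
  have h2 : qi t ((r : ℤ) + 1) ≠ 0 := h.qi_ne_zero (by omega)
  have h3 : qi t ((k : ℤ) + r + 1) ≠ 0 := h.qi_ne_zero (by omega)
  have h4 : qi t ((k : ℤ) + r + 2) ≠ 0 := h.qi_ne_zero (by omega)
  have h5 := hf k
  have h6 := hf r
  have h7 := hf (k + r)
  push_cast
  rw [show (k : ℤ) + r + 1 + 1 = k + r + 2 by ring]
  field_simp
  ring

theorem gb_identity_false {t : K} (h : Generic t) (k r : ℕ) :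
    t ^ (2 * (k + 1)) / gb t (k + r + 2) (k + 1) =
      1 / gb t (k + r + 1) (k + 1) - qi t ((k : ℤ) + r + 1) / qi t ((k : ℤ) + r + 2) * t⁻¹ *
        (gb t (k + r) k / (gb t (k + r + 1) (k + 1)) ^ 2) := by
  have h0 := h.ne_zero
  have hf := h.qFact_ne_zero
  rw [show k + r + 2 = (k + 1) + (r + 1) by ring, gb_add h,
    show k + r + 1 = (k + 1) + r by ring, gb_add h (k + 1) r, gb_add h k r,
    show k + 1 + (r + 1) = (k + r + 1) + 1 by ring, show k + 1 + r = k + r + 1 by ring,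
    qFact_succ t (k + r + 1), qFact_succ t (k + r), qFact_succ t k, qFact_succ t r]
  have h1 : qi t ((k : ℤ) + 1) ≠ 0 := h.qi_ne_zero (by omega)
  have h2 : qi t ((r : ℤ) + 1) ≠ 0 := h.qi_ne_zero (by omega)
  have h3 : qi t ((k : ℤ) + r + 1) ≠ 0 := h.qi_ne_zero (by omega)
  have h4 : qi t ((k : ℤ) + r + 2) ≠ 0 := h.qi_ne_zero (by omega)
  have h5 := hf k
  have h6 := hf r
  have h7 := hf (k + r)
  have h8 : t ^ (r + 1) * qi t ((k : ℤ) + r + 2) =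
      t ^ (k + r + 2) * qi t ((r : ℤ) + 1) + qi t ((k : ℤ) + 1) := by
    rw [show (k : ℤ) + r + 2 = (r + 1) + (k + 1) by ring, qi_add h]
    rw [zpow_neg, show ((r : ℤ) + 1) = ((r + 1 : ℕ) : ℤ) by push_cast; ring,
      show ((k : ℤ) + 1) = ((k + 1 : ℕ) : ℤ) by push_cast; ring, zpow_natCast, zpow_natCast]
    field_simp
    ring
  push_cast
  rw [show (k : ℤ) + r + 1 + 1 = k + r + 2 by ring]
  field_simp
  linear_combination (-t * t ^ k * t ^ (2 * (k * r)) * t ^ r) * h8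

theorem gb_identity_true {t : K} (h : Generic t) (k r : ℕ) :
    1 / gb t (k + r + 2) (k + 1) =
      1 / gb t (k + r + 1) k - qi t ((k : ℤ) + r + 1) / qi t ((k : ℤ) + r + 2) * t *
        (t ^ (2 * k) * gb t (k + r) k / (gb t (k + r + 1) k) ^ 2) := by
  have h0 := h.ne_zero
  have hf := h.qFact_ne_zero
  rw [show k + r + 2 = (k + 1) + (r + 1) by ring, gb_add h,
    show k + r + 1 = k + (r + 1) by ring, gb_add h k (r + 1), gb_add h k r,
    show k + 1 + (r + 1) = (k + r + 1) + 1 by ring, show k + (r + 1) = k + r + 1 by ring,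
    qFact_succ t (k + r + 1), qFact_succ t (k + r), qFact_succ t k, qFact_succ t r]
  have h1 : qi t ((k : ℤ) + 1) ≠ 0 := h.qi_ne_zero (by omega)
  have h2 : qi t ((r : ℤ) + 1) ≠ 0 := h.qi_ne_zero (by omega)
  have h3 : qi t ((k : ℤ) + r + 1) ≠ 0 := h.qi_ne_zero (by omega)
  have h4 : qi t ((k : ℤ) + r + 2) ≠ 0 := h.qi_ne_zero (by omega)
  have h5 := hf k
  have h6 := hf r
  have h7 := hf (k + r)
  have h8 : t ^ (r + 1) * qi t ((k : ℤ) + r + 2) =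
      t ^ (k + r + 2) * qi t ((r : ℤ) + 1) + qi t ((k : ℤ) + 1) := by
    rw [show (k : ℤ) + r + 2 = (r + 1) + (k + 1) by ring, qi_add h]
    rw [zpow_neg, show ((r : ℤ) + 1) = ((r + 1 : ℕ) : ℤ) by push_cast; ring,
      show ((k : ℤ) + 1) = ((k + 1 : ℕ) : ℤ) by push_cast; ring, zpow_natCast, zpow_natCast]
    field_simp
    ring
  push_cast
  rw [show (k : ℤ) + r + 1 + 1 = k + r + 2 by ring]
  field_simp
  linear_combination (-t ^ (2 * k) * t ^ (2 * (k * r))) * h8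

/-- The right side is the orthogonal projection onto the span of the weight vectors for the standard
pairing. It is verified against Wenzl's recursion entry by entry, splitting off the last letters;
orthogonality of weight vectors evaluates the middle sum. -/
theorem jonesWenzl_apply {t : K} (h : Generic t) (n : ℕ) (u v : List Bool) (hu : u.length = n)
    (hv : v.length = n) :
    jonesWenzl t n u v = t ^ inversions u * sym t (u.count true) v / gb t n (u.count true) := by
  have h0 := h.ne_zero
  induction n using Nat.strong_induction_on generalizing u v with
  | _ n ih =>
    match n, ih with
    | 0, _ =>
      rw [List.length_eq_zero_iff] at hu hv
      subst hu hv
      simp [jonesWenzl, idK, inversions, sym, gb_zero_right]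
    | 1, _ =>
      obtain ⟨x, rfl⟩ := List.length_eq_one_iff.mp hu
      obtain ⟨y, rfl⟩ := List.length_eq_one_iff.mp hv
      have h1 : gb t 1 1 = 1 := by
        have := gb_add h 1 0
        simpa [qFact_zero, h.qFact_ne_zero] using this
      cases x <;> cases y <;> simp [jonesWenzl, idK, inversions, sym, gb_zero_right, h1]
    | n + 2, ih =>
      obtain ⟨u, x, rfl, hu', hx⟩ := exists_append_of_length (m := n + 1) (n := 1) u hu
      obtain ⟨v, y, rfl, hv', hy⟩ := exists_append_of_length (m := n + 1) (n := 1) v hv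
      clear hu hv
      rename' hu' => hu, hv' => hv
      obtain ⟨x, rfl⟩ := List.length_eq_one_iff.mp hx
      obtain ⟨y, rfl⟩ := List.length_eq_one_iff.mp hy
      have ih1 := fun u v hu hv => ih (n + 1) (by omega) u v hu hv
      -- The entry is symmetric in its two words: it vanishes unless both have the same number of
      -- `true`. The transposed form is needed for the second factor of the product.
      have ih2 : ∀ u v : List Bool, u.length = n + 1 → v.length = n + 1 →
          jonesWenzl t (n + 1) u v =
            sym t (v.count true) u * t ^ inversions v / gb t (n + 1) (v.count true) := by
        intro u v hu hv
        rw [ih1 u v hu hv]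
        by_cases huv : u.count true = v.count true
        · simp [sym, huv]
        · have : ¬ v.count true = u.count true := fun h => huv h.symm
          simp [sym, huv, this]
      rw [jonesWenzl]
      simp only [qInt_eq_qi]
      rw [tens_snoc_idK (n + 1) _ hu hv, comp_capcup_comp t n _ hu hv]
      have hcu := count_true_le u
      have hcv := count_true_le v
      set m := u.count true with hm
      set m' := v.count true with hm'
      have e1 : ∀ s : List Bool, s.length = n → ∀ z, jonesWenzl t (n + 1) u (s ++ [z]) =
          t ^ inversions u / gb t (n + 1) m * sym t m (s ++ [z]) := by
        intro s hs z
        rw [ih1 u _ hu (by simp [hs])]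
        ring
      have e2 : ∀ s : List Bool, s.length = n → ∀ z, jonesWenzl t (n + 1) (s ++ [z]) v =
          t ^ inversions v / gb t (n + 1) m' * sym t m' (s ++ [z]) := by
        intro s hs z
        rw [ih2 _ v (by simp [hs]) hv]
        ring
      have e3 : wsum n (fun s => (∑ z : Bool, jonesWenzl t (n + 1) u (s ++ [z]) * capEntry t z x) *
          (∑ z : Bool, cupEntry t z y * jonesWenzl t (n + 1) (s ++ [z]) v)) =
          t ^ inversions u / gb t (n + 1) m * (t ^ inversions v / gb t (n + 1) m') *
            (capEntry t (!x) x * cupEntry t (!y) y) *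
            wsum n (fun s => sym t m (s ++ [!x]) * sym t m' (s ++ [!y])) := by
        rw [← wsum_mul_left]
        refine wsum_congr fun s hs => ?_
        simp only [e1 s hs, e2 s hs]
        cases x <;> cases y <;> simp [capEntry, cupEntry] <;> ring
      rw [e3, ih1 u v hu hv, ← hm, inversions_append, List.count_append, ← hm]
      have hsv : ∀ k, sym t k v = if m' = k then t ^ inversions v else 0 := fun k => rfl
      have hqn : ∀ k r : ℕ, k + r = n → qi t ((n : ℤ) + 1) = qi t ((k : ℤ) + r + 1) ∧
          qi t ((n : ℤ) + 2) = qi t ((k : ℤ) + r + 2) := by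
        rintro k r rfl
        push_cast
        exact ⟨rfl, rfl⟩
      clear_value m m'
      clear e1 e2 e3 ih ih1 ih2
      cases x <;> cases y
      · rw [sym_snoc_false]
        simp only [if_true, Bool.not_false, capEntry, cupEntry, inversions, List.count_cons,
          List.count_nil, Bool.false_eq_true, if_false]
        simp only [beq_iff_eq, Bool.false_eq_true, if_false, add_zero, hsv]
        by_cases hmm : m' = m
        · subst hmm
          cases m' with
          | zero => simp [sym_zero_snoc_true, wsum_const_zero, gb_zero_right]
          | succ k =>
            simp only [sym_succ_snoc_true, wsum_sym_mul_sym, if_true]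
            obtain ⟨r, hr⟩ := Nat.exists_eq_add_of_le (show k ≤ n by omega)
            subst hr
            have key := gb_identity_false h k r
            have hq := hqn k r rfl
            push_cast at hq ⊢
            simp only [hq.1, hq.2]
            simp
            linear_combination (- t ^ inversions u * t ^ inversions v) * key
        · rw [if_neg hmm]
          cases m with
          | zero => simp [sym_zero_snoc_true, wsum_const_zero]
          | succ k =>
            cases m' with
            | zero => simp [sym_zero_snoc_true, wsum_const_zero]
            | succ k' =>
              simp only [sym_succ_snoc_true, wsum_sym_mul_sym]
              rw [if_neg (by omega)]
              simp
      · simp only [Bool.false_eq_true, if_false, Bool.not_false, Bool.not_true, capEntry, cupEntry,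
          inversions, List.count_cons, List.count_nil]
        cases m with
        | zero => simp [sym_zero_snoc_true, wsum_const_zero]
        | succ k =>
          simp only [sym_succ_snoc_true, sym_snoc_false]
          simp
          rw [sym_succ_snoc_true, hsv]
          have e4 : wsum n (fun s => sym t k s * (t ^ m' * sym t m' s)) =
              t ^ m' * if k = m' then gb t n k else 0 := by
            rw [← wsum_sym_mul_sym, ← wsum_mul_left]
            exact wsum_congr fun s _ => by ring
          rw [e4]
          by_cases hk : m' = k
          · subst hk
            obtain ⟨r, hr⟩ := Nat.exists_eq_add_of_le (show m' ≤ n by omega)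
            subst hr
            have key := gb_identity_mixed h m' r
            have hq := hqn m' r rfl
            push_cast at hq
            simp only [Nat.cast_add, hq.1, hq.2]
            simp
            linear_combination (- t ^ inversions u * t ^ inversions v) * key
          · rw [if_neg hk, if_neg fun h => hk h.symm]
            simp
      · simp only [Bool.true_eq_false, if_false, Bool.not_false, Bool.not_true, capEntry, cupEntry,
          inversions, List.count_cons, List.count_nil]
        cases m' with
        | zero =>
          simp only [sym_zero_snoc_true, sym_snoc_false]
          simp [wsum_const_zero, hsv]
        | succ k =>
          simp only [sym_succ_snoc_true, sym_snoc_false]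
          simp [mul_inv_cancel₀ h0]
          rw [hsv]
          have e4 : wsum n (fun s => t ^ m * sym t m s * sym t k s) =
              t ^ m * if m = k then gb t n m else 0 := by
            rw [← wsum_sym_mul_sym, ← wsum_mul_left]
            exact wsum_congr fun s _ => by ring
          rw [e4]
          by_cases hk : m = k
          · subst hk
            obtain ⟨r, hr⟩ := Nat.exists_eq_add_of_le (show m ≤ n by omega)
            subst hr
            have key := gb_identity_mixed h m r
            have hq := hqn m r rfl
            push_cast at hq
            simp only [Nat.cast_add, hq.1, hq.2]
            simp
            linear_combination (- t ^ inversions u * t ^ inversions v) * key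
          · rw [if_neg hk, if_neg fun h => hk (by omega)]
            simp
      · simp only [if_true, Bool.not_true, capEntry, cupEntry, inversions, List.count_cons,
          List.count_nil, sym_snoc_false]
        simp
        rw [sym_succ_snoc_true, hsv]
        have e4 : wsum n (fun s => t ^ m * sym t m s * (t ^ m' * sym t m' s)) =
            t ^ m * t ^ m' * if m = m' then gb t n m else 0 := by
          rw [← wsum_sym_mul_sym, ← wsum_mul_left]
          exact wsum_congr fun s _ => by ring
        rw [e4]
        by_cases hmm : m' = m
        · subst hmm
          -- The words consisting of `true` only are a separate corner: there `gb t n (n + 1) = 0`,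
          -- so the correction term is absent.
          rcases Nat.lt_or_ge n m' with hlt | hge
          · have hm1 : m' = n + 1 := by omega
            subst hm1
            rw [gb_eq_zero t hlt]
            have h1 : ∀ k, gb t k k = 1 := by
              intro k
              have := gb_add h k 0
              simpa [qFact_zero, h.qFact_ne_zero] using this
            rw [h1, h1]
            simp
          · obtain ⟨r, hr⟩ := Nat.exists_eq_add_of_le hge
            subst hr
            have key := gb_identity_true h m' r
            have hq := hqn m' r rfl
            push_cast at hq
            simp only [Nat.cast_add, hq.1, hq.2]
            simp
            linear_combination (- t ^ inversions u * t ^ inversions v) * key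
        · rw [if_neg hmm, if_neg fun h => hmm h.symm]
          simp

end JonesWenzl

end QSpin


namespace QSpin

/-! ### Planar closure as a quantum trace, and Schur's lemma -/

section Schur

variable {K : Type*} [Field K]

/-- The word that pairs nontrivially with `u` under nested cups or caps. -/
def bar (u : List Bool) : List Bool := (u.map not).reverse

theorem bar_length (u : List Bool) : (bar u).length = u.length := by simp [bar]

theorem bar_bar (u : List Bool) : bar (bar u) = u := by
  simp [bar, List.map_reverse, Function.comp_def]

theorem bar_count_true (u : List Bool) : (bar u).count true = u.count false := by
  unfold bar
  rw [List.count_reverse]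
  induction u with
  | nil => rfl
  | cons x u ih => cases x <;> simp [ih]

theorem bar_inversions (u : List Bool) : inversions (bar u) = inversions u := by
  induction u with
  | nil => rfl
  | cons x u ih =>
    have : bar (x :: u) = bar u ++ [!x] := by simp [bar]
    rw [this, inversions_append, ih, bar_count_true]
    cases x <;> simp [inversions]
    ring

theorem zipWith_entry_prod (g : Bool → Bool → K) (x y : K)
    (hg : ∀ a b, g a b = if b = !a then (if a then x else y) else 0) (v w : List Bool)
    (h : v.length = w.length) :
    (List.zipWith g v w).prod =
      if w = v.map not then x ^ v.count true * y ^ v.count false else 0 := by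
  induction v generalizing w with
  | nil =>
    have : w = [] := by simpa using h.symm
    subst this
    simp
  | cons a v ih =>
    cases w with
    | nil => simp at h
    | cons b w =>
      rw [List.zipWith_cons_cons, List.prod_cons, ih w (by simpa using h), hg]
      simp only [List.map_cons, List.cons.injEq]
      by_cases hb : b = !a
      · subst hb
        by_cases hw : w = v.map not
        · subst hw
          cases a
          · simp [pow_succ]
            ring
          · simp [pow_succ]
            ring
        · simp [hw]
      · simp [hb]

theorem cups_append (t : K) (n : ℕ) (u v w : List Bool) (hv : v.length = n) (hw : w.length = n) :
    cups t n u (v ++ w) = if w = bar v then (-t⁻¹) ^ v.count true else 0 := by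
  unfold cups
  rw [List.take_left' hv, List.drop_left' hv,
    zipWith_entry_prod (cupEntry t) (-t⁻¹) 1 (by intro a b; cases a <;> cases b <;> rfl) _ _
      (by simp [hv, hw])]
  have : w.reverse = v.map not ↔ w = bar v := by
    rw [bar, List.reverse_eq_iff]
  simp only [this, one_pow, mul_one]

theorem caps_append (t : K) (n : ℕ) (u v w : List Bool) (hv : v.length = n) (hw : w.length = n) :
    caps t n (v ++ w) u = if w = bar v then (-t) ^ v.count false else 0 := by
  unfold caps
  rw [List.take_left' hv, List.drop_left' hv,
    zipWith_entry_prod (capEntry t) 1 (-t) (by intro a b; cases a <;> cases b <;> rfl) _ _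
      (by simp [hv, hw])]
  have : w.reverse = v.map not ↔ w = bar v := by
    rw [bar, List.reverse_eq_iff]
  simp only [this, one_pow, one_mul]

/-- The nested cups and caps force the returning strands to carry `bar x`. Their entries multiply to
(-t⁻¹)^{#true} (-t)^{#false}, which is (-1)^n times the weight of `x`. -/
theorem closure_eq {t : K} (ht : t ≠ 0) (n : ℕ) (M : Ker K) :
    closure t n M = (-1) ^ n * wsum n (fun x => kap t x * M x x) := by
  rw [closure, comp_apply, two_mul, wsum_add_length, ← wsum_mul_left]
  refine wsum_congr fun x hx => ?_
  rw [wsum_congr (g := fun y => if y = bar x then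
    (-t⁻¹) ^ x.count true * (M x x * (-t) ^ x.count false) else 0), wsum_ite_eq _ (by simp [bar, hx])]
  · have hc := count_false_add_count_true x
    rw [kap_eq t ht, neg_pow t⁻¹, neg_pow t, ← hx, ← hc, inv_pow, pow_add]
    rw [show ((x.count false + x.count true : ℕ) : ℤ) - 2 * (x.count true : ℤ) =
      (x.count false : ℤ) - (x.count true : ℤ) by push_cast; ring, zpow_sub₀ ht, zpow_natCast,
      zpow_natCast]
    field_simp
  · intro y hy
    rw [cups_append t n _ x y hx hy]
    by_cases hyx : y = bar x
    · rw [if_pos hyx, if_pos hyx]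
      congr 1
      rw [comp_apply, wsum_add_length]
      rw [wsum_congr (g := fun x' => if x' = x then M x x * (-t) ^ x.count false else 0),
        wsum_ite_eq _ hx]
      intro x' hx'
      rw [wsum_congr (g := fun y' => if y' = y then
        M x x' * caps t n (x' ++ y) [] else 0), wsum_ite_eq _ hy, caps_append t n _ x' y hx' hy]
      · by_cases hxx : x' = x
        · rw [if_pos hxx, hxx, if_pos hyx]
        · rw [if_neg hxx, if_neg, mul_zero]
          intro h1
          rw [hyx] at h1
          apply hxx
          rw [← bar_bar x', ← h1, bar_bar]
      · intro y' _
        rw [tens_append _ _ hx hx']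
        by_cases hyy : y' = y
        · rw [if_pos hyy, hyy]; simp [idK]
        · rw [if_neg hyy]
          have : ¬ y = y' := fun h => hyy h.symm
          simp [idK, this]
    · rw [if_neg hyx, if_neg hyx, zero_mul]

/-- The pairing of `φ` with a weight vector. -/
def pair (t : K) (n k : ℕ) (φ : List Bool → K) : K := wsum n (fun u => sym t k u * φ u)

theorem jonesWenzl_eq_sum {t : K} (h : Generic t) (n : ℕ) (u v : List Bool) (hu : u.length = n)
    (hv : v.length = n) :
    jonesWenzl t n u v = ∑ k ∈ Finset.range (n + 1), sym t k u * sym t k v / gb t n k := by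
  rw [jonesWenzl_apply h n u v hu hv, Finset.sum_eq_single (u.count true)]
  · simp [sym]
  · intro k _ hk
    rw [sym, if_neg fun h => hk h.symm]
    simp
  · intro hk
    have := count_true_le u
    simp at hk
    omega

theorem opK_jonesWenzl {t : K} (h : Generic t) (n : ℕ) (φ : List Bool → K) (u : List Bool)
    (hu : u.length = n) :
    opK n (jonesWenzl t n) φ u =
      ∑ k ∈ Finset.range (n + 1), sym t k u * (pair t n k φ / gb t n k) := by
  unfold opK pair
  rw [wsum_congr (g := fun v => ∑ k ∈ Finset.range (n + 1),
    (sym t k u / gb t n k) * (sym t k v * φ v)), wsum_sum]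
  · refine Finset.sum_congr rfl fun k _ => ?_
    rw [wsum_mul_left]
    ring
  · intro v hv
    rw [jonesWenzl_eq_sum h n u v hu hv, Finset.sum_mul]
    exact Finset.sum_congr rfl fun k _ => by ring

theorem sum_zpow_eq_qi {t : K} (h : Generic t) (n : ℕ) :
    ∑ k ∈ Finset.range (n + 1), t ^ ((n : ℤ) - 2 * k) = qi t (n + 1) := by
  have h0 := h.ne_zero
  induction n with
  | zero => simp [h.qi_one]
  | succ n ih =>
    rw [Finset.sum_range_succ']
    have e1 : ∀ k : ℕ, t ^ (((n + 1 : ℕ) : ℤ) - 2 * ((k + 1 : ℕ) : ℤ)) =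
        t ^ (-1 : ℤ) * t ^ ((n : ℤ) - 2 * k) := by
      intro k
      rw [← zpow_add₀ h0]
      congr 1
      push_cast
      ring
    simp only [e1]
    rw [← Finset.mul_sum, ih]
    have := qi_add h 1 ((n : ℤ) + 1)
    rw [h.qi_one] at this
    push_cast
    rw [show (n : ℤ) + 1 + 1 = 1 + (n + 1) by ring, this, sub_zero]
    ring

/-- Schur's lemma on the irreducible string: the diagonal coefficient at `sym t (k + 1)` equals the
one at `sym t k`, because `raise` passes through `Y` and its transpose returns the pairing to level
`k`. -/
theorem Equi.pair_eq {t : K} (h : Generic t) {n : ℕ} {Y : Ker K} (hY : Equi t n n Y) {k : ℕ}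
    (hk : k ≤ n) :
    pair t n k (opK n Y (sym t k)) / gb t n k = opK n Y (sym t 0) (List.replicate n false) := by
  induction k with
  | zero => rw [pair, wsum_sym_zero_mul, gb_zero_right, div_one]
  | succ k ih =>
    rw [← ih (by omega)]
    have h1 := wsum_sym_succ_raise h n k (opK n Y (sym t k))
    have h2 : wsum n (fun u => sym t (k + 1) u * QSpin.raise t u (opK n Y (sym t k))) =
        qi t (k + 1) * pair t n (k + 1) (opK n Y (sym t (k + 1))) := by
      rw [pair, ← wsum_mul_left]
      refine wsum_congr fun u hu => ?_
      rw [hY.raise _ u hu]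
      have : (fun v => QSpin.raise t v (sym t k)) = fun v => qi t (k + 1) * sym t (k + 1) v := by
        funext v; rw [raise_sym h]
      rw [this, opK_mul_left]
      ring
    rw [h2] at h1
    have h3 := gb_succ_right h n k
    have h4 : qi t ((k : ℤ) + 1) ≠ 0 := h.qi_ne_zero (by omega)
    have h5 := gb_ne_zero h hk
    have h6 := gb_ne_zero h (show k ≤ n by omega)
    rw [div_eq_div_iff h5 h6]
    apply mul_left_cancel₀ h4
    rw [← mul_assoc, h1]
    change _ = qi t ((k : ℤ) + 1) * (pair t n k (opK n Y (sym t k)) * gb t n (k + 1))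
    rw [mul_left_comm, h3, pair]
    ring

/-- In the quantum trace the projector leaves one diagonal coefficient for each weight vector. They
all agree by Schur's lemma, and the weights t^{n-2k} add up to [n+1]. -/
theorem closure_jonesWenzl_comp {t : K} (h : Generic t) {n : ℕ} {Y : Ker K}
    (hY : Equi t n n Y) :
    closure t n (comp n (jonesWenzl t n) Y) =
      (-1) ^ n * qi t (n + 1) * opK n Y (sym t 0) (List.replicate n false) := by
  have h0 := h.ne_zero
  rw [closure_eq h0, mul_assoc, ← sum_zpow_eq_qi h, Finset.sum_mul]
  congr 1
  rw [wsum_congr (g := fun x => ∑ k ∈ Finset.range (n + 1),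
    t ^ ((n : ℤ) - 2 * k) / gb t n k * wsum n (fun u => sym t k u * (Y u x * sym t k x))), wsum_sum]
  · refine Finset.sum_congr rfl fun k hk => ?_
    rw [wsum_mul_left, wsum_comm]
    rw [← hY.pair_eq h (k := k) (by simpa using Finset.mem_range_succ_iff.mp hk)]
    simp only [wsum_mul_left]
    rw [pair]
    simp only [opK]
    ring
  · intro x hx
    rw [comp_apply, ← wsum_mul_left]
    rw [wsum_congr (g := fun u => ∑ k ∈ Finset.range (n + 1),
      t ^ ((n : ℤ) - 2 * k) / gb t n k * (sym t k u * (Y u x * sym t k x))), wsum_sum]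
    · exact Finset.sum_congr rfl fun k _ => wsum_mul_left _ _ _
    · intro u hu
      rw [jonesWenzl_eq_sum h n x u hx hu, Finset.sum_mul, Finset.mul_sum]
      refine Finset.sum_congr rfl fun k _ => ?_
      rw [show kap t x * (sym t k x * sym t k u / gb t n k * Y u x) =
        sym t k x * (kap t x * (sym t k u / gb t n k * Y u x)) by ring,
        show t ^ ((n : ℤ) - 2 * k) / gb t n k * (sym t k u * (Y u x * sym t k x)) =
        sym t k x * (t ^ ((n : ℤ) - 2 * k) * (sym t k u / gb t n k * Y u x)) by ring]
      refine sym_mul_congr t k x fun hc => ?_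
      rw [kap_eq t h0, hc, hx]

end Schur

end QSpin


namespace QSpin

/-! ### Expansion of the network into vertex coefficients -/

section Network

variable {K : Type*} [Field K]

/-- The tensor product of functions of words, the first of words of length `m`. -/
def tp (m : ℕ) (φ ψ : List Bool → K) : List Bool → K := fun u => φ (u.take m) * ψ (u.drop m)

theorem tp_append {m : ℕ} (φ ψ : List Bool → K) {u : List Bool} (v : List Bool)
    (hu : u.length = m) : tp m φ ψ (u ++ v) = φ u * ψ v := by
  rw [tp, List.take_left' hu, List.drop_left' hu]

/-- The pairing of a function on words of length `m + n` with a product of weight vectors. -/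
def pair₂ (t : K) (m n i j : ℕ) (φ : List Bool → K) : K :=
  wsum m (fun u => wsum n (fun v => sym t i u * sym t j v * φ (u ++ v)))

/-- Matrix coefficients of the vertex that joins two edges. -/
def mergeCoeff (t : K) (a b c i j k : ℕ) : K :=
  pair₂ t a b i j (opK c (merge t a b c) (sym t k))

/-- Matrix coefficients of the vertex that splits an edge. -/
def splitCoeff (t : K) (c a b k i j : ℕ) : K :=
  pair t c k (opK (a + b) (split t c a b) (tp a (sym t i) (sym t j)))

theorem pair_congr (t : K) (n k : ℕ) {φ ψ : List Bool → K}
    (h : ∀ u : List Bool, u.length = n → φ u = ψ u) : pair t n k φ = pair t n k ψ :=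
  wsum_congr fun u hu => by rw [h u hu]

theorem pair_sum {ι : Type*} (t : K) (n k : ℕ) (s : Finset ι) (φ : ι → List Bool → K) :
    pair t n k (fun u => ∑ i ∈ s, φ i u) = ∑ i ∈ s, pair t n k (φ i) := by
  simp only [pair, Finset.mul_sum, wsum_sum]

theorem pair_mul_left (t : K) (n k : ℕ) (c : K) (φ : List Bool → K) :
    pair t n k (fun u => c * φ u) = c * pair t n k φ := by
  simp only [pair, ← wsum_mul_left]
  exact wsum_congr fun v _ => by ring

theorem pair_pair (t : K) (m n i j : ℕ) (φ : List Bool → K) :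
    pair t m i (fun u => pair t n j (fun v => φ (u ++ v))) = pair₂ t m n i j φ := by
  simp only [pair, pair₂, ← wsum_mul_left]
  refine wsum_congr fun u _ => wsum_congr fun v _ => ?_
  ring

theorem pair_pair' (t : K) (m n i j : ℕ) (φ : List Bool → K) :
    pair t n j (fun v => pair t m i (fun u => φ (u ++ v))) = pair₂ t m n i j φ := by
  simp only [pair, pair₂, ← wsum_mul_left]
  rw [wsum_comm]
  refine wsum_congr fun u _ => wsum_congr fun v _ => ?_
  ring

theorem pair₂_tp (t : K) (m n i j k l : ℕ) :
    pair₂ t m n i j (tp m (sym t k) (sym t l)) =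
      if i = k ∧ j = l then gb t m i * gb t n j else 0 := by
  have : pair₂ t m n i j (tp m (sym t k) (sym t l)) =
      wsum m (fun u => sym t i u * sym t k u) * wsum n (fun v => sym t j v * sym t l v) := by
    rw [pair₂, ← wsum_mul_right]
    refine wsum_congr fun u hu => ?_
    rw [← wsum_mul_left]
    refine wsum_congr fun v _ => ?_
    rw [tp_append _ _ _ hu]
    ring
  rw [this, wsum_sym_mul_sym, wsum_sym_mul_sym]
  by_cases h1 : i = k <;> by_cases h2 : j = l <;> simp [h1, h2]

/-- The part `e → a ⊗ b → a ⊗ f ⊗ d → c ⊗ d` of the tetrahedral network. -/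
def treeKer (t : K) (a b c d e f : ℕ) : Ker K :=
  comp (a + b) (split t e a b)
    (comp (a + b) (tens a a (jonesWenzl t a) (jonesWenzl t b))
    (comp (a + (f + d)) (tens a a idK (split t b f d))
    (comp (a + (f + d)) (tens a a idK (tens f f (jonesWenzl t f) (jonesWenzl t d)))
    (comp (c + d) (tens (a + f) c (merge t a f c) idK)
      (tens c c (jonesWenzl t c) idK)))))

/-- The matrix coefficients of `treeKer` at the highest weight vector of the source. -/
def treeCoeff (t : K) (a b c d e f k s : ℕ) : K :=
  ∑ r ∈ Finset.range (f + 1), ∑ l ∈ Finset.range (a + 1), ∑ m ∈ Finset.range (b + 1),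
    mergeCoeff t a f c l r k / (gb t f r * gb t a l) * (splitCoeff t b f d m r s / gb t b m) *
      splitCoeff t e a b 0 l m

/-- Every projector is replaced by its expansion in weight vectors. Each edge then carries a label
and each vertex a matrix coefficient; `treeCoeff` sums over the labels of the interior edges, while
`k` and `s` label the outgoing edges c and d. -/
theorem opK_treeKer {t : K} (h : Generic t) (a b c d e f : ℕ) (φ : List Bool → K) :
    opK (c + d) (treeKer t a b c d e f) φ (List.replicate e false) =
      ∑ k ∈ Finset.range (c + 1), ∑ s ∈ Finset.range (d + 1),
        pair₂ t c d k s φ / (gb t c k * gb t d s) * treeCoeff t a b c d e f k s := by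
  simp only [treeKer, opK_comp]
  -- The functions `φ5`, …, `φ1` apply the layers of the network one after the other, beginning at
  -- the target end.
  set φ5 := opK (c + d) (tens c c (jonesWenzl t c) idK) φ with hφ5
  set φ4 := opK (c + d) (tens (a + f) c (merge t a f c) idK) φ5 with hφ4
  set φ3 := opK (a + (f + d)) (tens a a idK (tens f f (jonesWenzl t f) (jonesWenzl t d))) φ4
    with hφ3
  set φ2 := opK (a + (f + d)) (tens a a idK (split t b f d)) φ3 with hφ2
  set φ1 := opK (a + b) (tens a a (jonesWenzl t a) (jonesWenzl t b)) φ2 with hφ1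
  have h5 : ∀ v w : List Bool, v.length = c → w.length = d → φ5 (v ++ w) =
      ∑ k ∈ Finset.range (c + 1), sym t k v * (pair t c k (fun v' => φ (v' ++ w)) / gb t c k) := by
    intro v w hv hw
    rw [hφ5, opK_tens _ _ _ hv, opK_jonesWenzl h c _ v hv]
    refine Finset.sum_congr rfl fun k _ => ?_
    congr 2
    exact pair_congr t c k fun v' _ => opK_id _ w hw
  have h4 : ∀ x w : List Bool, x.length = a + f → w.length = d → φ4 (x ++ w) =
      ∑ k ∈ Finset.range (c + 1), opK c (merge t a f c) (sym t k) x *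
        (pair t c k (fun v' => φ (v' ++ w)) / gb t c k) := by
    intro x w hx hw
    rw [hφ4, opK_tens _ _ _ hx]
    rw [opK_congr (ψ := fun v => ∑ k ∈ Finset.range (c + 1), sym t k v *
      (pair t c k (fun v' => φ (v' ++ w)) / gb t c k)), opK_sum]
    · exact Finset.sum_congr rfl fun k _ => opK_mul_right _ _ _ _ _
    · intro v hv
      rw [opK_id _ w hw, h5 v w hv hw]
  have h3 : ∀ va vf vd : List Bool, va.length = a → vf.length = f → vd.length = d →
      φ3 (va ++ (vf ++ vd)) = ∑ k ∈ Finset.range (c + 1), ∑ s ∈ Finset.range (d + 1),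
        ∑ r ∈ Finset.range (f + 1), pair₂ t c d k s φ / (gb t c k * gb t d s) *
          (pair t f r (fun x => opK c (merge t a f c) (sym t k) (va ++ x)) / gb t f r *
            (sym t r vf * sym t s vd)) := by
    intro va vf vd hva hvf hvd
    have inner : ∀ x : List Bool, x.length = f →
        opK d (jonesWenzl t d) (fun y => φ4 (va ++ (x ++ y))) vd =
          ∑ k ∈ Finset.range (c + 1), ∑ s ∈ Finset.range (d + 1),
            opK c (merge t a f c) (sym t k) (va ++ x) *
              (pair₂ t c d k s φ / (gb t c k * gb t d s) * sym t s vd) := by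
      intro x hx
      rw [opK_jonesWenzl h d _ vd hvd, Finset.sum_comm]
      refine Finset.sum_congr rfl fun s _ => ?_
      have : pair t d s (fun y => φ4 (va ++ (x ++ y))) = ∑ k ∈ Finset.range (c + 1),
          opK c (merge t a f c) (sym t k) (va ++ x) * (pair₂ t c d k s φ / gb t c k) := by
        rw [pair_congr t d s (ψ := fun y => ∑ k ∈ Finset.range (c + 1),
          opK c (merge t a f c) (sym t k) (va ++ x) *
            ((gb t c k)⁻¹ * pair t c k (fun v' => φ (v' ++ y))))]
        · rw [pair_sum]
          refine Finset.sum_congr rfl fun k _ => ?_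
          rw [pair_mul_left, pair_mul_left, pair_pair']
          ring
        · intro y hy
          rw [← List.append_assoc, h4 (va ++ x) y (by simp [hva, hx]) hy]
          refine Finset.sum_congr rfl fun k _ => ?_
          ring
      rw [this, Finset.sum_div, Finset.mul_sum]
      refine Finset.sum_congr rfl fun k _ => ?_
      rw [← div_div]
      ring
    rw [hφ3, opK_tens _ _ _ hva, opK_id _ va hva, opK_tens _ _ _ hvf,
      opK_congr _ inner, opK_sum]
    refine Finset.sum_congr rfl fun k _ => ?_
    rw [opK_sum]
    refine Finset.sum_congr rfl fun s _ => ?_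
    rw [opK_mul_right, opK_jonesWenzl h f _ vf hvf, Finset.sum_mul]
    refine Finset.sum_congr rfl fun r _ => ?_
    ring
  have h2 : ∀ va vb : List Bool, va.length = a → vb.length = b →
      φ2 (va ++ vb) = ∑ k ∈ Finset.range (c + 1), ∑ s ∈ Finset.range (d + 1),
        ∑ r ∈ Finset.range (f + 1), pair₂ t c d k s φ / (gb t c k * gb t d s) *
          (pair t f r (fun x => opK c (merge t a f c) (sym t k) (va ++ x)) / gb t f r *
            opK (f + d) (split t b f d) (tp f (sym t r) (sym t s)) vb) := by
    intro va vb hva hvb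
    rw [hφ2, opK_tens _ _ _ hva, opK_id _ va hva]
    rw [opK_congr (ψ := fun w => ∑ k ∈ Finset.range (c + 1), ∑ s ∈ Finset.range (d + 1),
        ∑ r ∈ Finset.range (f + 1), pair₂ t c d k s φ / (gb t c k * gb t d s) *
          (pair t f r (fun x => opK c (merge t a f c) (sym t k) (va ++ x)) / gb t f r *
            tp f (sym t r) (sym t s) w))]
    · simp only [opK_sum, opK_mul_left]
    · intro w hw
      obtain ⟨vf, vd, rfl, hvf, hvd⟩ := exists_append_of_length w hw
      rw [h3 va vf vd hva hvf hvd]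
      simp only [tp_append _ _ _ hvf]
  have h1 : ∀ va vb : List Bool, va.length = a → vb.length = b →
      φ1 (va ++ vb) = ∑ k ∈ Finset.range (c + 1), ∑ s ∈ Finset.range (d + 1),
        ∑ r ∈ Finset.range (f + 1), ∑ l ∈ Finset.range (a + 1), ∑ m ∈ Finset.range (b + 1),
          pair₂ t c d k s φ / (gb t c k * gb t d s) *
          (mergeCoeff t a f c l r k / (gb t f r * gb t a l) * (splitCoeff t b f d m r s / gb t b m))
            * (sym t l va * sym t m vb) := by
    intro va vb hva hvb
    have inner : ∀ x : List Bool, x.length = a →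
        opK b (jonesWenzl t b) (fun y => φ2 (x ++ y)) vb =
          ∑ k ∈ Finset.range (c + 1), ∑ s ∈ Finset.range (d + 1), ∑ r ∈ Finset.range (f + 1),
            pair t f r (fun y => opK c (merge t a f c) (sym t k) (x ++ y)) *
            (pair₂ t c d k s φ / (gb t c k * gb t d s) * (gb t f r)⁻¹ *
              ∑ m ∈ Finset.range (b + 1), sym t m vb * (splitCoeff t b f d m r s / gb t b m)) := by
      intro x hx
      rw [opK_congr _ fun y hy => h2 x y hx hy]
      simp only [opK_sum, opK_mul_left]
      simp only [opK_jonesWenzl h b _ vb hvb, splitCoeff]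
      refine Finset.sum_congr rfl fun k _ => Finset.sum_congr rfl fun s _ =>
        Finset.sum_congr rfl fun r _ => ?_
      ring
    rw [hφ1, opK_tens _ _ _ hva, opK_congr _ inner]
    simp only [opK_sum, opK_mul_right]
    simp only [opK_jonesWenzl h a _ va hva, pair_pair, Finset.mul_sum, Finset.sum_mul, mergeCoeff]
    refine Finset.sum_congr rfl fun k _ => Finset.sum_congr rfl fun s _ =>
      Finset.sum_congr rfl fun r _ => ?_
    rw [Finset.sum_comm]
    refine Finset.sum_congr rfl fun l _ => Finset.sum_congr rfl fun m _ => ?_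
    rw [← div_div]
    ring
  have hsplit : ∀ l m, splitCoeff t e a b 0 l m =
      opK (a + b) (split t e a b) (tp a (sym t l) (sym t m)) (List.replicate e false) :=
    fun l m => wsum_sym_zero_mul t e _
  rw [opK_congr (ψ := fun w => ∑ k ∈ Finset.range (c + 1), ∑ s ∈ Finset.range (d + 1),
        ∑ r ∈ Finset.range (f + 1), ∑ l ∈ Finset.range (a + 1), ∑ m ∈ Finset.range (b + 1),
          pair₂ t c d k s φ / (gb t c k * gb t d s) *
          (mergeCoeff t a f c l r k / (gb t f r * gb t a l) * (splitCoeff t b f d m r s / gb t b m))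
            * tp a (sym t l) (sym t m) w)]
  · simp only [opK_sum, opK_mul_left, ← hsplit, treeCoeff, Finset.mul_sum]
    refine Finset.sum_congr rfl fun k _ => Finset.sum_congr rfl fun s _ =>
      Finset.sum_congr rfl fun r _ => Finset.sum_congr rfl fun l _ =>
      Finset.sum_congr rfl fun m _ => ?_
    ring
  · intro w hw
    obtain ⟨va, vb, rfl, hva, hvb⟩ := exists_append_of_length w hw
    rw [h1 va vb hva hvb]
    simp only [tp_append _ _ _ hva]

end Network

end QSpin


namespace QSpin

/-! ### Vertex coefficients at extremal weights -/

section Vertex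

variable {K : Type*} [Field K]

theorem sym_zero_eq (t : K) (u : List Bool) :
    sym t 0 u = if u = List.replicate u.length false then 1 else 0 := by
  induction u with
  | nil => simp [sym_nil]
  | cons x u ih =>
    cases x
    · rw [sym_cons_false, ih]; simp [List.replicate_succ]
    · rw [sym_zero_cons_true]; simp [List.replicate_succ]

theorem inversions_replicate (x : Bool) (n : ℕ) : inversions (List.replicate n x) = 0 := by
  induction n with
  | zero => rfl
  | succ n ih => cases x <;> simp [List.replicate_succ, inversions, ih, List.count_replicate]

theorem sym_replicate_false_append (t : K) (k p : ℕ) (v : List Bool) :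
    sym t k (List.replicate p false ++ v) = sym t k v := by
  simp [sym, inversions_append, inversions_replicate, List.count_replicate]

theorem sym_append_replicate_false (t : K) (k q : ℕ) (v : List Bool) :
    sym t k (v ++ List.replicate q false) = t ^ (k * q) * sym t k v := by
  by_cases hk : v.count true = k
  · simp [sym, inversions_append, inversions_replicate, List.count_replicate, hk, pow_add, mul_comm]
  · simp [sym, List.count_replicate, hk]

theorem sym_append_replicate_true (t : K) (k y : ℕ) (v : List Bool) :
    sym t (k + y) (v ++ List.replicate y true) = sym t k v := by
  simp [sym, inversions_append, inversions_replicate, List.count_replicate]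

theorem sym_append_replicate_true_of_lt (t : K) {k y : ℕ} (hk : k < y) (v : List Bool) :
    sym t k (v ++ List.replicate y true) = 0 := by
  rw [sym, if_neg]
  simp [List.count_replicate]
  omega

theorem strands_eq {i j k p y q : ℕ} (hi : i = p + y) (hj : j = y + q) (hk : k = p + q) :
    strands i k j = p ∧ strands i j k = y ∧ strands j k i = q := by
  unfold strands
  omega

/-- The vertex splitting an edge, applied to a function of words. -/
theorem opK_split (t : K) {i j k p y q : ℕ} (hi : i = p + y) (hj : j = y + q) (hk : k = p + q)
    (φ : List Bool → K) {u₁ u₂ : List Bool} (hu₁ : u₁.length = p) (hu₂ : u₂.length = q) :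
    opK (i + j) (split t k i j) φ (u₁ ++ u₂) =
      wsum y (fun v => (-t⁻¹) ^ v.count true * φ ((u₁ ++ v) ++ (bar v ++ u₂))) := by
  obtain ⟨h1, h2, h3⟩ := strands_eq hi hj hk
  rw [split, h1, h2, show i + j = p + (2 * y + q) by omega, opK_tens _ _ _ hu₁, opK_id _ _ hu₁]
  have := opK_tens (m := 0) (m' := 2 * y) (n' := q) (cups t y) idK (fun v' => φ (u₁ ++ v'))
    (u := []) (u' := u₂) rfl
  rw [List.nil_append] at this
  rw [this, opK, two_mul, wsum_add_length]
  refine wsum_congr fun v hv => ?_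
  rw [← wsum_ite_eq (n := y) (bar v) (by rw [bar_length, hv])
    (fun w => (-t⁻¹) ^ v.count true * φ ((u₁ ++ v) ++ (w ++ u₂)))]
  refine wsum_congr fun w hw => ?_
  rw [cups_append t y _ v w hv hw, opK_id _ _ hu₂]
  split_ifs
  · simp
  · simp

/-- The vertex merging two edges, applied to a function of words. -/
theorem opK_merge (t : K) {i j k p y q : ℕ} (hi : i = p + y) (hj : j = y + q) (hk : k = p + q)
    (φ : List Bool → K) {u₁ v w u₂ : List Bool} (hu₁ : u₁.length = p) (hv : v.length = y)
    (hw : w.length = y) (hu₂ : u₂.length = q) :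
    opK k (merge t i j k) φ ((u₁ ++ v) ++ (w ++ u₂)) =
      if w = bar v then (-t) ^ v.count false * φ (u₁ ++ u₂) else 0 := by
  obtain ⟨h1, h2, h3⟩ := strands_eq hi hj hk
  rw [merge, h1, h2, show k = p + (0 + q) by omega,
    show u₁ ++ v ++ (w ++ u₂) = u₁ ++ ((v ++ w) ++ u₂) by simp, opK_tens _ _ _ hu₁, opK_id _ _ hu₁,
    opK_tens _ _ _ (by simp [hv, hw]; omega), opK, wsum_zero, opK_id _ _ hu₂,
    caps_append t y _ v w hv hw]
  split_ifs <;> simp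

/-- `bar` exchanges the two letters and reverses the word, so it preserves inversions and turns `l`
letters `true` into `y - l`. Hence only complementary weights meet across a bundle of cups or caps.
-/
theorem mul_sym_bar (t : K) (l m : ℕ) (x : K) {y : ℕ} {v : List Bool} (hv : v.length = y) :
    x ^ v.count true * (sym t l v * sym t m (bar v)) =
      if l + m = y then x ^ l * (sym t l v * sym t l v) else 0 := by
  have h := count_false_add_count_true v
  by_cases hl : v.count true = l
  · have hs : sym t m (bar v) = if l + m = y then sym t l v else 0 := by
      simp only [sym, bar_count_true, bar_inversions, hl, if_true]
      congr 1
      simp only [eq_iff_iff]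
      omega
    rw [hs]
    split_ifs <;> simp [hl]
  · simp [sym, hl]

/-- The source word is constantly `false`, so only the turned-back strands carry `true`. Summing
over their words gives the norm `gb t y l`, and the exponent `m * q` counts inversions with the
`false` letters to the right. -/
theorem splitCoeff_zero_left (t : K) {i j k p y q : ℕ} (hi : i = p + y) (hj : j = y + q)
    (hk : k = p + q) (l m : ℕ) :
    splitCoeff t k i j 0 l m =
      if l + m = y then (-t⁻¹) ^ l * t ^ (m * q) * gb t y l else 0 := by
  rw [splitCoeff, pair, wsum_sym_zero_mul, hk, List.replicate_add, ← hk,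
    opK_split t hi hj hk _ (by simp) (by simp)]
  have : ∀ v : List Bool, v.length = y → (-t⁻¹) ^ v.count true *
      tp i (sym t l) (sym t m) ((List.replicate p false ++ v) ++ (bar v ++ List.replicate q false))
      = if l + m = y then (-t⁻¹) ^ l * t ^ (m * q) * (sym t l v * sym t l v) else 0 := by
    intro v hv
    rw [tp_append _ _ _ (by simp [hv, hi]), sym_replicate_false_append, sym_append_replicate_false,
      show (-t⁻¹) ^ v.count true * (sym t l v * (t ^ (m * q) * sym t m (bar v))) =
        t ^ (m * q) * ((-t⁻¹) ^ v.count true * (sym t l v * sym t m (bar v))) by ring,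
      mul_sym_bar t l m _ hv]
    split_ifs <;> ring
  rw [wsum_congr this]
  split_ifs
  · rw [wsum_mul_left]; rfl
  · exact wsum_const_zero _

theorem bar_eq_replicate_false {y : ℕ} {v : List Bool} (hv : v.length = y) :
    bar v = List.replicate y false ↔ v = List.replicate y true := by
  constructor
  · intro h
    rw [← bar_bar v, h]
    simp [bar]
  · rintro rfl
    simp [bar]

/-- The right outgoing word must be constantly `false`, which forces the word on the turned-back
strands to be constantly `true`. This single configuration raises the left label by `y`. -/
theorem splitCoeff_zero_right (t : K) {i j k p y q : ℕ} (hi : i = p + y) (hj : j = y + q)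
    (hk : k = p + q) (m r : ℕ) :
    splitCoeff t k i j m r 0 =
      if r = m + y then (-t⁻¹) ^ y * t ^ (m * q) * gb t p m else 0 := by
  have key : ∀ u : List Bool, u.length = p →
      wsum q (fun w => sym t m (u ++ w) * opK (i + j) (split t k i j)
        (tp i (sym t r) (sym t 0)) (u ++ w)) =
      if r = m + y then (-t⁻¹) ^ y * t ^ (m * q) * (sym t m u * sym t m u) else 0 := by
    intro u hu
    have h1 : ∀ w : List Bool, w.length = q → sym t m (u ++ w) * opK (i + j) (split t k i j)
        (tp i (sym t r) (sym t 0)) (u ++ w) = if w = List.replicate q false then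
          (-t⁻¹) ^ y * sym t m (u ++ w) * sym t r (u ++ List.replicate y true) else 0 := by
      intro w hw
      rw [opK_split t hi hj hk _ hu hw]
      have h2 : ∀ v : List Bool, v.length = y → (-t⁻¹) ^ v.count true *
          tp i (sym t r) (sym t 0) ((u ++ v) ++ (bar v ++ w)) =
          if v = List.replicate y true then (if w = List.replicate q false then
            (-t⁻¹) ^ v.count true * sym t r (u ++ v) else 0) else 0 := by
        intro v hv
        rw [tp_append _ _ _ (by simp [hu, hv, hi]), sym_zero_eq]
        have : bar v ++ w = List.replicate (bar v ++ w).length false ↔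
            v = List.replicate y true ∧ w = List.replicate q false := by
          rw [List.length_append, List.replicate_add, bar_length, hv, hw,
            ← bar_eq_replicate_false hv]
          exact ⟨fun h => List.append_inj h (by simp [bar_length, hv]),
            fun h => by rw [h.1, h.2]⟩
        rw [if_congr this rfl rfl]
        by_cases hv' : v = List.replicate y true <;> by_cases hw' : w = List.replicate q false <;>
          simp [hv', hw']
      rw [wsum_congr h2, wsum_ite_eq _ (by simp)]
      split_ifs
      · simp only [List.count_replicate_self]; ring
      · ring
    rw [wsum_congr h1, wsum_ite_eq _ (by simp), sym_append_replicate_false]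
    split_ifs with hr
    · rw [hr, sym_append_replicate_true]; ring
    · by_cases hm : r < y
      · rw [sym_append_replicate_true_of_lt t hm, mul_zero]
      · obtain ⟨r', rfl⟩ := Nat.exists_eq_add_of_le' (not_lt.mp hm)
        rw [sym_append_replicate_true, show (-t⁻¹) ^ y * (t ^ (m * q) * sym t m u) * sym t r' u =
          (-t⁻¹) ^ y * t ^ (m * q) * (sym t m u * sym t r' u) by ring]
        rw [sym, sym]
        by_cases h3 : u.count true = m
        · rw [if_neg (show ¬ u.count true = r' by omega)]; ring
        · simp [h3]
  rw [splitCoeff, pair]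
  conv_lhs => rw [hk]
  rw [wsum_add_length, ← hk, wsum_congr key]
  split_ifs
  · rw [wsum_mul_left]; rfl
  · exact wsum_const_zero _

/-- The through strands are constantly `false`, and the sum over the capped strands again gives a
norm. This is the initial value of the recursion along the target edge. -/
theorem mergeCoeff_zero (t : K) {i j k p y q : ℕ} (hi : i = p + y) (hj : j = y + q)
    (hk : k = p + q) (l r : ℕ) :
    mergeCoeff t i j k l r 0 =
      if l + r = y then (-t) ^ r * t ^ (r * q) * gb t y l else 0 := by
  have h1 : ∀ u₁ v : List Bool, u₁.length = p → v.length = y →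
      wsum j (fun x => sym t l (u₁ ++ v) * sym t r x *
        opK k (merge t i j k) (sym t 0) ((u₁ ++ v) ++ x)) =
      sym t 0 u₁ * (sym t l (u₁ ++ v) *
        ((-t) ^ v.count false * (t ^ (r * q) * sym t r (bar v)))) := by
    intro u₁ v hu₁ hv
    have h2 : ∀ w : List Bool, w.length = y → wsum q (fun u₂ => sym t l (u₁ ++ v) *
        sym t r (w ++ u₂) * opK k (merge t i j k) (sym t 0) ((u₁ ++ v) ++ (w ++ u₂))) =
        if w = bar v then sym t 0 u₁ * (sym t l (u₁ ++ v) *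
        ((-t) ^ v.count false * (t ^ (r * q) * sym t r w))) else 0 := by
      intro w hw
      have h3 : ∀ u₂ : List Bool, u₂.length = q → sym t l (u₁ ++ v) *
          sym t r (w ++ u₂) * opK k (merge t i j k) (sym t 0) ((u₁ ++ v) ++ (w ++ u₂)) =
          sym t 0 u₂ * (if w = bar v then sym t 0 u₁ * (sym t l (u₁ ++ v) *
            ((-t) ^ v.count false * sym t r (w ++ u₂))) else 0) := by
        intro u₂ hu₂
        rw [opK_merge t hi hj hk _ hu₁ hv hw hu₂]
        split_ifs
        · have : sym t 0 (u₁ ++ u₂) = sym t 0 u₁ * sym t 0 u₂ := by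
            by_cases h4 : u₁.count true = 0 <;> by_cases h5 : u₂.count true = 0 <;>
              simp [sym, inversions_append, h4, h5, pow_add]
          rw [this]
          ring
        · ring
      rw [wsum_congr h3, wsum_sym_zero_mul, sym_append_replicate_false]
    rw [hj, wsum_add_length, ← hj, wsum_congr h2, wsum_ite_eq _ (by rw [bar_length, hv])]
  rw [mergeCoeff, pair₂, hi, wsum_add_length, ← hi, wsum_comm]
  rw [wsum_congr fun v hv => wsum_congr fun u₁ hu₁ => h1 u₁ v hu₁ hv]
  simp only [wsum_sym_zero_mul, sym_replicate_false_append]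
  have h4 : ∀ v : List Bool, v.length = y →
      sym t l v * ((-t) ^ v.count false * (t ^ (r * q) * sym t r (bar v))) =
      if l + r = y then (-t) ^ r * t ^ (r * q) * (sym t l v * sym t l v) else 0 := by
    intro v hv
    have h := mul_sym_bar t l r 1 hv
    have h' := count_false_add_count_true v
    rw [one_pow, one_mul, one_pow, one_mul] at h
    by_cases hl : v.count true = l
    · rw [show sym t l v * ((-t) ^ v.count false * (t ^ (r * q) * sym t r (bar v))) =
        (-t) ^ v.count false * t ^ (r * q) * (sym t l v * sym t r (bar v)) by ring, h]
      split_ifs with h5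
      · rw [show v.count false = r by omega]
      · ring
    · simp [sym, hl]
  rw [wsum_congr h4]
  split_ifs
  · rw [wsum_mul_left]; rfl
  · exact wsum_const_zero _

end Vertex

end QSpin


namespace QSpin

/-! ### Quantum factorials and the q-Chu–Vandermonde sum -/

section QFactorial

variable {K : Type*} [Field K]

/-- The quantum factorial of an integer (meaningful for nonnegative integers). -/
def qF (t : K) (n : ℤ) : K := qFact t n.toNat

/-- The inverse quantum factorial of an integer, zero at negative integers. -/
def iF (t : K) (n : ℤ) : K := if 0 ≤ n then (qF t n)⁻¹ else 0

theorem qF_natCast (t : K) (n : ℕ) : qF t n = qFact t n := by simp [qF]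

theorem iF_natCast (t : K) (n : ℕ) : iF t n = (qFact t n)⁻¹ := by simp [iF, qF]

theorem Generic.qF_ne_zero {t : K} (h : Generic t) (n : ℤ) : qF t n ≠ 0 := h.qFact_ne_zero _

theorem iF_of_nonneg (t : K) {n : ℤ} (hn : 0 ≤ n) : iF t n = (qF t n)⁻¹ := if_pos hn

theorem iF_of_neg (t : K) {n : ℤ} (hn : n < 0) : iF t n = 0 := if_neg (not_le.mpr hn)

theorem qF_add_one (t : K) {n : ℤ} (hn : 0 ≤ n) : qF t (n + 1) = qi t (n + 1) * qF t n := by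
  lift n to ℕ using hn
  rw [qF_natCast, ← Nat.cast_add_one, qF_natCast, qFact_succ]
  push_cast
  ring

theorem qF_eq_mul_pred (t : K) {n : ℤ} (hn : 1 ≤ n) : qF t n = qi t n * qF t (n - 1) := by
  have := qF_add_one t (n := n - 1) (by omega)
  rwa [sub_add_cancel] at this

theorem Generic.iF_pred {t : K} (h : Generic t) (n : ℤ) : iF t (n - 1) = qi t n * iF t n := by
  rcases lt_trichotomy n 0 with hn | hn | hn
  · rw [iF_of_neg t hn, iF_of_neg t (by omega), mul_zero]
  · subst hn
    rw [qi_zero, zero_mul, iF_of_neg t (by omega)]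
  · rw [iF_of_nonneg t (by omega), iF_of_nonneg t (by omega), qF_eq_mul_pred t (n := n) (by omega)]
    have h1 := h.qi_ne_zero (n := n) (by omega)
    have h2 := h.qF_ne_zero (n - 1)
    field_simp

theorem iF_zero (t : K) : iF t 0 = 1 := by simp [iF, qF, qFact_zero]

theorem Generic.qF_mul_iF {t : K} (h : Generic t) {n : ℤ} (hn : 0 ≤ n) : qF t n * iF t n = 1 := by
  rw [iF_of_nonneg t hn, mul_inv_cancel₀ (h.qF_ne_zero n)]

/-- The three-term relation behind all contiguous relations below; in each use the free parameter
`u` is chosen so that the new factors cancel against factorials. -/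
theorem qi_mul_qi {t : K} (h : Generic t) (x y u : ℤ) :
    qi t x * qi t y = qi t (x - u) * qi t (y + u) + qi t u * qi t (y - x + u) := by
  have h0 := h.ne_zero
  have h1 := h.sub_inv_ne_zero
  simp only [qi]
  rw [div_mul_div_comm, div_mul_div_comm, div_mul_div_comm, ← add_div]
  congr 1
  simp only [neg_add, neg_sub, zpow_add₀ h0, zpow_sub₀ h0, zpow_neg]
  have hx := zpow_ne_zero x h0
  have hy := zpow_ne_zero y h0
  have hu := zpow_ne_zero u h0
  field_simp
  ring

/-- A terminating `q`-Chu–Vandermonde sum. -/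
theorem sum_antidiagonal_qFact {t : K} (h : Generic t) (α β n : ℕ) :
    ∑ p ∈ Finset.HasAntidiagonal.antidiagonal n, t ^ ((p.2 : ℤ) * (α + 1) - p.1 * (β + 1)) *
        (qFact t (α + p.1) * qFact t (β + p.2) / (qFact t p.1 * qFact t p.2)) =
      qFact t α * qFact t β * qFact t (α + β + n + 1) / (qFact t n * qFact t (α + β + 1)) := by
  have h0 := h.ne_zero
  have hF := h.qFact_ne_zero
  induction n generalizing α β with
  | zero => simp [qFact_zero, hF]
  | succ n ih =>
    have hq : ∀ n : ℕ, qi t ((n : ℤ) + 1) ≠ 0 := fun n => h.qi_ne_zero (by omega)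
    -- On the antidiagonal of `n + 1` one has [n+1] = t^{p₂}[p₁] + t^{-p₁}[p₂]. Each piece cancels
    -- one factorial and is a sum of order `n`, with `α` or `β` increased by one.
    have key : qi t (n + 1) * (∑ p ∈ Finset.HasAntidiagonal.antidiagonal (n + 1),
        t ^ ((p.2 : ℤ) * (α + 1) - p.1 * (β + 1)) *
        (qFact t (α + p.1) * qFact t (β + p.2) / (qFact t p.1 * qFact t p.2))) =
        t ^ (-(β + 1 : ℤ)) * (∑ p ∈ Finset.HasAntidiagonal.antidiagonal n,
          t ^ ((p.2 : ℤ) * ((α + 1 : ℕ) + 1) - p.1 * (β + 1)) *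
        (qFact t (α + 1 + p.1) * qFact t (β + p.2) / (qFact t p.1 * qFact t p.2))) +
        t ^ (α + 1 : ℤ) * (∑ p ∈ Finset.HasAntidiagonal.antidiagonal n,
          t ^ ((p.2 : ℤ) * (α + 1) - p.1 * ((β + 1 : ℕ) + 1)) *
        (qFact t (α + p.1) * qFact t (β + 1 + p.2) / (qFact t p.1 * qFact t p.2))) := by
      have e1 : ∀ p ∈ Finset.HasAntidiagonal.antidiagonal (n + 1), qi t (n + 1) *
          (t ^ ((p.2 : ℤ) * (α + 1) - p.1 * (β + 1)) *
          (qFact t (α + p.1) * qFact t (β + p.2) / (qFact t p.1 * qFact t p.2))) =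
          t ^ (p.2 : ℤ) * qi t p.1 * (t ^ ((p.2 : ℤ) * (α + 1) - p.1 * (β + 1)) *
          (qFact t (α + p.1) * qFact t (β + p.2) / (qFact t p.1 * qFact t p.2))) +
          t ^ (-(p.1 : ℤ)) * qi t p.2 * (t ^ ((p.2 : ℤ) * (α + 1) - p.1 * (β + 1)) *
          (qFact t (α + p.1) * qFact t (β + p.2) / (qFact t p.1 * qFact t p.2))) := by
        intro p hp
        rw [Finset.HasAntidiagonal.mem_antidiagonal] at hp
        rw [show (n + 1 : ℤ) = p.1 + p.2 by exact_mod_cast hp.symm, qi_add h]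
        ring
      rw [Finset.mul_sum, Finset.sum_congr rfl e1, Finset.sum_add_distrib,
        Finset.Nat.sum_antidiagonal_succ, Finset.Nat.sum_antidiagonal_succ']
      simp only [Nat.cast_zero, qi_zero, mul_zero, zero_mul, zero_add, add_zero]
      congr 1
      · rw [Finset.mul_sum]
        refine Finset.sum_congr rfl fun p _ => ?_
        rw [qFact_succ t p.1, show α + (p.1 + 1) = α + 1 + p.1 by ring]
        have e2 : t ^ ((p.2 : ℤ) * (α + 1) - ((p.1 + 1 : ℕ) : ℤ) * (β + 1)) * t ^ (p.2 : ℤ) =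
            t ^ (-(β + 1 : ℤ)) * t ^ ((p.2 : ℤ) * ((α + 1 : ℕ) + 1) - p.1 * (β + 1)) := by
          rw [← zpow_add₀ h0, ← zpow_add₀ h0]
          congr 1
          push_cast
          ring
        have := hq p.1
        have := hF p.1
        have := hF p.2
        rw [← mul_assoc (t ^ (-(β + 1 : ℤ))), ← e2]
        push_cast
        field_simp
      · rw [Finset.mul_sum]
        refine Finset.sum_congr rfl fun p _ => ?_
        rw [qFact_succ t p.2, show β + (p.2 + 1) = β + 1 + p.2 by ring]
        have e2 : t ^ (((p.2 + 1 : ℕ) : ℤ) * (α + 1) - (p.1 : ℤ) * (β + 1)) * t ^ (-(p.1 : ℤ)) =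
            t ^ (α + 1 : ℤ) * t ^ ((p.2 : ℤ) * (α + 1) - p.1 * ((β + 1 : ℕ) + 1)) := by
          rw [← zpow_add₀ h0, ← zpow_add₀ h0]
          congr 1
          push_cast
          ring
        have := hq p.2
        have := hF p.1
        have := hF p.2
        rw [← mul_assoc (t ^ (α + 1 : ℤ)), ← e2]
        push_cast
        field_simp
    have e3 : t ^ (-(β + 1 : ℤ)) * qi t (α + 1) + t ^ (α + 1 : ℤ) * qi t (β + 1) =
        qi t ((α + β + 1 : ℕ) + 1) := by
      rw [show (((α + β + 1 : ℕ) : ℤ) + 1) = (β + 1 : ℤ) + (α + 1) by push_cast; ring,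
        qi_add h (β + 1 : ℤ) (α + 1), add_comm]
    rw [ih, ih, show α + 1 + β + n + 1 = α + β + (n + 1) + 1 by ring,
      show α + (β + 1) + n + 1 = α + β + (n + 1) + 1 by ring,
      show α + 1 + β + 1 = α + β + 1 + 1 by ring, show α + (β + 1) + 1 = α + β + 1 + 1 by ring,
      qFact_succ t α, qFact_succ t β] at key
    apply mul_left_cancel₀ (hq n)
    rw [key, qFact_succ t n, qFact_succ t (α + β + 1), ← e3]
    have := hq n
    have := hF n
    have := hF (α + β + 1)
    have e4 : qi t (((α + β + 1 : ℕ) : ℤ) + 1) ≠ 0 := hq _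
    rw [← e3] at e4
    field_simp

end QFactorial

/-! ### Closed form of the vertex coefficients -/

section MergeCoefficients

variable {K : Type*} [Field K]

/-- Move `raise` through the vertex. At the target it produces [w+1] and the next weight vector; at
the source it acts on the two edges by the coproduct, and its transpose lowers `l` or `r`. -/
theorem mergeCoeff_succ {t : K} (h : Generic t) {i j k p y q : ℕ} (hi : i = p + y)
    (hj : j = y + q) (hk : k = p + q) (l r w : ℕ) :
    qi t (w + 1) * mergeCoeff t i j k l r (w + 1) =
      (if l = 0 then 0 else t ^ ((j : ℤ) - 2 * r) * (t ^ ((i : ℤ) + 1 - 2 * l) *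
        qi t ((i : ℤ) + 1 - l)) * mergeCoeff t i j k (l - 1) r w) +
      (if r = 0 then 0 else t ^ ((j : ℤ) + 1 - 2 * r) * qi t ((j : ℤ) + 1 - r) *
        mergeCoeff t i j k l (r - 1) w) := by
  have h0 := h.ne_zero
  obtain ⟨h1, h2, h3⟩ := strands_eq hi hj hk
  have hM : Equi t (i + j) k (merge t i j k) := by
    apply equi_merge h0 <;> omega
  set ψ := opK k (merge t i j k) (sym t w) with hψ
  have e1 : qi t (w + 1) * mergeCoeff t i j k l r (w + 1) =
      wsum i (fun u => wsum j (fun v => sym t l u * sym t r v *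
        raise t (u ++ v) ψ)) := by
    rw [mergeCoeff, pair₂, ← wsum_mul_left]
    refine wsum_congr fun u hu => ?_
    rw [← wsum_mul_left]
    refine wsum_congr fun v hv => ?_
    rw [hM.raise _ _ (by simp [hu, hv]), opK_congr _ fun x _ => raise_sym h w x, opK_mul_left]
    ring
  have e2 : ∀ u v : List Bool, v.length = j → sym t l u * sym t r v * raise t (u ++ v) ψ =
      sym t r v * (t ^ ((j : ℤ) - 2 * r) * (sym t l u * raise t u (fun u' => ψ (u' ++ v)))) +
      sym t l u * (sym t r v * raise t v (fun v' => ψ (u ++ v'))) := by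
    intro u v hv
    rw [raise_append]
    have : sym t r v * kap t v = sym t r v * t ^ ((j : ℤ) - 2 * r) :=
      sym_mul_congr t r v fun hr => by rw [kap_eq t h0, hv, hr]
    linear_combination (sym t l u * raise t u (fun u' => ψ (u' ++ v))) * this
  rw [e1, wsum_congr fun u _ => wsum_congr fun v hv => e2 u v hv]
  simp only [wsum_add]
  congr 1
  · rw [wsum_comm]
    simp only [wsum_mul_left]
    rcases l with _ | l
    · simp only [wsum_sym_zero_raise, mul_zero, wsum_const_zero, if_true]
    · simp only [wsum_sym_succ_raise h, Nat.add_sub_cancel, if_neg (Nat.succ_ne_zero l)]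
      rw [mergeCoeff, ← hψ, pair₂, wsum_comm, ← wsum_mul_left]
      refine wsum_congr fun v _ => ?_
      rw [← wsum_mul_left, ← wsum_mul_left, ← wsum_mul_left, ← wsum_mul_left]
      refine wsum_congr fun u _ => ?_
      push_cast
      rw [show (i : ℤ) + 1 - 2 * (l + 1) = i - 1 - 2 * l by ring,
        show (i : ℤ) + 1 - (l + 1) = i - l by ring]
      ring
  · simp only [wsum_mul_left]
    rcases r with _ | r
    · simp only [wsum_sym_zero_raise, mul_zero, wsum_const_zero, if_true]
    · simp only [wsum_sym_succ_raise h, Nat.add_sub_cancel, if_neg (Nat.succ_ne_zero r)]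
      rw [mergeCoeff, ← hψ, pair₂, ← wsum_mul_left]
      refine wsum_congr fun u _ => ?_
      rw [← wsum_mul_left, ← wsum_mul_left, ← wsum_mul_left]
      refine wsum_congr fun v _ => ?_
      push_cast
      rw [show (j : ℤ) + 1 - 2 * (r + 1) = j - 1 - 2 * r by ring,
        show (j : ℤ) + 1 - (r + 1) = j - r by ring]
      ring

/-- The summand in the closed form of the vertex coefficients. -/
def mergeTerm (t : K) (a c y z l s u : ℤ) : K :=
  (-1) ^ u.natAbs * t ^ (u * (a - l + 1)) * (qF t (c - s + u) * qF t (y + s - u)) *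
    (iF t u * iF t (s - u) * iF t (l - u) * iF t (z - s + u))

theorem qi_mul_mergeTerm_succ {t : K} (h : Generic t) (a c y z l s v : ℤ) (hv : 0 ≤ v) :
    qi t (v + 1) * mergeTerm t a c y z l (s + 1) (v + 1) =
      -(t ^ (a - l + 1 - v)) * mergeTerm t a c y z (l - 1) s v := by
  have h0 := h.ne_zero
  lift v to ℕ using hv
  have e1 := h.iF_pred (v + 1)
  rw [add_sub_cancel_right] at e1
  have e2 : t ^ (a - l + 1 - v) * t ^ (v * (a - (l - 1) + 1)) = t ^ ((v + 1) * (a - l + 1)) := by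
    rw [← zpow_add₀ h0]; congr 1; ring
  simp only [mergeTerm, ← Nat.cast_add_one, Int.natAbs_natCast]
  push_cast
  rw [show c - (s + 1) + (v + 1) = c - s + v by ring, show y + (s + 1) - (v + 1) = y + s - v by ring,
    show s + 1 - (v + 1 : ℤ) = s - v by ring, show l - (v + 1 : ℤ) = l - 1 - v by ring,
    show z - (s + 1) + (v + 1) = z - s + v by ring, ← e2, e1, pow_succ]
  ring

theorem qi_mul_mergeTerm {t : K} (h : Generic t) (a c y z l s v : ℤ) (hv : 0 ≤ v) :
    qi t (l - v) * mergeTerm t a c y z l s v = t ^ (-v) * mergeTerm t a c y z (l - 1) s v := by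
  have h0 := h.ne_zero
  lift v to ℕ using hv
  have e1 := h.iF_pred (l - v)
  rw [show l - (v : ℤ) - 1 = l - 1 - v by ring] at e1
  have e2 : t ^ (-(v : ℤ)) * t ^ (v * (a - (l - 1) + 1)) = t ^ (v * (a - l + 1)) := by
    rw [← zpow_add₀ h0]; congr 1; ring
  simp only [mergeTerm]
  rw [← e2, e1]
  ring

theorem qi_mul_qi_mul_mergeTerm {t : K} (h : Generic t) {a c y z l : ℤ} (hy : 0 ≤ y) {s v : ℕ}
    (hv : v ≤ s) (hs : (s : ℤ) + 1 ≤ c) :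
    qi t (s + 1 - v) * qi t (c - s + v) * mergeTerm t a c y z l (s + 1) v =
      qi t (z - s + v) * qi t (y + s + 1 - v) * mergeTerm t a c y z l s v := by
  have e1 := h.iF_pred (s + 1 - v)
  have e2 := h.iF_pred (z - s + v)
  have e3 := qF_add_one t (n := c - (s + 1) + v) (by omega)
  have e4 := qF_add_one t (n := y + s - v) (by omega)
  rw [show (s : ℤ) + 1 - v - 1 = s - v by ring] at e1
  rw [show z - (s : ℤ) + v - 1 = z - (s + 1) + v by ring] at e2
  rw [show c - ((s : ℤ) + 1) + v + 1 = c - s + v by ring] at e3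
  rw [show y + (s : ℤ) - v + 1 = y + s + 1 - v by ring] at e4
  simp only [mergeTerm]
  rw [show y + ((s : ℤ) + 1) - v = y + s + 1 - v by ring, e1, e2, e3, e4]
  ring

/-- This is the recursion of `mergeCoeff_succ` with the prefactors of the closed form removed. It
holds term by term after [s+1][c-s] is split with parameter `u` and one of the pieces is shifted by
one. -/
theorem sum_mergeTerm_succ {t : K} (h : Generic t) {a c y z x : ℤ} (ha : a = x + y) (hc : c = x + z)
    (hy : 0 ≤ y) (l : ℤ) (s : ℕ) (hs : (s : ℤ) + 1 ≤ c) :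
    qi t (s + 1) * qi t (c - s) * ∑ u ∈ Finset.range (s + 2), mergeTerm t a c y z l (s + 1) u =
      -(qi t (a + 1 - l) * t ^ (z - 2 * s - y + a)) *
          ∑ u ∈ Finset.range (s + 1), mergeTerm t a c y z (l - 1) s u +
        qi t (z - s + l) * qi t (y + s + 1 - l) *
          ∑ u ∈ Finset.range (s + 1), mergeTerm t a c y z l s u := by
  have h0 := h.ne_zero
  have e1 : ∀ u : ℕ, qi t (s + 1) * qi t (c - s) * mergeTerm t a c y z l (s + 1) u =
      qi t (s + 1 - u) * qi t (c - s + u) * mergeTerm t a c y z l (s + 1) u +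
      qi t (c - 2 * s - 1 + u) * (qi t u * mergeTerm t a c y z l (s + 1) u) := by
    intro u
    rw [qi_mul_qi h _ _ (u : ℤ), show c - s - (s + 1) + u = c - 2 * s - 1 + u by ring]
    ring
  -- The first piece contains [s+1-u] and vanishes at the last index; the second contains [u] and
  -- vanishes at the first. After reindexing both run over the same range.
  rw [Finset.mul_sum, Finset.sum_congr rfl fun u _ => e1 u, Finset.sum_add_distrib,
    Finset.sum_range_succ, Finset.sum_range_succ' (fun u : ℕ => qi t (c - 2 * s - 1 + u) * _)]
  push_cast
  rw [sub_self, qi_zero, zero_mul, zero_mul, add_zero, zero_mul, mul_zero, add_zero,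
    Finset.mul_sum, Finset.mul_sum, ← Finset.sum_add_distrib, ← Finset.sum_add_distrib]
  refine Finset.sum_congr rfl fun v hv => ?_
  rw [Finset.mem_range] at hv
  rw [qi_mul_qi_mul_mergeTerm h hy (by omega) hs, qi_mul_mergeTerm_succ h _ _ _ _ _ _ _ (by omega)]
  have e2 := qi_mul_qi h (z - s + l) (y + s + 1 - l) (l - v)
  rw [show z - s + l - (l - v) = z - s + v by ring,
    show y + s + 1 - l + (l - v) = y + s + 1 - v by ring] at e2
  have e3 := qi_mul_mergeTerm h a c y z l s v (by omega)
  rw [e2]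
  have e4 := qi_add h (a + 1 - l) (z - y - 1 + l - 2 * s + v)
  rw [show a + 1 - l + (z - y - 1 + l - 2 * s + v) = c - 2 * s - 1 + (v + 1) by
    rw [ha, hc]; ring] at e4
  have e5 := qi_neg t (z - y - 1 + l - 2 * s + v)
  rw [e4, show y + s + 1 - l - (z - s + l) + (l - v) = -(z - y - 1 + l - 2 * s + v) by ring, e5]
  have e6 : t ^ (z - 2 * s - y + a) = t ^ (z - y - 1 + l - 2 * s + v) * t ^ (a - l + 1 - v) := by
    rw [← zpow_add₀ h0]; congr 1; ring
  have e7 : t ^ (-(a + 1 - l)) * t ^ (a - l + 1 - v) = t ^ (-(v : ℤ)) := by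
    rw [← zpow_add₀ h0]; congr 1; ring
  rw [e6]
  linear_combination (-qi t (z - y - 1 + l - 2 * s + v) * mergeTerm t a c y z (l - 1) s v) * e7 +
    qi t (z - y - 1 + l - 2 * s + v) * e3

/-- The closed form of the vertex coefficients. -/
theorem mergeCoeff_eq {t : K} (h : Generic t) {i j k p y q : ℕ} (hi : i = p + y) (hj : j = y + q)
    (hk : k = p + q) (l r s : ℕ) (hs : s ≤ k) (hlr : l + r = y + s) :
    mergeCoeff t i j k l r s = (-1) ^ (y + l) * t ^ ((r : ℤ) * (j - r + 1) - s) *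
      (qF t q * iF t (k - s) * iF t r) *
        ∑ u ∈ Finset.range (s + 1), mergeTerm t i k y q l s u := by
  have h0 := h.ne_zero
  -- The induction follows the weight string of the target edge, from its highest weight vector
  -- upwards in `s`.
  induction s generalizing l r with
  | zero =>
    have hF := h.qFact_ne_zero
    rw [mergeCoeff_zero t hi hj hk, if_pos (by omega)]
    have hy : y = l + r := by omega
    have e0 : t ^ ((r : ℤ) * (j - r + 1)) = t ^ r * t ^ (r * q) * t ^ (l * r) := by
      rw [← pow_add, ← pow_add, ← zpow_natCast]
      congr 1
      rw [hj, hy]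
      push_cast
      ring
    have e1 : ((-1 : K)) ^ (y + l) = (-1) ^ r := by
      rw [hy, show l + r + l = 2 * l + r by ring, pow_add, pow_mul]; simp
    simp only [zero_add, Finset.sum_range_one, mergeTerm, Nat.cast_zero, sub_zero, zero_mul,
      add_zero, zpow_zero, iF_zero, Int.natAbs_zero, pow_zero, mul_one, one_mul]
    rw [e0, e1, neg_pow, iF_natCast, iF_natCast, iF_natCast, iF_natCast, qF_natCast, qF_natCast,
      qF_natCast]
    rw [hy, gb_add h]
    have := hF q; have := hF k; have := hF r; have := hF l
    field_simp
  | succ s ih =>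
    have hsum := sum_mergeTerm_succ h (a := i) (c := k) (y := y) (z := q) (x := p)
      (by exact_mod_cast hi) (by exact_mod_cast hk) (by omega) l s (by omega)
    have hiF := h.iF_pred ((k : ℤ) - s)
    rw [show (k : ℤ) - s - 1 = k - (s + 1 : ℕ) by push_cast; ring] at hiF
    have hr : (r : ℤ) = y + s + 1 - l := by omega
    apply mul_left_cancel₀ (h.qi_ne_zero (n := (s : ℤ) + 1) (by omega))
    rw [mergeCoeff_succ h hi hj hk, hiF]
    have e1 : (if l = 0 then 0 else t ^ ((j : ℤ) - 2 * r) * (t ^ ((i : ℤ) + 1 - 2 * l) *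
        qi t ((i : ℤ) + 1 - l)) * mergeCoeff t i j k (l - 1) r s) =
        (-1) ^ (y + l) * t ^ ((r : ℤ) * (j - r + 1) - (s + 1 : ℕ)) *
        (qF t q * iF t (k - s) * iF t r) * (-(qi t (i + 1 - l) * t ^ ((q : ℤ) - 2 * s - y + i)) *
          ∑ u ∈ Finset.range (s + 1), mergeTerm t i k y q ((l : ℤ) - 1) s u) := by
      rcases l with _ | l
      · rw [if_pos rfl, Finset.sum_eq_zero]
        · ring
        · intro u _
          simp only [mergeTerm]
          rw [iF_of_neg t (n := ((0 : ℕ) : ℤ) - 1 - u) (by omega)]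
          ring
      · rw [if_neg (Nat.succ_ne_zero l), Nat.add_sub_cancel, ih l r (by omega) (by omega)]
        have e2 : t ^ ((j : ℤ) - 2 * r) * t ^ ((i : ℤ) + 1 - 2 * (l + 1 : ℕ)) *
            t ^ ((r : ℤ) * (j - r + 1) - s) = t ^ ((r : ℤ) * (j - r + 1) - (s + 1 : ℕ)) *
            t ^ ((q : ℤ) - 2 * s - y + i) := by
          rw [← zpow_add₀ h0, ← zpow_add₀ h0, ← zpow_add₀ h0]
          congr 1
          push_cast at hr ⊢
          have : (j : ℤ) = y + q := by exact_mod_cast hj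
          linarith
        push_cast at e2 ⊢
        rw [show (l : ℤ) + 1 - 1 = l by ring, pow_add, pow_add, pow_add, pow_one]
        linear_combination ((-1) ^ y * (-1) ^ l * qi t ((i : ℤ) + 1 - (l + 1)) *
          (qF t q * iF t (k - s) * iF t r) *
          ∑ u ∈ Finset.range (s + 1), mergeTerm t i k y q l s u) * e2
    have e3 : (if r = 0 then 0 else t ^ ((j : ℤ) + 1 - 2 * r) * qi t ((j : ℤ) + 1 - r) *
        mergeCoeff t i j k l (r - 1) s) =
        (-1) ^ (y + l) * t ^ ((r : ℤ) * (j - r + 1) - (s + 1 : ℕ)) *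
        (qF t q * iF t (k - s) * iF t r) * (qi t ((q : ℤ) - s + l) * qi t ((y : ℤ) + s + 1 - l) *
          ∑ u ∈ Finset.range (s + 1), mergeTerm t i k y q l s u) := by
      rw [← hr]
      rcases r with _ | r
      · simp [qi_zero]
      · rw [if_neg (Nat.succ_ne_zero r), Nat.add_sub_cancel, ih l r (by omega) (by omega)]
        have e2 : t ^ ((j : ℤ) + 1 - 2 * (r + 1 : ℕ)) *
            t ^ ((r : ℤ) * (j - r + 1) - s) =
            t ^ (((r + 1 : ℕ) : ℤ) * (j - (r + 1 : ℕ) + 1) - (s + 1 : ℕ)) := by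
          rw [← zpow_add₀ h0]
          congr 1
          push_cast
          ring
        have e4 := h.iF_pred ((r + 1 : ℕ) : ℤ)
        rw [show ((r + 1 : ℕ) : ℤ) - 1 = r by push_cast; ring] at e4
        rw [← e2, e4, show (q : ℤ) - s + l = j + 1 - (r + 1 : ℕ) by omega]
        ring
    rw [e1, e3]
    push_cast at hsum ⊢
    linear_combination (-((-1) ^ (y + l) * t ^ ((r : ℤ) * (j - r + 1) - (s + 1)) *
        (qF t q * iF t (k - s) * iF t r))) * hsum

end MergeCoefficients

end QSpin


namespace QSpin

/-! ### The network with one edge cut open -/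

section Tetrahedron

variable {K : Type*} [Field K]

/-- The numbers of strands running between the edges of a tetrahedron at its four vertices. -/
structure TetStrands (a b c d e f ab ae be ac af cf cd ce de bd bf df : ℕ) : Prop where
  abe_a : a = ae + ab
  abe_b : b = ab + be
  abe_e : e = ae + be
  acf_a : a = ac + af
  acf_c : c = ac + cf
  acf_f : f = af + cf
  cde_c : c = ce + cd
  cde_d : d = cd + de
  cde_e : e = ce + de
  bdf_b : b = bf + bd
  bdf_d : d = df + bd
  bdf_f : f = bf + df

variable {a b c d e f ab ae be ac af cf cd ce de bd bf df : ℕ}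

theorem equi_treeKer {t : K} (ht : t ≠ 0)
    (H : TetStrands a b c d e f ab ae be ac af cf cd ce de bd bf df) :
    Equi t e (c + d) (treeKer t a b c d e f) := by
  obtain ⟨h1, h2, h3, h4, h5, h6, h7, h8, h9, h10, h11, h12⟩ := H
  have s1 := strands_eq h1 h2 h3
  have s2 := strands_eq h4 h6 h5
  have s4 := strands_eq (i := f) (j := d) (k := b) h12 h11 h10
  have E1 : Equi t e (a + b) (split t e a b) := by apply equi_split ht <;> omega
  have E2 : Equi t (a + f) c (merge t a f c) := by apply equi_merge ht <;> omega
  have E4 : Equi t b (f + d) (split t b f d) := by apply equi_split ht <;> omega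
  have jw := equi_jonesWenzl ht
  have E5 := E2.tens (equi_id t d)
  rw [add_assoc] at E5
  exact E1.comp (((jw a).tens (jw b)).comp (((equi_id t a).tens E4).comp
    (((equi_id t a).tens ((jw f).tens (jw d))).comp
      (E5.comp ((jw c).tens (equi_id t d))))))

theorem opK_treeKer_tp {t : K} (h : Generic t) {k s : ℕ} (hk : k ≤ c) (hs : s ≤ d) :
    opK (c + d) (treeKer t a b c d e f) (tp c (sym t k) (sym t s)) (List.replicate e false) =
      treeCoeff t a b c d e f k s := by
  rw [opK_treeKer h, Finset.sum_eq_single_of_mem k (Finset.mem_range.mpr (by omega)),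
    Finset.sum_eq_single_of_mem s (Finset.mem_range.mpr (by omega))]
  · rw [pair₂_tp, if_pos ⟨rfl, rfl⟩, div_self, one_mul]
    exact mul_ne_zero (gb_ne_zero h hk) (gb_ne_zero h hs)
  · intro s' _ hs'
    rw [pair₂_tp, if_neg fun H => hs' H.2, zero_div, zero_mul]
  · intro k' _ hk'
    refine Finset.sum_eq_zero fun s' _ => ?_
    rw [pair₂_tp, if_neg fun H => hk' H.1, zero_div, zero_mul]

theorem raise_tp {t : K} (h : Generic t) (k s : ℕ) (w : List Bool) (hw : w.length = c + d) :
    raise t w (tp c (sym t k) (sym t s)) =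
      t ^ ((d : ℤ) - 2 * s) * qi t (k + 1) * tp c (sym t (k + 1)) (sym t s) w +
        qi t (s + 1) * tp c (sym t k) (sym t (s + 1)) w := by
  obtain ⟨u, v, rfl, hu, hv⟩ := exists_append_of_length w hw
  rw [raise_append, tp_append _ _ _ hu, tp_append _ _ _ hu]
  have e1 : raise t u (fun u' => tp c (sym t k) (sym t s) (u' ++ v)) =
      raise t u (fun u' => sym t k u' * sym t s v) :=
    raise_congr t u fun u' hu' => tp_append _ _ _ (by rw [hu', hu])
  have e2 : raise t v (fun v' => tp c (sym t k) (sym t s) (u ++ v')) =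
      raise t v (fun v' => sym t k u * sym t s v') :=
    raise_congr t v fun v' _ => tp_append _ _ _ hu
  rw [e1, e2, raise_mul_right, raise_mul_left, raise_sym h, raise_sym h]
  have : sym t s v * kap t v = sym t s v * t ^ ((d : ℤ) - 2 * s) :=
    sym_mul_congr t s v fun hs => by rw [kap_eq t h.ne_zero, hv, hs]
  linear_combination (qi t (k + 1) * sym t (k + 1) u) * this

/-- The highest weight condition. -/
theorem treeCoeff_succ {t : K} (h : Generic t)
    (H : TetStrands a b c d e f ab ae be ac af cf cd ce de bd bf df) {k s : ℕ}
    (hk : k + 1 ≤ c) (hs : s + 1 ≤ d) :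
    t ^ ((d : ℤ) - 2 * s) * qi t (k + 1) * treeCoeff t a b c d e f (k + 1) s +
      qi t (s + 1) * treeCoeff t a b c d e f k (s + 1) = 0 := by
  -- Evaluate the network on `raise` of a product of weight vectors, at the word constantly equal to
  -- `false`. Equivariance moves `raise` to that word, which has no letter to change.
  rw [← opK_treeKer_tp h hk (by omega), ← opK_treeKer_tp h (by omega) hs, ← opK_mul_left,
    ← opK_mul_left, ← opK_add, ← opK_congr _ fun w hw => raise_tp h k s w hw,
    ← (equi_treeKer h.ne_zero H).raise _ _ (by simp), raise_replicate_false]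

/-- A highest weight vector of given weight in the product of two strings is unique up to scalar. So
all coefficients reduce to the one at `s = 0`, where edge d is in its highest weight and
`splitCoeff_zero_right` applies. -/
theorem treeCoeff_sub {t : K} (h : Generic t)
    (H : TetStrands a b c d e f ab ae be ac af cf cd ce de bd bf df) (k s : ℕ) (hks : k + s = cd) :
    treeCoeff t a b c d e f k s = (-1) ^ s * t ^ ((d : ℤ) * s - s * (s - 1)) *
      (qFact t cd / (qFact t s * qFact t k)) * treeCoeff t a b c d e f cd 0 := by
  have h0 := h.ne_zero
  have hF := h.qFact_ne_zero
  induction s generalizing k with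
  | zero =>
    obtain rfl : k = cd := by omega
    simp [qFact_zero, hF]
  | succ s ih =>
    have h1 := treeCoeff_succ h H (k := k) (s := s) (by have := H.cde_c; omega)
      (by have := H.cde_d; omega)
    rw [ih (k + 1) (by omega)] at h1
    have q1 := h.qi_ne_zero (n := (s : ℤ) + 1) (by omega)
    have q2 := h.qi_ne_zero (n := (k : ℤ) + 1) (by omega)
    apply mul_left_cancel₀ q1
    rw [eq_neg_of_add_eq_zero_right h1, qFact_succ t s, qFact_succ t k]
    have e1 : t ^ ((d : ℤ) * (s + 1 : ℕ) - (s + 1 : ℕ) * ((s + 1 : ℕ) - 1)) =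
        t ^ ((d : ℤ) - 2 * s) * t ^ ((d : ℤ) * s - s * (s - 1)) := by
      rw [← zpow_add₀ h0]; congr 1; push_cast; ring
    rw [e1, pow_succ]
    have := hF s; have := hF k; have := hF cd
    field_simp

theorem mul_gb {t : K} (h : Generic t) {n k m : ℕ} (hn : k + m = n) :
    gb t n k = t ^ (k * m) * qFact t n / (qFact t k * qFact t m) := by
  rw [← hn, gb_add h]

/-- The evaluation of the network with the edge `e` cut open. -/
theorem opK_treeKer_merge {t : K} (h : Generic t)
    (H : TetStrands a b c d e f ab ae be ac af cf cd ce de bd bf df) :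
    opK (c + d) (treeKer t a b c d e f) (opK e (merge t c d e) (sym t 0))
      (List.replicate e false) =
      treeCoeff t a b c d e f cd 0 * t ^ cd * (qFact t cd / (qFact t c * qFact t d)) *
        (qFact t de * qFact t ce * qFact t (ce + de + cd + 1) / qFact t (e + 1)) := by
  have h0 := h.ne_zero
  have hF := h.qFact_ne_zero
  have hc := H.cde_c
  have hd := H.cde_d
  have he := H.cde_e
  rw [opK_treeKer h]
  have e1 : ∀ k s, pair₂ t c d k s (opK e (merge t c d e) (sym t 0)) =
      if k + s = cd then (-t) ^ s * t ^ (s * de) * gb t cd k else 0 :=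
    fun k s => mergeCoeff_zero t hc hd he k s
  have e2 : ∑ k ∈ Finset.range (c + 1), ∑ s ∈ Finset.range (d + 1),
      pair₂ t c d k s (opK e (merge t c d e) (sym t 0)) / (gb t c k * gb t d s) *
        treeCoeff t a b c d e f k s = ∑ p ∈ Finset.HasAntidiagonal.antidiagonal cd,
      (-t) ^ p.2 * t ^ (p.2 * de) * gb t cd p.1 / (gb t c p.1 * gb t d p.2) *
        treeCoeff t a b c d e f p.1 p.2 := by
    rw [← Finset.sum_product', ← Finset.sum_subset
      (s₁ := Finset.HasAntidiagonal.antidiagonal cd)]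
    · refine Finset.sum_congr rfl fun p hp => ?_
      rw [e1, if_pos (by simpa using hp)]
    · intro p hp
      rw [Finset.HasAntidiagonal.mem_antidiagonal] at hp
      simp only [Finset.mem_product, Finset.mem_range]
      omega
    · intro p _ hp
      rw [e1, if_neg (by simpa using hp), zero_div, zero_mul]
  rw [e2]
  -- Once `treeCoeff_sub` and the norms are inserted, the sum over k + s = cd is a q-Chu–Vandermonde
  -- sum.
  have e3 := sum_antidiagonal_qFact h de ce cd
  have e4 : ∀ p ∈ Finset.HasAntidiagonal.antidiagonal cd,
      (-t) ^ p.2 * t ^ (p.2 * de) * gb t cd p.1 / (gb t c p.1 * gb t d p.2) *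
        treeCoeff t a b c d e f p.1 p.2 =
      (treeCoeff t a b c d e f cd 0 * t ^ cd * (qFact t cd / (qFact t c * qFact t d)) *
        qFact t cd) * (t ^ ((p.2 : ℤ) * (de + 1) - p.1 * (ce + 1)) *
        (qFact t (de + p.1) * qFact t (ce + p.2) / (qFact t p.1 * qFact t p.2))) := by
    rintro ⟨k, s⟩ hp
    rw [Finset.HasAntidiagonal.mem_antidiagonal] at hp
    simp only at hp ⊢
    rw [treeCoeff_sub h H k s hp, mul_gb h hp, mul_gb h (m := ce + s) (by omega : k + (ce + s) = c),
      mul_gb h (m := de + k) (by omega : s + (de + k) = d), neg_pow]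
    have e5 : t ^ cd * t ^ ((s : ℤ) * (de + 1) - k * (ce + 1)) * (t ^ (k * (ce + s)) *
        t ^ (s * (de + k))) = t ^ s * t ^ (s * de) * t ^ (k * s) *
          t ^ ((d : ℤ) * s - s * (s - 1)) := by
      simp only [← zpow_natCast]
      simp only [← zpow_add₀ h0]
      congr 1
      rw [hd, ← hp]
      push_cast
      ring
    have e6 : ((-1 : K)) ^ s * (-1) ^ s = 1 := by rw [← mul_pow]; simp
    have := hF s; have := hF k; have := hF cd; have := hF c; have := hF d
    have := hF (ce + s); have := hF (de + k)
    rw [show (-1) ^ s * t ^ s * t ^ (s * de) * (t ^ (k * s) * qFact t cd / (qFact t k * qFact t s)) /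
      (t ^ (k * (ce + s)) * qFact t c / (qFact t k * qFact t (ce + s)) *
        (t ^ (s * (de + k)) * qFact t d / (qFact t s * qFact t (de + k)))) *
      ((-1) ^ s * t ^ ((d : ℤ) * s - s * (s - 1)) * (qFact t cd / (qFact t s * qFact t k)) *
        treeCoeff t a b c d e f cd 0) = ((-1) ^ s * (-1) ^ s) * (t ^ s * t ^ (s * de) * t ^ (k * s) *
          t ^ ((d : ℤ) * s - s * (s - 1))) / (t ^ (k * (ce + s)) * t ^ (s * (de + k))) *
        (qFact t cd ^ 2 * qFact t (ce + s) * qFact t (de + k) /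
          (qFact t s * qFact t k * qFact t c * qFact t d)) * treeCoeff t a b c d e f cd 0 by
        field_simp, e6, ← e5]
    field_simp
  rw [Finset.sum_congr rfl e4, ← Finset.mul_sum, e3,
    show de + ce + cd + 1 = ce + de + cd + 1 by ring, show de + ce + 1 = e + 1 by omega]
  have := hF cd
  field_simp

end Tetrahedron

end QSpin


namespace QSpin

/-! ### The evaluation as a balanced hypergeometric sum -/

section Evaluation

variable {K : Type*} [Field K]
variable {a b c d e f ab ae be ac af cf cd ce de bd bf df : ℕ}

/-- Conservation of weight at the extremal vertices imposes `l + m = ab` and `r = m + df`, leaving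
one free label. The upper limit of `r` causes no loss: beyond it the norm `gb t bf m` is zero. -/
theorem treeCoeff_eq_sum_antidiagonal (t : K)
    (H : TetStrands a b c d e f ab ae be ac af cf cd ce de bd bf df) :
    treeCoeff t a b c d e f cd 0 = ∑ p ∈ Finset.HasAntidiagonal.antidiagonal ab,
      mergeCoeff t a f c p.1 (p.2 + df) cd / (gb t f (p.2 + df) * gb t a p.1) *
        ((-t⁻¹) ^ df * t ^ (p.2 * bd) * gb t bf p.2 / gb t b p.2) *
          ((-t⁻¹) ^ p.1 * t ^ (p.2 * be) * gb t ab p.1) := by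
  obtain ⟨h1, h2, h3, h4, h5, h6, h7, h8, h9, h10, h11, h12⟩ := H
  have e1 : ∀ l m, splitCoeff t e a b 0 l m = _ := splitCoeff_zero_left t h1 h2 h3
  have e2 : ∀ m r, splitCoeff t b f d m r 0 = _ :=
    splitCoeff_zero_right t h12 (by omega : d = df + bd) h10
  rw [treeCoeff, Finset.sum_comm]
  have e3 : ∀ l ∈ Finset.range (a + 1), (∑ r ∈ Finset.range (f + 1), ∑ m ∈ Finset.range (b + 1),
      mergeCoeff t a f c l r cd / (gb t f r * gb t a l) * (splitCoeff t b f d m r 0 / gb t b m) *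
        splitCoeff t e a b 0 l m) = ∑ m ∈ Finset.range (b + 1), if l + m = ab then
      mergeCoeff t a f c l (m + df) cd / (gb t f (m + df) * gb t a l) *
        ((-t⁻¹) ^ df * t ^ (m * bd) * gb t bf m / gb t b m) *
          ((-t⁻¹) ^ l * t ^ (m * be) * gb t ab l) else 0 := by
    intro l _
    rw [Finset.sum_comm]
    refine Finset.sum_congr rfl fun m _ => ?_
    simp only [e1, e2]
    split_ifs with hlm
    · by_cases hm : m ≤ bf
      · rw [Finset.sum_eq_single_of_mem (m + df) (Finset.mem_range.mpr (by omega)), if_pos rfl]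
        intro r _ hr
        rw [if_neg hr]
        ring
      · rw [gb_eq_zero t (not_le.mp hm)]
        simp
    · simp
  rw [Finset.sum_congr rfl e3, ← Finset.sum_product', ← Finset.sum_subset
    (s₁ := Finset.HasAntidiagonal.antidiagonal ab)]
  · refine Finset.sum_congr rfl fun p hp => ?_
    rw [if_pos (by simpa using hp)]
  · intro p hp
    rw [Finset.HasAntidiagonal.mem_antidiagonal] at hp
    simp only [Finset.mem_product, Finset.mem_range]
    omega
  · intro p _ hp
    rw [if_neg (by simpa using hp)]

/-- The summand of the hypergeometric sum computed by the network. -/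
def tetTerm (t : K) (ab af be cf ce e cd : ℕ) (u : ℕ) : K :=
  (-1) ^ u * (qF t (ce + u) * qF t ((af : ℤ) + cd - u) * qF t (be + u)) *
    (iF t u * iF t ((cd : ℤ) - u) * iF t ((cf : ℤ) - cd + u) * iF t ((ab : ℤ) - u) *
      iF t ((e : ℤ) + 1 + u))

/-- Bookkeeping for the next lemma, stated with letters: the four factors assumed nonzero are those
that cancel. -/
theorem div_mul_rearrange (S A₁ A₂ Z₁ Z₂ P₁ P₂ P₃ P₄ D₁ D₂ D₃ U X Y Fc Fce Ff Fa Fb Fbf Fab Fn Fm Fl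
    Fae Fbe Fr : K) (hr : Fr ≠ 0) (hn : Fn ≠ 0) (hl : Fl ≠ 0) (hm : Fm ≠ 0) :
    S * Z₁ * (Fc * Fce⁻¹ * Fr⁻¹) * (U * Z₂ * X * Y) /
          (D₁ * Ff / (Fr * Fn) * (D₂ * Fa / (Fl * Fae))) *
        (A₁ * P₁ * (P₃ * Fbf / (Fm * Fn)) / (D₃ * Fb / (Fm * Fbe))) *
      (A₂ * P₂ * (P₄ * Fab / (Fl * Fm))) = 
    (S * (A₁ * A₂)) * (Z₁ * Z₂ * (P₁ * P₂ * P₃ * P₄) / (D₁ * D₂ * D₃)) *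
      ((Fc * Fbf * Fab / (Fce * Ff * Fa * Fb)) * (U * X * Y * (Fbe * Fae / Fm))) := by
  simp only [div_eq_mul_inv, mul_inv, inv_inv]
  have e1 := mul_inv_cancel₀ hr
  have e2 := mul_inv_cancel₀ hn
  have e3 := mul_inv_cancel₀ hl
  have e4 := mul_inv_cancel₀ hm
  calc _ = (S * (A₁ * A₂)) * (Z₁ * Z₂ * (P₁ * P₂ * P₃ * P₄) * (D₁⁻¹ * D₂⁻¹ * D₃⁻¹)) *
      ((Fc * Fbf * Fab * (Fce⁻¹ * Ff⁻¹ * Fa⁻¹ * Fb⁻¹)) * (U * X * Y * (Fbe * Fae * Fm⁻¹))) *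
      ((Fr * Fr⁻¹) * (Fn * Fn⁻¹) * (Fl * Fl⁻¹) * (Fm * Fm⁻¹)) := by ring
    _ = _ := by rw [e1, e2, e3, e4]; ring

/-- Insertion of the closed forms. The result is arranged so that, for fixed `u`, the dependence on
`l` and `m` in the last bracket is a q-Chu–Vandermonde summand. -/
theorem treeCoeff_summand {t : K} (h : Generic t)
    (H : TetStrands a b c d e f ab ae be ac af cf cd ce de bd bf df) {l m : ℕ} (hlm : l + m = ab) :
    mergeCoeff t a f c l (m + df) cd / (gb t f (m + df) * gb t a l) *
        ((-t⁻¹) ^ df * t ^ (m * bd) * gb t bf m / gb t b m) *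
          ((-t⁻¹) ^ l * t ^ (m * be) * gb t ab l) =
      (-1) ^ (af + df) * t ^ (-(cd : ℤ)) * (qFact t cf * qFact t bf * qFact t ab /
        (qFact t ce * qFact t f * qFact t a * qFact t b)) *
      ∑ u ∈ Finset.range (cd + 1), (-1) ^ u * (qF t (ce + u) * qF t ((af : ℤ) + cd - u)) *
        (iF t u * iF t ((cd : ℤ) - u) * iF t ((cf : ℤ) - cd + u)) *
        (iF t ((l : ℤ) - u) * t ^ ((m : ℤ) * (be + 1 + u) - (l - u) * (ae + 1)) *
          (qFact t (be + l) * qFact t (ae + m) / qFact t m)) := by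
  have h0 := h.ne_zero
  have hF := h.qFact_ne_zero
  obtain ⟨h1, h2, h3, h4, h5, h6, h7, h8, h9, h10, h11, h12⟩ := H
  -- If `m > bf`, the left side has the factor `gb t bf m = 0`, and on the right `iF` is taken at a
  -- negative integer: `cf - cd + u` when `u ≤ l`, and `l - u` otherwise.
  by_cases hm : m ≤ bf
  · rw [mergeCoeff_eq h h4 h6 h5 l (m + df) cd (by omega) (by omega), Finset.mul_sum,
      Finset.mul_sum, Finset.sum_div, Finset.sum_mul, Finset.sum_mul]
    refine Finset.sum_congr rfl fun u _ => ?_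
    obtain ⟨n, hn⟩ := Nat.exists_eq_add_of_le hm
    rw [mul_gb h (m := n) (by omega : m + df + n = f), mul_gb h (m := ae + m) (by omega : l + (ae + m) = a),
      mul_gb h hn.symm, mul_gb h (m := be + l) (by omega : m + (be + l) = b), mul_gb h hlm]
    have s1 : ((-1 : K)) ^ (af + l) * ((-t⁻¹) ^ df * (-t⁻¹) ^ l) =
        (-1) ^ (af + df) * (t ^ (-(df + l : ℤ))) := by
      rw [neg_pow t⁻¹ df, neg_pow t⁻¹ l, pow_add, pow_add, zpow_neg, ← Nat.cast_add, zpow_natCast,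
        pow_add, inv_pow, inv_pow, mul_inv]
      have : ((-1 : K)) ^ l * (-1) ^ l = 1 := by rw [← mul_pow]; simp
      linear_combination ((-1) ^ af * (-1) ^ df * (t ^ df)⁻¹ * (t ^ l)⁻¹) * this
    have s2 : (t ^ (((m + df : ℕ) : ℤ) * (f - (m + df : ℕ) + 1) - cd) * t ^ ((u : ℤ) * (a - l + 1)) *
        t ^ (-(df + l : ℤ)) * (t ^ (m * bd) * t ^ (m * be) * t ^ (m * n) * t ^ (l * m))) =
        t ^ (-(cd : ℤ)) * t ^ ((m : ℤ) * (be + 1 + u) - (l - u) * (ae + 1)) *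
        (t ^ ((m + df) * n) * t ^ (l * (ae + m)) * t ^ (m * (be + l))) := by
      simp only [← zpow_natCast]
      simp only [← zpow_add₀ h0]
      congr 1
      have i1 : (f : ℤ) = m + df + n := by omega
      have i2 : (a : ℤ) = l + ae + m := by omega
      have i3 : (bd : ℤ) = be + l - n := by omega
      rw [i1, i2]
      push_cast
      rw [i3]
      ring
    simp only [mergeTerm, Int.natAbs_natCast, qF_natCast]
    rw [show (c : ℤ) - cd = ce by omega, iF_natCast, iF_natCast]
    have := hF m; have := hF l; have := hF n; have := hF (m + df); have := hF (ae + m)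
    have := hF (be + l); have := hF f; have := hF a; have := hF b; have := hF ce
    have := hF bf; have := hF ab
    generalize qF t ((ce : ℤ) + u) * qF t ((af : ℤ) + cd - u) = X
    generalize iF t (u : ℤ) = Y₁
    generalize iF t ((cd : ℤ) - u) = Y₂
    generalize iF t ((l : ℤ) - u) = Y₃
    generalize iF t ((cf : ℤ) - cd + u) = Y₄
    have d0 : t ^ ((m + df) * n) * t ^ (l * (ae + m)) * t ^ (m * (be + l)) ≠ 0 := by
      exact mul_ne_zero (mul_ne_zero (pow_ne_zero _ h0) (pow_ne_zero _ h0)) (pow_ne_zero _ h0)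
    generalize t ^ (((m + df : ℕ) : ℤ) * (f - (m + df : ℕ) + 1) - cd) = Z₁ at s2 ⊢
    generalize t ^ ((u : ℤ) * (a - l + 1)) = Z₂ at s2 ⊢
    generalize t ^ (-(df + l : ℤ)) = Z₃ at s1 s2
    generalize t ^ (-(cd : ℤ)) = Z₄ at s2 ⊢
    generalize t ^ ((m : ℤ) * (be + 1 + u) - (l - u) * (ae + 1)) = Z₅ at s2 ⊢
    generalize (-t⁻¹) ^ df = A₁ at s1 ⊢
    generalize (-t⁻¹) ^ l = A₂ at s1 ⊢
    rw [eq_comm, ← eq_div_iff d0] at s2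
    have d1 : t ^ ((m + df) * n) ≠ 0 := pow_ne_zero _ h0
    have d2 : t ^ (l * (ae + m)) ≠ 0 := pow_ne_zero _ h0
    have d3 : t ^ (m * (be + l)) ≠ 0 := pow_ne_zero _ h0
    clear d0
    generalize t ^ ((m + df) * n) = D₁ at d1 s2 ⊢
    generalize t ^ (l * (ae + m)) = D₂ at d2 s2 ⊢
    generalize t ^ (m * (be + l)) = D₃ at d3 s2 ⊢
    generalize t ^ (m * bd) = P₁ at s2 ⊢
    generalize t ^ (m * be) = P₂ at s2 ⊢
    generalize t ^ (m * n) = P₃ at s2 ⊢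
    generalize t ^ (l * m) = P₄ at s2 ⊢
    rw [div_mul_rearrange _ _ _ _ _ _ _ _ _ _ _ _ _ _ _ _ _ _ _ _ _ _ _ _ _ _ _ _ (hF (m + df)) (hF n)
      (hF l) (hF m), s1]
    trans (-1) ^ (af + df) * (Z₁ * Z₂ * Z₃ * (P₁ * P₂ * P₃ * P₄) / (D₁ * D₂ * D₃)) *
      ((qFact t cf * qFact t bf * qFact t ab /
        (qFact t ce * qFact t f * qFact t a * qFact t b)) *
        ((-1) ^ u * X * (Y₁ * Y₂ * Y₃ * Y₄) * (qFact t (be + l) * qFact t (ae + m) / qFact t m)))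
    · ring
    · rw [← s2]; ring
  · rw [gb_eq_zero t (not_le.mp hm), mul_zero, zero_div, mul_zero, zero_mul,
      Finset.sum_eq_zero, mul_zero]
    intro u _
    by_cases hu : u ≤ l
    · rw [iF_of_neg t (n := (cf : ℤ) - cd + u) (by omega)]
      ring
    · rw [iF_of_neg t (n := (l : ℤ) - u) (by omega)]
      ring

/-- The hypergeometric form of the reduced evaluation. -/
theorem treeCoeff_eq {t : K} (h : Generic t)
    (H : TetStrands a b c d e f ab ae be ac af cf cd ce de bd bf df) :
    treeCoeff t a b c d e f cd 0 = (-1) ^ (af + df) * t ^ (-(cd : ℤ)) *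
      (qFact t cf * qFact t bf * qFact t ab /
        (qFact t ce * qFact t f * qFact t a * qFact t b)) *
      (qFact t ae * qFact t (ab + ae + be + 1)) *
      ∑ u ∈ Finset.range (cd + 1), tetTerm t ab af be cf ce e cd u := by
  have h0 := h.ne_zero
  have hF := h.qFact_ne_zero
  rw [treeCoeff_eq_sum_antidiagonal t H, Finset.sum_congr rfl fun p hp => treeCoeff_summand h H
    (Finset.HasAntidiagonal.mem_antidiagonal.mp hp), ← Finset.mul_sum, Finset.sum_comm]
  rw [mul_assoc _ (qFact t ae * _)]
  congr 1
  rw [Finset.mul_sum]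
  refine Finset.sum_congr rfl fun u _ => ?_
  have he := H.abe_e
  rw [← Finset.mul_sum, tetTerm]
  -- After the exchange of summations the inner sum starts effectively at `l = u`. With `l = u + i`
  -- it is the q-Chu–Vandermonde sum of order `ab - u`.
  have key : ∑ p ∈ Finset.HasAntidiagonal.antidiagonal ab, (iF t ((p.1 : ℤ) - u) *
      t ^ ((p.2 : ℤ) * (be + 1 + u) - (p.1 - u) * (ae + 1)) *
      (qFact t (be + p.1) * qFact t (ae + p.2) / qFact t p.2)) =
      qFact t ae * qFact t (ab + ae + be + 1) * (qF t (be + u) *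
        (iF t ((ab : ℤ) - u) * iF t ((e : ℤ) + 1 + u))) := by
    by_cases hu : u ≤ ab
    · obtain ⟨n, rfl⟩ := Nat.exists_eq_add_of_le hu
      have e1 := sum_antidiagonal_qFact h (be + u) ae n
      rw [show ((u + n : ℕ) : ℤ) - u = n by push_cast; ring,
        show (e : ℤ) + 1 + u = (be + u + ae + 1 : ℕ) by push_cast; omega, ← Nat.cast_add,
        qF_natCast, iF_natCast, iF_natCast,
        show u + n + ae + be + 1 = be + u + ae + n + 1 by ring,
        show qFact t ae * qFact t (be + u + ae + n + 1) * (qFact t (be + u) * ((qFact t n)⁻¹ *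
          (qFact t (be + u + ae + 1))⁻¹)) = qFact t (be + u) * qFact t ae *
          qFact t (be + u + ae + n + 1) / (qFact t n * qFact t (be + u + ae + 1)) by
          field_simp, ← e1]
      rw [Finset.Nat.sum_antidiagonal_eq_sum_range_succ_mk,
        Finset.Nat.sum_antidiagonal_eq_sum_range_succ_mk, Nat.succ_eq_add_one, add_assoc u n 1,
        Finset.sum_range_add, Finset.sum_eq_zero, zero_add]
      · refine Finset.sum_congr rfl fun i hi => ?_
        simp only
        rw [show ((u + i : ℕ) : ℤ) - u = i by push_cast; ring, iF_natCast,
          show be + (u + i) = be + u + i by ring, Nat.add_sub_add_left]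
        push_cast
        rw [show (be : ℤ) + 1 + u = be + u + 1 by ring]
        have := hF i; have := hF (n - i)
        field_simp
      · intro i hi
        rw [Finset.mem_range] at hi
        simp only
        rw [iF_of_neg t (by omega), zero_mul, zero_mul]
    · rw [iF_of_neg t (n := (ab : ℤ) - u) (by omega), Finset.sum_eq_zero]
      · ring
      · intro p hp
        rw [Finset.HasAntidiagonal.mem_antidiagonal] at hp
        rw [iF_of_neg t (by omega)]
        ring
  rw [key]
  ring

/-- Everything except the projector on edge e is an equivariant endomorphism, so the closure reduces
to its value at the highest weight vector. -/
theorem tetBracket_eq {t : K} (h : Generic t)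
    (H : TetStrands a b c d e f ab ae be ac af cf cd ce de bd bf df) :
    tetBracket t a b c d e f = (-1) ^ e * qi t (e + 1) *
      opK (c + d) (treeKer t a b c d e f) (opK e (merge t c d e) (sym t 0))
        (List.replicate e false) := by
  have h0 := h.ne_zero
  have s3 := strands_eq H.cde_c H.cde_d H.cde_e
  have E3 : Equi t (c + d) e (merge t c d e) := by
    have := H.cde_c; have := H.cde_d; have := H.cde_e
    apply equi_merge h0 <;> omega
  have key : ∀ φ, opK e (comp (a + b) (split t e a b)
    (comp (a + b) (tens a a (jonesWenzl t a) (jonesWenzl t b))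
    (comp (a + (f + d)) (tens a a idK (split t b f d))
    (comp (a + (f + d)) (tens a a idK (tens f f (jonesWenzl t f) (jonesWenzl t d)))
    (comp (c + d) (tens (a + f) c (merge t a f c) idK)
    (comp (c + d) (tens c c (jonesWenzl t c) idK)
      (merge t c d e))))))) φ = opK (c + d) (treeKer t a b c d e f) (opK e (merge t c d e) φ) := by
    intro φ
    simp only [treeKer, opK_comp]
  have hY' : Equi t e e (comp (a + b) (split t e a b)
    (comp (a + b) (tens a a (jonesWenzl t a) (jonesWenzl t b))
    (comp (a + (f + d)) (tens a a idK (split t b f d))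
    (comp (a + (f + d)) (tens a a idK (tens f f (jonesWenzl t f) (jonesWenzl t d)))
    (comp (c + d) (tens (a + f) c (merge t a f c) idK)
    (comp (c + d) (tens c c (jonesWenzl t c) idK)
      (merge t c d e))))))) := by
    obtain ⟨h1, h2, h3, h4, h5, h6, h7, h8, h9, h10, h11, h12⟩ := H
    have s1 := strands_eq h1 h2 h3
    have s2 := strands_eq h4 h6 h5
    have s4 := strands_eq (i := f) (j := d) (k := b) h12 h11 h10
    have E1 : Equi t e (a + b) (split t e a b) := by apply equi_split h0 <;> omega
    have E2 : Equi t (a + f) c (merge t a f c) := by apply equi_merge h0 <;> omega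
    have E4 : Equi t b (f + d) (split t b f d) := by apply equi_split h0 <;> omega
    have jw := equi_jonesWenzl h0
    have E5 := E2.tens (equi_id t d)
    rw [add_assoc] at E5
    exact E1.comp (((jw a).tens (jw b)).comp (((equi_id t a).tens E4).comp
      (((equi_id t a).tens ((jw f).tens (jw d))).comp
        (E5.comp (((jw c).tens (equi_id t d)).comp E3)))))
  rw [tetBracket, closure_jonesWenzl_comp h hY', key]

/-- The standard evaluation of the tetrahedron as a hypergeometric sum. -/
theorem tetEval_eq_tetTerm {t : K} (h : Generic t)
    (H : TetStrands a b c d e f ab ae be ac af cf cd ce de bd bf df) :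
    tetEval t a b c d e f = (-1) ^ (e + af + df) *
      (qFact t (ab + ae + be + 1) * qFact t (ce + de + cd + 1) /
        (qFact t be * qFact t ac * qFact t af * qFact t ce * qFact t bd * qFact t df)) *
      ∑ u ∈ Finset.range (cd + 1), tetTerm t ab af be cf ce e cd u := by
  have h0 := h.ne_zero
  have hF := h.qFact_ne_zero
  have v1 : vertexFact t a b e = qFact t ab * qFact t ae * qFact t be := by
    obtain ⟨s1, s2, s3⟩ := strands_eq H.abe_a H.abe_b H.abe_e
    rw [vertexFact, s1, s2, s3]
  have v2 : vertexFact t a c f = qFact t ac * qFact t af * qFact t cf := by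
    obtain ⟨s1, s2, s3⟩ := strands_eq (i := a) (j := c) (k := f) (p := af) (y := ac) (q := cf)
      (by have := H.acf_a; omega) H.acf_c H.acf_f
    rw [vertexFact, s1, s2, s3]
  have v3 : vertexFact t c d e = qFact t cd * qFact t ce * qFact t de := by
    obtain ⟨s1, s2, s3⟩ := strands_eq H.cde_c H.cde_d H.cde_e
    rw [vertexFact, s1, s2, s3]
  have v4 : vertexFact t b d f = qFact t bd * qFact t bf * qFact t df := by
    obtain ⟨s1, s2, s3⟩ := strands_eq (i := b) (j := d) (k := f) (p := bf) (y := bd) (q := df)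
      H.bdf_b (by have := H.bdf_d; omega) H.bdf_f
    rw [vertexFact, s1, s2, s3]
  rw [tetEval, v1, v2, v3, v4, tetBracket_eq h H, opK_treeKer_merge h H, treeCoeff_eq h H,
    qFact_succ t e, zpow_neg, zpow_natCast, pow_add, pow_add, pow_add]
  have q1 := h.qi_ne_zero (n := (e : ℤ) + 1) (by omega)
  have := hF a; have := hF b; have := hF c; have := hF d; have := hF e; have := hF f
  have := hF ab; have := hF ae; have := hF be; have := hF ac; have := hF af; have := hF cf
  have := hF cd; have := hF ce; have := hF de; have := hF bd; have := hF bf; have := hF df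
  field_simp

end Evaluation

end QSpin


namespace QSpin

/-! ### Vanishing q-differences and the q-Saalschütz sum -/

section Racah

variable {K : Type*} [Field K]

/-- A product of quantum integers of `u + x`, for `x` in a list, is annihilated by the `q`-analogue
of a finite difference of higher order. -/
theorem sum_prod_qi_eq_zero {t : K} (h : Generic t) (xs : List ℤ) :
    ∑ u ∈ Finset.range (xs.length + 2), (-1) ^ u * (iF t u * iF t ((xs.length + 1 : ℕ) - u)) *
      (xs.map fun x => qi t (u + x)).prod = 0 := by
  suffices H : ∀ (n : ℕ) (xs : List ℤ), xs.length = n → ∑ u ∈ Finset.range (n + 2),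
      (-1) ^ u * (iF t u * iF t ((n + 1 : ℕ) - u)) * (xs.map fun x => qi t (u + x)).prod = 0 from
    H _ xs rfl
  intro n
  induction n with
  | zero =>
    intro xs hxs
    rw [List.length_eq_zero_iff.mp hxs]
    simp [Finset.sum_range_succ]
    ring
  | succ n ih =>
    intro xs hxs
    obtain ⟨x, xs, rfl⟩ := List.exists_cons_of_length_eq_add_one hxs
    have hxs' : xs.length = n := by simpa using hxs
    -- Multiply by [n+2] and write [u+x][n+2] = [n+2+x][u] + [x][n+2-u]. The factors [u] and [n+2-u]
    -- are absorbed by the inverse factorials, leaving two q-differences of lower order, the first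
    -- with all entries of the list shifted by one.
    apply (mul_eq_zero_iff_left (h.qi_ne_zero (n := (n : ℤ) + 2) (by omega))).mp
    have e1 : ∀ u : ℕ, (-1) ^ u * (iF t u * iF t ((n + 1 + 1 : ℕ) - u)) *
        ((x :: xs).map fun x => qi t (u + x)).prod * qi t ((n : ℤ) + 2) =
        qi t (n + 2 + x) * ((-1) ^ u * (qi t u * iF t u * iF t ((n + 1 + 1 : ℕ) - u)) *
          (xs.map fun x => qi t (u + x)).prod) +
        qi t x * ((-1) ^ u * (iF t u * (qi t ((n + 1 + 1 : ℕ) - u) * iF t ((n + 1 + 1 : ℕ) - u))) *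
          (xs.map fun x => qi t (u + x)).prod) := by
      intro u
      have e2 := qi_mul_qi h (u + x) (n + 2) x
      rw [show (u : ℤ) + x - x = u by ring, show (n : ℤ) + 2 - (u + x) + x =
        ((n + 1 + 1 : ℕ) : ℤ) - u by push_cast; ring] at e2
      rw [List.map_cons, List.prod_cons]
      linear_combination ((-1) ^ u * (iF t u * iF t ((n + 1 + 1 : ℕ) - u)) *
        (xs.map fun x => qi t (u + x)).prod) * e2
    rw [mul_comm, Finset.sum_mul, Finset.sum_congr rfl fun u _ => e1 u, Finset.sum_add_distrib,
      ← Finset.mul_sum, ← Finset.mul_sum, Finset.sum_range_succ',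
      Finset.sum_range_succ (fun u : ℕ => (-1) ^ u * (iF t u * (qi t ((n + 1 + 1 : ℕ) - u) * _)) * _)]
    have e3 := ih (xs.map (· + 1)) (by simpa using hxs')
    have e4 := ih xs hxs'
    simp only [Nat.cast_zero, qi_zero, zero_mul, mul_zero, add_zero, sub_self]
    rw [show ∑ u ∈ Finset.range (n + 2), (-1) ^ (u + 1) * (qi t (u + 1 : ℕ) * iF t (u + 1 : ℕ) *
        iF t ((n + 1 + 1 : ℕ) - (u + 1 : ℕ))) * (xs.map fun x => qi t ((u + 1 : ℕ) + x)).prod =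
        -∑ u ∈ Finset.range (n + 2), (-1) ^ u * (iF t u * iF t ((n + 1 : ℕ) - u)) *
          ((xs.map (· + 1)).map fun x => qi t (u + x)).prod by
      rw [← Finset.sum_neg_distrib]
      refine Finset.sum_congr rfl fun u _ => ?_
      rw [← h.iF_pred, List.map_map, pow_succ]
      have : ∀ x : ℤ, ((u + 1 : ℕ) : ℤ) + x = u + (x + 1) := fun x => by push_cast; ring
      simp only [this, Function.comp_def]
      rw [show ((u + 1 : ℕ) : ℤ) - 1 = u by push_cast; ring,
        show ((n + 1 + 1 : ℕ) : ℤ) - (u + 1 : ℕ) = (n + 1 : ℕ) - u by push_cast; ring]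
      ring, e3, show ∑ u ∈ Finset.range (n + 2), (-1) ^ u * (iF t u * (qi t ((n + 1 + 1 : ℕ) - u) *
        iF t ((n + 1 + 1 : ℕ) - u))) * (xs.map fun x => qi t (u + x)).prod =
        ∑ u ∈ Finset.range (n + 2), (-1) ^ u * (iF t u * iF t ((n + 1 : ℕ) - u)) *
          (xs.map fun x => qi t (u + x)).prod by
      refine Finset.sum_congr rfl fun u _ => ?_
      rw [← h.iF_pred, show ((n + 1 + 1 : ℕ) : ℤ) - u - 1 = (n + 1 : ℕ) - u by push_cast; ring], e4]
    ring

/-- For negative `n` the formula persists: the product then contains [0], which agrees with the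
convention for `iF`. Hence quotients of factorials may be treated as products of quantum integers
without case distinctions. -/
theorem qF_mul_iF_eq_prod {t : K} (h : Generic t) (n : ℤ) (p : ℕ) (hn : 0 ≤ n + p) :
    qF t (n + p) * iF t n = ∏ i ∈ Finset.range p, qi t (n + i + 1) := by
  rcases lt_or_ge n 0 with hneg | hpos
  · rw [iF_of_neg t hneg, mul_zero, eq_comm, Finset.prod_eq_zero_iff]
    refine ⟨(-n - 1).toNat, Finset.mem_range.mpr (by omega), ?_⟩
    rw [show n + ((-n - 1).toNat : ℤ) + 1 = 0 by omega, qi_zero]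
  · induction p with
    | zero => simp [h.qF_mul_iF hpos]
    | succ p ih =>
      rw [Finset.prod_range_succ, ← ih (by omega)]
      push_cast
      rw [← add_assoc, qF_add_one t (by omega)]
      ring

/-- A vanishing sum of quotients of quantum factorials. -/
theorem sum_qF_ratio_eq_zero {t : K} (h : Generic t) (A B C P Q : ℤ) (hP : 0 ≤ P) (hQB : B ≤ Q)
    (hPC : C ≤ P) (hQA : A ≤ Q) (hB : P - C + (Q - A) + 1 = B) (M : ℕ) (hM : B < M) :
    ∑ u ∈ Finset.range M, (-1) ^ u * (qF t (P + u) * qF t (Q - u)) *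
      (iF t u * iF t (B - u) * iF t (C + u) * iF t (A - u)) = 0 := by
  obtain ⟨p, hp⟩ := Int.eq_ofNat_of_zero_le (show 0 ≤ P - C by omega)
  obtain ⟨q, hq⟩ := Int.eq_ofNat_of_zero_le (show 0 ≤ Q - A by omega)
  -- The two quotients of factorials are products of `P - C` and `Q - A` quantum integers, in `u`
  -- and in `-u`. The balance condition makes the order `B` of the difference exceed their total
  -- number by one.
  have key := sum_prod_qi_eq_zero h ((List.range p).map (fun i : ℕ => C + i + 1) ++
    (List.range q).map (fun i : ℕ => -A - i - 1))
  simp only [List.length_append, List.length_map, List.length_range] at key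
  rw [← Finset.sum_subset (s₁ := Finset.range (p + q + 2)) (by
    intro u; simp only [Finset.mem_range]; omega)]
  · rw [← mul_zero ((-1) ^ q), ← key, Finset.mul_sum]
    refine Finset.sum_congr rfl fun u hu => ?_
    rw [Finset.mem_range] at hu
    have e1 := qF_mul_iF_eq_prod h (C + u) p (by omega)
    have e2 := qF_mul_iF_eq_prod h (A - u) q (by omega)
    rw [show C + u + p = P + u by omega] at e1
    rw [show A - u + q = Q - u by omega] at e2
    rw [List.map_append, List.prod_append, List.map_map, List.map_map,
      show ((p + q + 1 : ℕ) : ℤ) = B by omega]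
    have e3 : ((List.range p).map ((fun x => qi t (u + x)) ∘ fun i : ℕ => C + i + 1)).prod =
        ∏ i ∈ Finset.range p, qi t (C + u + i + 1) := by
      rw [Finset.prod_range]
      rw [← List.prod_ofFn]
      congr 1
      rw [List.ofFn_eq_map, ← List.map_coe_finRange_eq_range, List.map_map]
      refine List.map_congr_left fun i _ => ?_
      simp only [Function.comp_apply]
      congr 1
      ring
    have e4 : (-1) ^ q * ((List.range q).map
        ((fun x => qi t (u + x)) ∘ fun i : ℕ => -A - i - 1)).prod =
        ∏ i ∈ Finset.range q, qi t (A - u + i + 1) := by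
      have : ∀ i : ℕ, qi t (A - u + i + 1) = -1 * qi t (u + (-A - i - 1)) := by
        intro i
        rw [show A - u + i + 1 = -((u : ℤ) + (-A - i - 1)) by ring, qi_neg]
        ring
      simp only [this]
      rw [Finset.prod_mul_distrib, Finset.prod_const, Finset.card_range, Finset.prod_range,
        ← List.prod_ofFn]
      congr 2
      rw [List.ofFn_eq_map, ← List.map_coe_finRange_eq_range, List.map_map]
      rfl
    rw [e3, ← e1]
    linear_combination (-((-1) ^ u * iF t u * iF t (B - u) * (qF t (P + u) * iF t (C + u)))) *
      (e4.trans e2.symm)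
  · intro u _ hu
    rw [Finset.mem_range] at hu
    rw [iF_of_neg t (n := B - u) (by omega)]
    ring

/-- The summand of the `q`-Saalschütz sum. -/
def saalTerm (t : K) (B d C P : ℤ) (u : ℕ) : K :=
  (-1) ^ u * (qF t (P + u) * qF t (C + B + d + u)) *
    (iF t u * iF t (B - u) * iF t (C + u) * iF t (P + 1 + d + u))

/-- Both neighbors on the right have `P` raised by one, and one of them has `d`, the other `B`,
lowered. The relation is the three-term relation in each summand, with a shift by one in the piece
containing [u]. -/
theorem sum_saalTerm_contiguous {t : K} (h : Generic t) (B : ℕ) (d C P : ℤ) (hC : 0 ≤ C + B + 1)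
    (hP : 0 ≤ P) (hd : 0 ≤ d) :
    qi t (P + 1) * ∑ u ∈ Finset.range (B + 2), saalTerm t (B + 1) d C P u =
      qi t (C + B + 1 + d) * ∑ u ∈ Finset.range (B + 2), saalTerm t (B + 1) (d - 1) C (P + 1) u -
      qi t (P - C - B - d) * ∑ u ∈ Finset.range (B + 1), saalTerm t B d (C + 1) (P + 1) u := by
  have e1 : ∀ u : ℕ, qi t (P + 1) * saalTerm t (B + 1) d C P u =
      qi t (C + B + 1 + d) * saalTerm t (B + 1) (d - 1) C (P + 1) u +
      qi t (P - C - B - d) * ((-1) ^ u * (qF t (P + u) * qF t (C + B + d + u)) *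
    (qi t u * iF t u * iF t (B + 1 - u) * iF t (C + u) * iF t (P + 1 + d + u))) := by
    intro u
    simp only [saalTerm]
    rcases lt_or_ge (C + u) 0 with hu | hu
    · rw [iF_of_neg t hu]; ring
    · have e2 := qi_mul_qi h (P + 1 + u) (C + B + 1 + d) u
      rw [show P + 1 + (u : ℤ) - u = P + 1 by ring,
        show C + B + 1 + d - (P + 1 + u) + u = -(P - C - B - d) by ring, qi_neg] at e2
      rw [show C + (B + 1) + d + (u : ℤ) = C + B + d + u + 1 by ring,
        show C + (B + 1) + (d - 1) + (u : ℤ) = C + B + d + u by ring,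
        show P + 1 + (u : ℤ) = P + u + 1 by ring, qF_add_one t (n := C + B + d + u) (by omega),
        qF_add_one t (n := P + u) (by omega), show P + 1 + 1 + (d - 1) + (u : ℤ) = P + 1 + d + u by ring]
      rw [show P + 1 + (u : ℤ) = P + u + 1 by ring,
        show C + B + 1 + d + (u : ℤ) = C + B + d + u + 1 by ring] at e2
      linear_combination (-((-1) ^ u * (qF t (P + u) * qF t (C + B + d + u)) *
        (iF t u * iF t (B + 1 - u) * iF t (C + u) * iF t (P + 1 + d + u)))) * e2
  rw [Finset.mul_sum, Finset.sum_congr rfl fun u _ => e1 u, Finset.sum_add_distrib,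
    ← Finset.mul_sum, ← Finset.mul_sum, sub_eq_add_neg (_ * _) (_ * _), ← mul_neg]
  congr 2
  rw [Finset.sum_range_succ', Nat.cast_zero, qi_zero, zero_mul, zero_mul, zero_mul, zero_mul,
    mul_zero, add_zero, ← Finset.sum_neg_distrib]
  refine Finset.sum_congr rfl fun u _ => ?_
  rw [← h.iF_pred, saalTerm, pow_succ]
  push_cast
  rw [show P + ((u : ℤ) + 1) = P + 1 + u by ring, show C + B + d + ((u : ℤ) + 1) = C + 1 + B + d + u by ring,
    show (u : ℤ) + 1 - 1 = u by ring, show (B : ℤ) + 1 - (u + 1) = B - u by ring,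
    show C + ((u : ℤ) + 1) = C + 1 + u by ring, show P + 1 + d + ((u : ℤ) + 1) = P + 1 + 1 + d + u by ring]
  ring

/-- At `d = -1` the factorials of `P + u` cancel, and the remaining sum is a vanishing q-difference.
It starts the induction on `d`. -/
theorem sum_saalTerm_neg_one {t : K} (h : Generic t) (B : ℕ) (C P : ℤ) (hC : 0 ≤ C + B)
    (hP : 0 ≤ P) :
    ∑ u ∈ Finset.range (B + 2), saalTerm t (B + 1) (-1) C P u = 0 := by
  rw [← sum_qF_ratio_eq_zero h (B + 1) (B + 1) C (C + B) (B + 1) hC (by omega) (by omega) (by omega)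
    (by omega) (B + 2) (by omega)]
  refine Finset.sum_congr rfl fun u hu => ?_
  rw [Finset.mem_range] at hu
  have e1 := h.qF_mul_iF (n := P + u) (by omega)
  have e2 := h.qF_mul_iF (n := (B : ℤ) + 1 - u) (by omega)
  rw [saalTerm, show C + ((B : ℤ) + 1) + -1 + u = C + B + u by ring,
    show P + 1 + -1 + (u : ℤ) = P + u by ring]
  linear_combination ((-1) ^ u * (qF t (C + B + u)) *
    (iF t u * iF t (B + 1 - u) * iF t (C + u))) * (e1 - e2)

/-- The `q`-Saalschütz sum. -/
theorem sum_saalTerm {t : K} (h : Generic t) (B d : ℕ) (C P : ℤ) (hC : 0 ≤ C + B) (hP : 0 ≤ P)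
    (hPC : C + B ≤ P) :
    ∑ u ∈ Finset.range (B + 1), saalTerm t B d C P u =
      (-1) ^ B * (qF t (B + d) * qF t (P - C) * qF t (C + B + d) * qF t P) *
        (iF t (P + 1 + d + B) * iF t d * iF t (P - C - B) * iF t B * iF t (C + B)) := by
  induction B generalizing d C P with
  | zero =>
    have e1 := h.qF_mul_iF (n := (d : ℤ)) (by omega)
    have e2 := h.qF_mul_iF (n := P - C) (by omega)
    simp only [zero_add, Finset.sum_range_one, Nat.cast_zero, sub_zero, add_zero, pow_zero, iF_zero,
      saalTerm]
    linear_combination (-(qF t P * qF t (C + d) * iF t C * iF t (P + 1 + d))) *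
      (e1 * (qF t (P - C) * iF t (P - C)) + e2)
  | succ B ih =>
    -- The outer induction on `B` supplies the term with smaller `B`; `step` reduces each `d` to `d
    -- - 1`, to be supplied by an inner induction on `d`.
    have step : ∀ (d : ℕ) (P : ℤ), 0 ≤ P → C + B + 1 ≤ P →
        qi t (C + B + 1 + d) * ∑ u ∈ Finset.range (B + 2), saalTerm t (B + 1) (d - 1) C (P + 1) u =
        qi t (C + B + 1 + d) * ((-1) ^ (B + 1) * (qF t (B + d) * qF t (P + 1 - C) *
          qF t (C + B + d) * qF t (P + 1)) *
        (iF t (P + 1 + d + (B + 1)) * (qi t d * iF t d) * iF t (P - C - B) * iF t (B + 1) *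
          iF t (C + B + 1))) →
        ∑ u ∈ Finset.range (B + 2), saalTerm t (B + 1) d C P u =
        (-1) ^ (B + 1) * (qF t (B + 1 + d) * qF t (P - C) * qF t (C + B + 1 + d) * qF t P) *
          (iF t (P + 1 + d + (B + 1)) * iF t d * iF t (P - C - B - 1) * iF t (B + 1) *
            iF t (C + B + 1)) := by
      intro d P hP hPC hstep
      apply mul_left_cancel₀ (h.qi_ne_zero (n := P + 1) (by omega))
      have hih := ih d (C + 1) (P + 1) (by omega) (by omega) (by omega)
      rw [sum_saalTerm_contiguous h B d C P (by push_cast at hC; omega) hP (by omega), hstep, hih]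
      have e2 := qi_mul_qi h (B + 1 + d) (P - C - B) (B + 1)
      rw [show (B : ℤ) + 1 + d - (B + 1) = d by ring, show P - C - B + ((B : ℤ) + 1) = P + 1 - C by ring,
        show P - C - B - (B + 1 + d) + ((B : ℤ) + 1) = P - C - B - d by ring] at e2
      have i1 := h.iF_pred (P - C - B)
      have i2 := h.iF_pred ((B : ℤ) + 1)
      rw [show (B : ℤ) + 1 - 1 = B by ring] at i2
      have q1 := qF_add_one t hP
      have q2 := qF_add_one t (n := B + d) (by omega)
      rw [show (B : ℤ) + d + 1 = B + 1 + d by ring] at q2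
      have q3 := qF_add_one t (n := P - C) (by omega)
      rw [show P - C + 1 = P + 1 - C by ring] at q3
      have q4 : qi t (C + B + 1 + d) * qF t (C + B + d) * qi t d = qF t (C + B + 1 + d) * qi t d := by
        rcases eq_or_lt_of_le (show 0 ≤ C + B + 1 + d by push_cast at hC; omega) with h0 | h0
        · have hd : d = 0 := by push_cast at hC; omega
          rw [hd, Nat.cast_zero, qi_zero, mul_zero, mul_zero]
        · have q5 := qF_eq_mul_pred t (n := C + B + 1 + d) (by omega)
          rw [show C + B + 1 + (d : ℤ) - 1 = C + B + d by ring] at q5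
          rw [q5]
      rw [i1, q2, q3, q1, show P + 1 - (C + 1) = P - C by ring, i2,
        show C + 1 + (B : ℤ) + d = C + B + 1 + d by ring, show C + 1 + (B : ℤ) = C + B + 1 by ring,
        show P + 1 + 1 + (d : ℤ) + B = P + 1 + d + (B + 1) by ring, pow_succ]
      linear_combination ((-1) ^ B * -1 * (qF t (B + d) * qF t (P - C) * (qi t (P + 1) * qF t P)) *
        (iF t (P + 1 + d + (B + 1)) * iF t d * iF t (P - C - B) * iF t (B + 1) *
          iF t (C + B + 1))) * (qi t (P + 1 - C) * q4 - qF t (C + B + 1 + d) * e2)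
    push_cast at hC hPC ⊢
    simp only [← add_assoc, ← sub_sub] at step hC hPC ⊢
    induction d generalizing P with
    | zero =>
      refine step 0 P hP hPC ?_
      rw [Nat.cast_zero, qi_zero, zero_mul, mul_zero, zero_mul, zero_mul, zero_mul, mul_zero, mul_zero]
      -- In the corner `C + B + 1 = 0` the vanishing lemma is not available, but the prefactor is
      -- [0].
      rcases eq_or_lt_of_le hC with h0 | h0
      · rw [← h0, zero_add, qi_zero, zero_mul]
      · rw [zero_sub, sum_saalTerm_neg_one h B C (P + 1) (by omega) (by omega), mul_zero]
    | succ d ihd =>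
      refine step (d + 1) P hP hPC ?_
      have := ihd (P + 1) (by omega) (by omega)
      have i1 := h.iF_pred ((d : ℤ) + 1)
      rw [add_sub_cancel_right] at i1
      push_cast
      rw [add_sub_cancel_right, this, ← i1]
      rw [show P + 1 - C - (B : ℤ) - 1 = P - C - B by ring,
        show P + 1 + 1 + (d : ℤ) + B + 1 = P + 1 + (d + 1) + B + 1 by ring,
        show (B : ℤ) + 1 + d = B + (d + 1) by ring, show C + (B : ℤ) + 1 + d = C + B + (d + 1) by ring]

end Racah

end QSpin


namespace QSpin

/-! ### From the balanced sum to the Racah sum -/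

section RacahSum

variable {K : Type*} [Field K]

/-- The summand of the Racah sum. -/
def racahTerm (t : K) (T₁ T₂ T₃ T₄ S₁ S₂ S₃ : ℤ) (z : ℕ) : K :=
  (-1) ^ z * qF t (z + 1) * (iF t (z - T₁) * iF t (z - T₂) * iF t (z - T₃) * iF t (z - T₄)) *
    (iF t (S₁ - z) * iF t (S₂ - z) * iF t (S₃ - z))

/-- The summand of the other balanced hypergeometric sum. -/
def balTerm (t : K) (T₁ T₂ T₃ T₄ S₁ S₂ S₃ : ℤ) (u : ℕ) : K :=
  (-1) ^ u * (qF t (S₃ - T₄ + u) * qF t (S₁ + S₂ - T₁ - T₂ - u) * qF t (S₃ - T₃ + u)) *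
    (iF t u * iF t (S₁ - T₁ - u) * iF t (S₃ - S₁ + u) * iF t (S₁ - T₂ - u) *
      iF t (T₁ + T₂ - S₁ + 1 + u))

/-- The prefactor of the balanced sum. -/
def balFactor (t : K) (T₁ T₂ T₃ T₄ S₁ S₂ S₃ : ℤ) : K :=
  (-1) ^ S₁ * (qF t (T₁ + 1) * qF t (T₂ + 1)) * (iF t (S₂ - T₁) * iF t (S₂ - T₂) * iF t (S₁ - T₃) *
    iF t (S₁ - T₄) * iF t (S₃ - T₃) * iF t (S₃ - T₄))

/-- Here [S₂-T₁][z+2] is split so that one factor cancels in `z + 1 - T₁` and the other in `S₂ - z -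
1`. In both shifted parameter sets the difference `S₂ - T₁` drops by one. -/
theorem racahTerm_succ {t : K} (h : Generic t) (T₁ T₂ T₃ T₄ S₁ S₂ S₃ : ℤ) (z : ℕ) :
    qi t (S₂ - T₁) * racahTerm t T₁ T₂ T₃ T₄ S₁ S₂ S₃ (z + 1) =
      -(qi t (S₂ + 1) * racahTerm t T₁ (T₂ - 1) (T₃ - 1) (T₄ - 1) (S₁ - 1) (S₂ - 1) (S₃ - 1) z) -
      qi t (T₁ + 1) *
        racahTerm t (T₁ - 1) (T₂ - 1) (T₃ - 1) (T₄ - 1) (S₁ - 1) (S₂ - 2) (S₃ - 1) z := by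
  have e1 := qi_mul_qi h (S₂ - T₁) (z + 2) (S₂ - z - 1)
  rw [show S₂ - T₁ - (S₂ - z - 1) = z + 1 - T₁ by ring,
    show (z : ℤ) + 2 + (S₂ - z - 1) = S₂ + 1 by ring,
    show (z : ℤ) + 2 - (S₂ - T₁) + (S₂ - z - 1) = T₁ + 1 by ring] at e1
  have e2 := qF_add_one t (n := (z : ℤ) + 1) (by omega)
  rw [show (z : ℤ) + 1 + 1 = z + 2 by ring] at e2
  have e3 := h.iF_pred (z + 1 - T₁)
  rw [show (z : ℤ) + 1 - T₁ - 1 = z - T₁ by ring] at e3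
  have e4 := h.iF_pred (S₂ - z - 1)
  have k : ∀ T : ℤ, (z : ℤ) - (T - 1) = z + 1 - T := fun T => by ring
  have k' : ∀ S : ℤ, S - 1 - (z : ℤ) = S - (z + 1) := fun T => by ring
  simp only [racahTerm, k, k']
  push_cast
  rw [show (z : ℤ) + 1 + 1 = z + 2 by ring, e2, e3, show S₂ - 2 - (z : ℤ) = S₂ - z - 1 - 1 by ring, e4,
    show S₂ - ((z : ℤ) + 1) = S₂ - z - 1 by ring, pow_succ]
  linear_combination (-((-1) ^ z * qF t (z + 1) * (iF t (z + 1 - T₁) * iF t (z + 1 - T₂) *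
    iF t (z + 1 - T₃) * iF t (z + 1 - T₄)) * (iF t (S₁ - (z + 1)) * iF t (S₂ - z - 1) *
      iF t (S₃ - (z + 1))))) * e1

/-- The same relation for the other sum, up to the change of `balFactor` recorded in
`balFactor_sub_one` and `balFactor_sub_two`. -/
theorem balTerm_contiguous {t : K} (h : Generic t) {T₁ T₂ T₃ T₄ S₁ S₂ S₃ : ℤ} (hS : T₁ < S₂)
    (u : ℕ) :
    qi t (T₂ + 1) * balTerm t T₁ T₂ T₃ T₄ S₁ S₂ S₃ u =
      qi t (S₂ + 1) * balTerm t T₁ (T₂ - 1) (T₃ - 1) (T₄ - 1) (S₁ - 1) (S₂ - 1) (S₃ - 1) u +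
      qi t (S₂ - T₂) *
        balTerm t (T₁ - 1) (T₂ - 1) (T₃ - 1) (T₄ - 1) (S₁ - 1) (S₂ - 2) (S₃ - 1) u := by
  simp only [balTerm]
  rw [show S₁ - 1 - (T₂ - 1) - (u : ℤ) = S₁ - T₂ - u by ring]
  rcases lt_or_ge (S₁ - T₂ - u) 0 with hu | hu
  · rw [iF_of_neg t hu]; ring
  · have e1 := qi_mul_qi h (T₂ + 1) (S₁ + S₂ - T₁ - T₂ - u) (T₁ + T₂ - S₁ + 1 + u)
    rw [show T₂ + 1 - (T₁ + T₂ - S₁ + 1 + u) = S₁ - T₁ - u by ring,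
      show S₁ + S₂ - T₁ - T₂ - u + (T₁ + T₂ - S₁ + 1 + u) = S₂ + 1 by ring,
      show S₁ + S₂ - T₁ - T₂ - u - (T₂ + 1) + (T₁ + T₂ - S₁ + 1 + u) = S₂ - T₂ by ring] at e1
    have e2 := qF_eq_mul_pred t (n := S₁ + S₂ - T₁ - T₂ - u) (by omega)
    have e3 := h.iF_pred (S₁ - T₁ - u)
    have e4 := h.iF_pred (T₁ + T₂ - S₁ + 1 + u)
    rw [e2, show S₃ - 1 - (T₄ - 1) = S₃ - T₄ by ring, show S₃ - 1 - (T₃ - 1) = S₃ - T₃ by ring,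
      show S₁ - 1 + (S₂ - 1) - T₁ - (T₂ - 1) - (u : ℤ) = S₁ + S₂ - T₁ - T₂ - u - 1 by ring,
      show S₁ - 1 + (S₂ - 2) - (T₁ - 1) - (T₂ - 1) - (u : ℤ) = S₁ + S₂ - T₁ - T₂ - u - 1 by ring,
      show S₁ - 1 - T₁ - (u : ℤ) = S₁ - T₁ - u - 1 by ring, e3,
      show S₁ - 1 - (T₁ - 1) - (u : ℤ) = S₁ - T₁ - u by ring,
      show S₃ - 1 - (S₁ - 1) = S₃ - S₁ by ring,
      show T₁ + (T₂ - 1) - (S₁ - 1) + 1 + (u : ℤ) = T₁ + T₂ - S₁ + 1 + u by ring,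
      show T₁ - 1 + (T₂ - 1) - (S₁ - 1) + 1 + (u : ℤ) = T₁ + T₂ - S₁ + 1 + u - 1 by ring, e4]
    linear_combination ((-1) ^ u * (qF t (S₃ - T₄ + u) * qF t (S₁ + S₂ - T₁ - T₂ - u - 1) *
      qF t (S₃ - T₃ + u)) * (iF t u * iF t (S₁ - T₁ - u) * iF t (S₃ - S₁ + u) * iF t (S₁ - T₂ - u) *
      iF t (T₁ + T₂ - S₁ + 1 + u))) * e1

theorem iF_mul_iF_eq_zero (t : K) {m n : ℤ} (hmn : m + n < 0) : iF t m * iF t n = 0 := by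
  rcases lt_or_ge m 0 with hm | hm
  · rw [iF_of_neg t hm, zero_mul]
  · rw [iF_of_neg t (n := n) (by omega), mul_zero]

/-- When `S₂ = T₁` the conditions `z ≥ T₁` and `z ≤ S₂` leave a single term. -/
theorem sum_racahTerm_of_eq {t : K} {T₁ T₂ T₃ T₄ S₁ S₂ S₃ : ℤ} (hS : S₂ = T₁) (h1 : 0 ≤ T₁)
    {N : ℕ} (hN : S₂ < N) :
    ∑ z ∈ Finset.range N, racahTerm t T₁ T₂ T₃ T₄ S₁ S₂ S₃ z =
      (-1) ^ T₁ * qF t (T₁ + 1) * (iF t (T₁ - T₂) * iF t (T₁ - T₃) * iF t (T₁ - T₄)) *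
        (iF t (S₁ - T₁) * iF t (S₃ - T₁)) := by
  subst hS
  lift S₂ to ℕ using h1
  rw [Finset.sum_eq_single_of_mem S₂ (Finset.mem_range.mpr (by exact_mod_cast hN))]
  · rw [racahTerm, sub_self, iF_zero, zpow_natCast]
    ring
  · intro z _ hz
    have := iF_mul_iF_eq_zero t (m := (z : ℤ) - S₂ - 0) (n := 0)
    rw [racahTerm]
    rcases lt_or_gt_of_ne hz with hz' | hz'
    · rw [iF_of_neg t (n := (z : ℤ) - S₂) (by omega)]; ring
    · rw [iF_of_neg t (n := (S₂ : ℤ) - z) (by omega)]; ring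

/-- When `S₂ = T₁` the numerator factorial of `S₁ + S₂ - T₁ - T₂ - u` cancels against that of `S₁ -
T₂ - u`, and a q-Saalschütz sum remains. -/
theorem sum_balTerm_of_eq {t : K} (h : Generic t) {T₁ T₂ T₃ T₄ S₁ S₂ S₃ : ℤ} (hS : S₂ = T₁)
    (hsum : S₁ + S₂ + S₃ = T₁ + T₂ + T₃ + T₄) (h21 : T₂ ≤ S₂) (h31 : T₃ ≤ S₂) (h41 : T₄ ≤ S₂)
    (h11 : T₁ ≤ S₁) (h13 : T₁ ≤ S₃) (h43 : T₄ ≤ S₃) {M : ℕ} (hM : S₁ - T₁ < M) :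
    ∑ u ∈ Finset.range M, balTerm t T₁ T₂ T₃ T₄ S₁ S₂ S₃ u =
      (-1) ^ (S₁ - T₁) * (qF t (S₁ - T₃) * qF t (S₁ - T₄) * qF t (S₃ - T₃) * qF t (S₃ - T₄)) *
        (iF t (T₂ + 1) * iF t (T₁ - T₃) * iF t (T₁ - T₄) * iF t (S₁ - T₁) * iF t (S₃ - T₁)) := by
  obtain ⟨B, hB⟩ := Int.eq_ofNat_of_zero_le (show 0 ≤ S₁ - T₁ by omega)
  obtain ⟨d, hd⟩ := Int.eq_ofNat_of_zero_le (show 0 ≤ T₁ - T₃ by omega)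
  have key := sum_saalTerm h B d (S₃ - S₁) (S₃ - T₄) (by omega) (by omega) (by omega)
  rw [show (B : ℤ) + d = S₁ - T₃ by omega, show S₃ - T₄ - (S₃ - S₁) = S₁ - T₄ by ring,
    show S₃ - S₁ + B + d = S₃ - T₃ by omega, show S₃ - T₄ + 1 + d + B = T₂ + 1 by omega, ← hd,
    show S₁ - T₄ - B = T₁ - T₄ by omega, ← hB, show S₃ - S₁ + (S₁ - T₁) = S₃ - T₁ by ring] at key
  rw [hB, zpow_natCast, ← hB, ← key, ← Finset.sum_subset (s₁ := Finset.range (B + 1)) (by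
    intro u; simp only [Finset.mem_range]; omega)]
  · refine Finset.sum_congr rfl fun u hu => ?_
    rw [Finset.mem_range] at hu
    have e1 := h.qF_mul_iF (n := S₁ - T₂ - u) (by omega)
    rw [balTerm, saalTerm, show S₁ + S₂ - T₁ - T₂ - u = S₁ - T₂ - u by omega,
      show S₃ - S₁ + (S₁ - T₁) + (T₁ - T₃) + u = S₃ - T₃ + u by ring,
      show S₃ - T₄ + 1 + (T₁ - T₃) + u = T₁ + T₂ - S₁ + 1 + u by omega]
    linear_combination ((-1) ^ u * (qF t (S₃ - T₄ + u) * qF t (S₃ - T₃ + u)) *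
      (iF t u * iF t (S₁ - T₁ - u) * iF t (S₃ - S₁ + u) * iF t (T₁ + T₂ - S₁ + 1 + u))) * e1
  · intro u _ hu
    rw [Finset.mem_range] at hu
    rw [balTerm, iF_of_neg t (n := S₁ - T₁ - u) (by omega)]
    ring

theorem balFactor_sub_one {t : K} (h : Generic t) (T₁ T₂ T₃ T₄ S₁ S₂ S₃ : ℤ) (hT : 0 ≤ T₂) :
    qi t (T₂ + 1) * balFactor t T₁ (T₂ - 1) (T₃ - 1) (T₄ - 1) (S₁ - 1) (S₂ - 1) (S₃ - 1) =
      -(qi t (S₂ - T₁) * balFactor t T₁ T₂ T₃ T₄ S₁ S₂ S₃) := by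
  have hq := qF_add_one t hT
  have hi := h.iF_pred (S₂ - T₁)
  have k : ∀ S T : ℤ, S - 1 - (T - 1) = S - T := fun S T => by ring
  simp only [balFactor, k, sub_add_cancel]
  rw [show S₂ - 1 - T₁ = S₂ - T₁ - 1 by ring, hi, hq, zpow_sub_one₀ (by simp)]
  rw [inv_neg_one]
  ring

theorem balFactor_sub_two {t : K} (h : Generic t) (T₁ T₂ T₃ T₄ S₁ S₂ S₃ : ℤ) (hT₁ : 0 ≤ T₁)
    (hT : 0 ≤ T₂) :
    qi t (T₁ + 1) * qi t (T₂ + 1) *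
      balFactor t (T₁ - 1) (T₂ - 1) (T₃ - 1) (T₄ - 1) (S₁ - 1) (S₂ - 2) (S₃ - 1) =
      -(qi t (S₂ - T₁) * qi t (S₂ - T₂) * balFactor t T₁ T₂ T₃ T₄ S₁ S₂ S₃) := by
  have hq := qF_add_one t hT
  have hq' := qF_add_one t hT₁
  have hi := h.iF_pred (S₂ - T₁)
  have hi' := h.iF_pred (S₂ - T₂)
  have k : ∀ S T : ℤ, S - 1 - (T - 1) = S - T := fun S T => by ring
  simp only [balFactor, k, sub_add_cancel]
  rw [show S₂ - 2 - (T₁ - 1) = S₂ - T₁ - 1 by ring, show S₂ - 2 - (T₂ - 1) = S₂ - T₂ - 1 by ring,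
    hi, hi', hq, hq', zpow_sub_one₀ (by simp), inv_neg_one]
  ring

/-- The boundary case of the transformation in which the shifted Racah sum is empty. One numerator
factorial cancels against the last denominator factorial, and what is left is a vanishing
q-difference. -/
theorem sum_balTerm_eq_zero {t : K} (h : Generic t) {T₁ T₂ T₃ T₄ S₁ S₂ S₃ : ℤ}
    (hsum : S₁ + S₂ + S₃ = T₁ + T₂ + T₃ + T₄) (hS : T₁ < S₂) (h22 : T₂ < S₂)
    (h3 : S₂ = T₃ ∨ S₂ = T₄) (h33 : T₃ ≤ S₃) (h43 : T₄ ≤ S₃) (h14 : T₄ ≤ S₁) (h13 : T₃ ≤ S₁)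
    {M : ℕ} (hM : S₁ - T₁ < M) :
    ∑ u ∈ Finset.range M,
      balTerm t (T₁ - 1) (T₂ - 1) (T₃ - 1) (T₄ - 1) (S₁ - 1) (S₂ - 2) (S₃ - 1) u = 0 := by
  rcases h3 with h3 | h3
  · rw [← sum_qF_ratio_eq_zero h (S₁ - T₂) (S₁ - T₁) (S₃ - S₁) (S₃ - T₃) (S₁ + S₂ - T₁ - T₂ - 1)
      (by omega) (by omega) (by omega) (by omega) (by omega) M hM]
    refine Finset.sum_congr rfl fun u _ => ?_
    have e1 := h.qF_mul_iF (n := S₃ - T₄ + u) (by omega)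
    have k : ∀ S T : ℤ, S - 1 - (T - 1) = S - T := fun S T => by ring
    simp only [balTerm, k]
    rw [show S₁ - 1 + (S₂ - 2) - (T₁ - 1) - (T₂ - 1) - (u : ℤ) = S₁ + S₂ - T₁ - T₂ - 1 - u by ring,
      show T₁ - 1 + (T₂ - 1) - (S₁ - 1) + 1 + (u : ℤ) = S₃ - T₄ + u by omega]
    linear_combination ((-1) ^ u * (qF t (S₁ + S₂ - T₁ - T₂ - 1 - u) * qF t (S₃ - T₃ + u)) *
      (iF t u * iF t (S₁ - T₁ - u) * iF t (S₃ - S₁ + u) * iF t (S₁ - T₂ - u))) * e1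
  · rw [← sum_qF_ratio_eq_zero h (S₁ - T₂) (S₁ - T₁) (S₃ - S₁) (S₃ - T₄) (S₁ + S₂ - T₁ - T₂ - 1)
      (by omega) (by omega) (by omega) (by omega) (by omega) M hM]
    refine Finset.sum_congr rfl fun u _ => ?_
    have e1 := h.qF_mul_iF (n := S₃ - T₃ + u) (by omega)
    have k : ∀ S T : ℤ, S - 1 - (T - 1) = S - T := fun S T => by ring
    simp only [balTerm, k]
    rw [show S₁ - 1 + (S₂ - 2) - (T₁ - 1) - (T₂ - 1) - (u : ℤ) = S₁ + S₂ - T₁ - T₂ - 1 - u by ring,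
      show T₁ - 1 + (T₂ - 1) - (S₁ - 1) + 1 + (u : ℤ) = S₃ - T₃ + u by omega]
    linear_combination ((-1) ^ u * (qF t (S₁ + S₂ - T₁ - T₂ - 1 - u) * qF t (S₃ - T₄ + u)) *
      (iF t u * iF t (S₁ - T₁ - u) * iF t (S₃ - S₁ + u) * iF t (S₁ - T₂ - u))) * e1

theorem racahTerm_eq_zero (t : K) {T₁ T₂ T₃ T₄ S₁ S₂ S₃ : ℤ}
    (hTS : S₁ < T₁ ∨ S₃ < T₁ ∨ S₂ < T₂ ∨ S₂ < T₃ ∨ S₂ < T₄) (z : ℕ) :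
    racahTerm t T₁ T₂ T₃ T₄ S₁ S₂ S₃ z = 0 := by
  unfold racahTerm
  rcases hTS with H | H | H | H | H
  · linear_combination ((-1) ^ z * qF t (z + 1) * (iF t (z - T₂) * iF t (z - T₃) * iF t (z - T₄)) *
      (iF t (S₂ - z) * iF t (S₃ - z))) * iF_mul_iF_eq_zero t (m := z - T₁) (n := S₁ - z) (by omega)
  · linear_combination ((-1) ^ z * qF t (z + 1) * (iF t (z - T₂) * iF t (z - T₃) * iF t (z - T₄)) *
      (iF t (S₂ - z) * iF t (S₁ - z))) * iF_mul_iF_eq_zero t (m := z - T₁) (n := S₃ - z) (by omega)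
  · linear_combination ((-1) ^ z * qF t (z + 1) * (iF t (z - T₁) * iF t (z - T₃) * iF t (z - T₄)) *
      (iF t (S₁ - z) * iF t (S₃ - z))) * iF_mul_iF_eq_zero t (m := z - T₂) (n := S₂ - z) (by omega)
  · linear_combination ((-1) ^ z * qF t (z + 1) * (iF t (z - T₁) * iF t (z - T₂) * iF t (z - T₄)) *
      (iF t (S₁ - z) * iF t (S₃ - z))) * iF_mul_iF_eq_zero t (m := z - T₃) (n := S₂ - z) (by omega)
  · linear_combination ((-1) ^ z * qF t (z + 1) * (iF t (z - T₁) * iF t (z - T₂) * iF t (z - T₃)) *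
      (iF t (S₁ - z) * iF t (S₃ - z))) * iF_mul_iF_eq_zero t (m := z - T₄) (n := S₂ - z) (by omega)

/-- The transformation between the Racah sum and the balanced sum. -/
theorem sum_racahTerm_eq {t : K} (h : Generic t) (n : ℕ) {T₁ T₂ T₃ T₄ S₁ S₂ S₃ : ℤ}
    (hn : S₂ - T₁ = n) (hsum : S₁ + S₂ + S₃ = T₁ + T₂ + T₃ + T₄)
    (h1 : T₁ ≤ S₁ ∧ T₂ ≤ S₁ ∧ T₃ ≤ S₁ ∧ T₄ ≤ S₁) (h2 : T₂ ≤ S₂ ∧ T₃ ≤ S₂ ∧ T₄ ≤ S₂)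
    (h3 : T₁ ≤ S₃ ∧ T₂ ≤ S₃ ∧ T₃ ≤ S₃ ∧ T₄ ≤ S₃) {N M : ℕ} (hN : S₂ < N) (hM : S₁ - T₁ < M) :
    ∑ z ∈ Finset.range N, racahTerm t T₁ T₂ T₃ T₄ S₁ S₂ S₃ z =
      balFactor t T₁ T₂ T₃ T₄ S₁ S₂ S₃ *
        ∑ u ∈ Finset.range M, balTerm t T₁ T₂ T₃ T₄ S₁ S₂ S₃ u := by
  obtain ⟨h11, h21, h31, h41⟩ := h1
  obtain ⟨h22, h32, h42⟩ := h2
  obtain ⟨h13, h23, h33, h43⟩ := h3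
  -- Induction on `S₂ - T₁`, with the one-term Racah sum and the q-Saalschütz sum as its start.
  induction n generalizing T₁ T₂ T₃ T₄ S₁ S₂ S₃ N with
  | zero =>
    have hS : S₂ = T₁ := by push_cast at hn; omega
    rw [sum_racahTerm_of_eq hS (by omega) hN, sum_balTerm_of_eq h hS hsum h22 h32 h42 h11 h13 h43 hM,
      balFactor, hS, sub_self, iF_zero]
    have e1 := h.qF_mul_iF (n := T₂ + 1) (by omega)
    have e2 := h.qF_mul_iF (n := S₁ - T₃) (by omega)
    have e3 := h.qF_mul_iF (n := S₁ - T₄) (by omega)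
    have e4 := h.qF_mul_iF (n := S₃ - T₃) (by omega)
    have e5 := h.qF_mul_iF (n := S₃ - T₄) (by omega)
    have e6 : (-1 : K) ^ S₁ * (-1) ^ (S₁ - T₁) = (-1) ^ T₁ := by
      rw [← zpow_add₀ (by simp), show S₁ + (S₁ - T₁) = 2 * (S₁ - T₁) + T₁ by ring,
        zpow_add₀ (by simp), zpow_mul]
      simp
    rw [← e6]
    calc _ = (-1) ^ S₁ * (-1) ^ (S₁ - T₁) * qF t (T₁ + 1) *
          (iF t (T₁ - T₂) * iF t (T₁ - T₃) * iF t (T₁ - T₄)) * (iF t (S₁ - T₁) * iF t (S₃ - T₁)) *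
          ((qF t (T₂ + 1) * iF t (T₂ + 1)) * (qF t (S₁ - T₃) * iF t (S₁ - T₃)) *
          (qF t (S₁ - T₄) * iF t (S₁ - T₄)) * (qF t (S₃ - T₃) * iF t (S₃ - T₃)) *
          (qF t (S₃ - T₄) * iF t (S₃ - T₄))) := by rw [e1, e2, e3, e4, e5]; ring
      _ = _ := by ring
  | succ n ih =>
    have hS : T₁ < S₂ := by push_cast at hn; omega
    push_cast at hn
    obtain ⟨N, rfl⟩ := Nat.exists_eq_add_of_le' (show 1 ≤ N by omega)
    push_cast at hN
    have hc : ∑ z ∈ Finset.range N,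
        racahTerm t T₁ (T₂ - 1) (T₃ - 1) (T₄ - 1) (S₁ - 1) (S₂ - 1) (S₃ - 1) z =
        balFactor t T₁ (T₂ - 1) (T₃ - 1) (T₄ - 1) (S₁ - 1) (S₂ - 1) (S₃ - 1) *
        ∑ u ∈ Finset.range M,
          balTerm t T₁ (T₂ - 1) (T₃ - 1) (T₄ - 1) (S₁ - 1) (S₂ - 1) (S₃ - 1) u := by
      -- The shift may break the inequalities, here `T₁ ≤ S₁` or `T₁ ≤ S₃`. Then all terms on both
      -- sides vanish.
      by_cases hb : T₁ < S₁ ∧ T₁ < S₃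
      · apply ih <;> omega
      · rw [Finset.sum_eq_zero fun z _ => racahTerm_eq_zero t (by omega) z,
          Finset.sum_eq_zero fun u _ => ?_, mul_zero]
        rw [balTerm]
        linear_combination ((-1) ^ u * (qF t (S₃ - 1 - (T₄ - 1) + u) *
          qF t (S₁ - 1 + (S₂ - 1) - T₁ - (T₂ - 1) - u) * qF t (S₃ - 1 - (T₃ - 1) + u)) * (iF t u *
          iF t (S₁ - 1 - (T₂ - 1) - u) * iF t (T₁ + (T₂ - 1) - (S₁ - 1) + 1 + u))) *
          (if hb' : S₁ ≤ T₁ then by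
            rw [iF_of_neg t (n := S₁ - 1 - T₁ - u) (by omega), zero_mul] else
            iF_mul_iF_eq_zero t (by omega) :
            iF t (S₁ - 1 - T₁ - u) * iF t (S₃ - 1 - (S₁ - 1) + u) = 0)
    have ha : ∑ z ∈ Finset.range N,
        racahTerm t (T₁ - 1) (T₂ - 1) (T₃ - 1) (T₄ - 1) (S₁ - 1) (S₂ - 2) (S₃ - 1) z =
        balFactor t (T₁ - 1) (T₂ - 1) (T₃ - 1) (T₄ - 1) (S₁ - 1) (S₂ - 2) (S₃ - 1) *
        ∑ u ∈ Finset.range M,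
          balTerm t (T₁ - 1) (T₂ - 1) (T₃ - 1) (T₄ - 1) (S₁ - 1) (S₂ - 2) (S₃ - 1) u := by
      -- With `S₂` lowered by two, some `T_i` may exceed it. The Racah terms are then zero; on the
      -- other side `balFactor` vanishes if it is `T₂`, and the balanced sum does if it is `T₃` or
      -- `T₄`.
      by_cases hb : T₂ < S₂ ∧ T₃ < S₂ ∧ T₄ < S₂
      · apply ih <;> omega
      · rw [Finset.sum_eq_zero fun z _ => racahTerm_eq_zero t (by omega) z]
        by_cases h2 : T₂ < S₂
        · rw [sum_balTerm_eq_zero h hsum hS h2 (by omega) h33 h43 h41 h31 hM, mul_zero]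
        · rw [balFactor, iF_of_neg t (n := S₂ - 2 - (T₂ - 1)) (by omega)]
          ring
    have hW : qi t (T₂ + 1) * ∑ u ∈ Finset.range M, balTerm t T₁ T₂ T₃ T₄ S₁ S₂ S₃ u =
        qi t (S₂ + 1) * ∑ u ∈ Finset.range M,
          balTerm t T₁ (T₂ - 1) (T₃ - 1) (T₄ - 1) (S₁ - 1) (S₂ - 1) (S₃ - 1) u +
        qi t (S₂ - T₂) * ∑ u ∈ Finset.range M,
          balTerm t (T₁ - 1) (T₂ - 1) (T₃ - 1) (T₄ - 1) (S₁ - 1) (S₂ - 2) (S₃ - 1) u := by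
      rw [Finset.mul_sum, Finset.mul_sum, Finset.mul_sum, ← Finset.sum_add_distrib]
      exact Finset.sum_congr rfl fun u _ => balTerm_contiguous h hS u
    have hR : qi t (S₂ - T₁) * ∑ z ∈ Finset.range (N + 1), racahTerm t T₁ T₂ T₃ T₄ S₁ S₂ S₃ z =
        -(qi t (S₂ + 1) * ∑ z ∈ Finset.range N,
          racahTerm t T₁ (T₂ - 1) (T₃ - 1) (T₄ - 1) (S₁ - 1) (S₂ - 1) (S₃ - 1) z) -
        qi t (T₁ + 1) * ∑ z ∈ Finset.range N,
          racahTerm t (T₁ - 1) (T₂ - 1) (T₃ - 1) (T₄ - 1) (S₁ - 1) (S₂ - 2) (S₃ - 1) z := by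
      rw [Finset.sum_range_succ']
      have : racahTerm t T₁ T₂ T₃ T₄ S₁ S₂ S₃ 0 = 0 := by
        rw [racahTerm, iF_of_neg t (n := ((0 : ℕ) : ℤ) - T₄) (by push_cast; omega)]
        ring
      rw [this, add_zero, Finset.mul_sum, Finset.mul_sum, Finset.mul_sum, ← Finset.sum_neg_distrib,
        ← Finset.sum_sub_distrib]
      exact Finset.sum_congr rfl fun z _ => racahTerm_succ h _ _ _ _ _ _ _ z
    have f1 := balFactor_sub_one h T₁ T₂ T₃ T₄ S₁ S₂ S₃ (by omega)
    have f2 := balFactor_sub_two h T₁ T₂ T₃ T₄ S₁ S₂ S₃ (by omega) (by omega)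
    apply mul_left_cancel₀ (mul_ne_zero (h.qi_ne_zero (n := T₂ + 1) (by omega))
      (h.qi_ne_zero (n := S₂ - T₁) (by omega)))
    rw [mul_assoc, hR, hc, ha]
    linear_combination (-(qi t (S₂ - T₁) * balFactor t T₁ T₂ T₃ T₄ S₁ S₂ S₃)) * hW -
      (qi t (S₂ + 1) * ∑ u ∈ Finset.range M,
          balTerm t T₁ (T₂ - 1) (T₃ - 1) (T₄ - 1) (S₁ - 1) (S₂ - 1) (S₃ - 1) u) * f1 -
      (∑ u ∈ Finset.range M,
          balTerm t (T₁ - 1) (T₂ - 1) (T₃ - 1) (T₄ - 1) (S₁ - 1) (S₂ - 2) (S₃ - 1) u) * f2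

end RacahSum

/-! ### The evaluation as a Racah sum -/

section Evaluation

variable {K : Type*} [Field K]

/-- The standard evaluation of the tetrahedron as a Racah sum. -/
theorem tetEval_eq {t : K} (h : Generic t)
    {a b c d e f ab ae be ac af cf cd ce de bd bf df : ℕ}
    (H : TetStrands a b c d e f ab ae be ac af cf cd ce de bd bf df)
    {T₁ T₂ T₃ T₄ S₁ S₂ S₃ : ℤ} (hT₁ : T₁ = ab + ae + be) (hT₂ : T₂ = ce + de + cd)
    (hT₃ : T₃ = ac + af + cf) (hT₄ : T₄ = bd + bf + df) (hS₁ : S₁ = T₁ + cd) (hS₂ : S₂ = T₁ + df)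
    (hS₃ : S₃ = T₁ + cf) {N : ℕ} (hN : S₂ < N) :
    tetEval t a b c d e f = ∑ z ∈ Finset.range N, racahTerm t T₁ T₂ T₃ T₄ S₁ S₂ S₃ z := by
  obtain ⟨h1, h2, h3, h4, h5, h6, h7, h8, h9, h10, h11, h12⟩ := id H
  rw [sum_racahTerm_eq h df (M := cd + 1) (by omega) (by omega) (by omega) (by omega) (by omega) hN
    (by omega), tetEval_eq_tetTerm h H, balFactor]
  have e1 : ∀ u : ℕ, tetTerm t ab af be cf ce e cd u = balTerm t T₁ T₂ T₃ T₄ S₁ S₂ S₃ u := by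
    intro u
    rw [tetTerm, balTerm, show S₃ - T₄ = ce by omega, show S₁ + S₂ - T₁ - T₂ = af + cd by omega,
      show S₃ - T₃ = be by omega, show S₁ - T₁ = cd by omega, show S₃ - S₁ = cf - cd by omega,
      show S₁ - T₂ = ab by omega, show T₁ + T₂ - S₁ + 1 = e + 1 by omega]
  have e2 : (-1 : K) ^ S₁ = (-1) ^ (e + af + df) := by
    rw [← zpow_natCast, show S₁ = ((e + af + df : ℕ) : ℤ) + 2 * (cd - df) by omega,
      zpow_add₀ (by simp), zpow_mul]
    simp
  simp only [e1]
  rw [e2, show T₁ + 1 = (ab + ae + be + 1 : ℕ) by omega, show T₂ + 1 = (ce + de + cd + 1 : ℕ) by omega,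
    show S₂ - T₁ = df by omega, show S₂ - T₂ = af by omega, show S₁ - T₃ = bd by omega,
    show S₁ - T₄ = ac by omega, show S₃ - T₃ = be by omega, show S₃ - T₄ = ce by omega]
  simp only [qF_natCast, iF_natCast]
  rw [div_eq_mul_inv]
  simp only [mul_inv]
  ring

end Evaluation

end QSpin


namespace QSpin

/-! ### Euler's series, truncated modulo a power of q -/

section Euler

open PowerSeries

theorem poch_zero : poch 0 = 1 := by simp [poch]

theorem poch_succ (n : ℕ) : poch (n + 1) = poch n * (1 - X ^ (n + 1)) := by
  simp [poch, Finset.prod_range_succ]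

theorem invPoch_mul_poch (n : ℕ) : invPoch n * poch n = 1 := by
  rw [mul_comm, poch_mul_invPoch]

theorem invPoch_zero : invPoch 0 = 1 := by
  have := poch_mul_invPoch 0
  rwa [poch_zero, one_mul] at this

theorem invPoch_eq (n : ℕ) : invPoch n = invPoch (n + 1) * (1 - X ^ (n + 1)) := by
  have h1 := invPoch_mul_poch n
  have h2 := poch_mul_invPoch (n + 1)
  rw [poch_succ] at h2
  linear_combination (-invPoch n) * h2 + (invPoch (n + 1) * (1 - X ^ (n + 1))) * h1

/-- Truncations of Euler's two series: `∑ q^{ai} / (q)_i` for `δ = 0` and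
`∑ (-1)^i q^{i(i-1)/2 + ai} / (q)_i` for `δ = 1`. -/
noncomputable def eulerSum (δ a N : ℕ) : PowerSeries ℤ :=
  ∑ i ∈ Finset.range N, (-1) ^ (δ * i) * X ^ (δ * (i * (i - 1) / 2) + a * i) * invPoch i

/-- The truncated form of (1 - q^a) / (q^a)_∞ = 1 / (q^{a+1})_∞. For `a ≥ 1` the error has order at
least `N + 1`. -/
theorem eulerSum_zero_mul (a N : ℕ) :
    (1 - X ^ a) * eulerSum 0 a (N + 1) =
      eulerSum 0 (a + 1) (N + 1) - X ^ (a * (N + 1)) * invPoch N := by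
  induction N with
  | zero => simp [eulerSum, invPoch_zero]
  | succ N ih =>
    have e : ∀ b, eulerSum 0 b (N + 1 + 1) =
        eulerSum 0 b (N + 1) + X ^ (b * (N + 1)) * invPoch (N + 1) := by
      intro b
      rw [eulerSum, Finset.sum_range_succ, ← eulerSum]
      simp
    rw [e, e, mul_add, ih, invPoch_eq N]
    ring

/-- The truncated form of (q^a)_∞ = (1 - q^a) (q^{a+1})_∞. The two sums on the right differ in
length by one because the second is shifted by one index. -/
theorem eulerSum_one (a N : ℕ) :
    eulerSum 1 a (N + 1) = eulerSum 1 (a + 1) (N + 1) - X ^ a * eulerSum 1 (a + 1) N := by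
  have tri : ∀ i : ℕ, (i + 1) * (i + 1 - 1) / 2 = i * (i - 1) / 2 + i :=
    Nat.triangle_succ
  simp only [eulerSum, one_mul]
  rw [Finset.sum_range_succ', Finset.sum_range_succ' (fun i => _ * _ * invPoch i),
    Finset.mul_sum, add_sub_right_comm, ← Finset.sum_sub_distrib]
  congr 1
  · refine Finset.sum_congr rfl fun i _ => ?_
    rw [invPoch_eq i, tri]
    ring

/-- Reduction modulo `q ^ N`. -/
noncomputable def modX (N : ℕ) :
    PowerSeries ℤ →+* PowerSeries ℤ ⧸ Ideal.span {(X : PowerSeries ℤ) ^ N} :=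
  Ideal.Quotient.mk _

theorem modX_eq_iff {N : ℕ} {f g : PowerSeries ℤ} :
    modX N f = modX N g ↔ ∀ j < N, coeff j f = coeff j g := by
  rw [modX, Ideal.Quotient.eq, Ideal.mem_span_singleton, X_pow_dvd_iff]
  simp [sub_eq_zero]

theorem modX_eq_zero {N : ℕ} {f : PowerSeries ℤ} (h : X ^ N ∣ f) : modX N f = 0 :=
  Ideal.Quotient.eq_zero_iff_mem.mpr (Ideal.mem_span_singleton.mpr h)

theorem modX_eulerSum_zero (N : ℕ) {a : ℕ} (ha : 1 ≤ a) :
    modX (N + 1) (eulerSum 0 (a + 1) (N + 1)) =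
      modX (N + 1) (1 - X ^ a) * modX (N + 1) (eulerSum 0 a (N + 1)) := by
  rw [← map_mul, eulerSum_zero_mul, map_sub, modX_eq_zero (f := X ^ (a * (N + 1)) * _), sub_zero]
  exact (pow_dvd_pow _ (Nat.le_mul_of_pos_left _ ha)).mul_right _

theorem modX_eulerSum_one (N : ℕ) {a : ℕ} (ha : 1 ≤ a) :
    modX (N + 1) (eulerSum 1 a (N + 1)) =
      modX (N + 1) (1 - X ^ a) * modX (N + 1) (eulerSum 1 (a + 1) (N + 1)) := by
  rw [← map_mul, eulerSum_one]
  have e : eulerSum 1 (a + 1) (N + 1) = eulerSum 1 (a + 1) N +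
      (-1) ^ N * X ^ (N * (N - 1) / 2 + (a + 1) * N) * invPoch N := by
    rw [eulerSum, Finset.sum_range_succ, ← eulerSum, one_mul, one_mul]
  have e2 : eulerSum 1 (a + 1) (N + 1) - X ^ a * eulerSum 1 (a + 1) N =
      (1 - X ^ a) * eulerSum 1 (a + 1) (N + 1) +
        X ^ (a + (N * (N - 1) / 2 + (a + 1) * N)) * ((-1) ^ N * invPoch N) := by
    rw [pow_add]
    linear_combination X ^ a * e
  rw [e2, map_add, modX_eq_zero (f := X ^ (a + (N * (N - 1) / 2 + (a + 1) * N)) * _), add_zero]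
  refine (pow_dvd_pow _ ?_).mul_right _
  nlinarith [Nat.zero_le (N * (N - 1) / 2)]

theorem modX_eulerSum_zero_succ (N m : ℕ) :
    modX (N + 1) (eulerSum 0 (m + 1) (N + 1)) =
      modX (N + 1) (poch m) * modX (N + 1) (eulerSum 0 1 (N + 1)) := by
  induction m with
  | zero => simp [poch_zero]
  | succ m ih =>
    rw [modX_eulerSum_zero N (by omega), ih, poch_succ, map_mul]
    ring

theorem modX_eulerSum_one_succ (N m : ℕ) :
    modX (N + 1) (eulerSum 1 1 (N + 1)) =
      modX (N + 1) (poch m) * modX (N + 1) (eulerSum 1 (m + 1) (N + 1)) := by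
  induction m with
  | zero => simp [poch_zero]
  | succ m ih =>
    rw [ih, modX_eulerSum_one N (by omega), poch_succ, map_mul]
    ring

/-- Shift the parameter of both series from 1 to `N + 2`, at the price of the same factor `poch (N +
1)`. At `N + 2` every term except the zeroth vanishes modulo q^{N+1}. -/
theorem modX_eulerSum_mul (N : ℕ) :
    modX (N + 1) (eulerSum 1 1 (N + 1)) * modX (N + 1) (eulerSum 0 1 (N + 1)) = 1 := by
  have h1 := modX_eulerSum_one_succ N (N + 1)
  have h0 := modX_eulerSum_zero_succ N (N + 1)
  have e : ∀ δ, modX (N + 1) (eulerSum δ (N + 1 + 1) (N + 1)) = 1 := by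
    intro δ
    rw [eulerSum, Finset.sum_range_succ', map_add, map_sum, Finset.sum_eq_zero]
    · simp [invPoch_zero]
    · intro i _
      refine modX_eq_zero ?_
      rw [mul_comm ((-1) ^ _), mul_assoc]
      refine (pow_dvd_pow _ ?_).mul_right _
      nlinarith [Nat.zero_le (δ * ((i + 1) * (i + 1 - 1) / 2))]
  rw [h1, e, mul_one, ← h0, e]

/-- `(q)_m = (q)_∞ / (q^{m+1})_∞`. -/
theorem modX_poch (N m : ℕ) :
    modX (N + 1) (poch m) = modX (N + 1) (eulerSum 1 1 (N + 1)) *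
      modX (N + 1) (eulerSum 0 (m + 1) (N + 1)) := by
  rw [modX_eulerSum_zero_succ]
  linear_combination (-modX (N + 1) (poch m)) * modX_eulerSum_mul N

/-- `1 / (q)_m = (q^{m+1})_∞ / (q)_∞`. -/
theorem modX_invPoch (N m : ℕ) :
    modX (N + 1) (invPoch m) = modX (N + 1) (eulerSum 0 1 (N + 1)) *
      modX (N + 1) (eulerSum 1 (m + 1) (N + 1)) := by
  have h1 := modX_eulerSum_one_succ N m
  have h2 := congrArg (modX (N + 1)) (invPoch_mul_poch m)
  rw [map_mul, map_one] at h2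
  linear_combination (-modX (N + 1) (invPoch m)) * modX_eulerSum_mul N +
    (modX (N + 1) (invPoch m) * modX (N + 1) (eulerSum 0 1 (N + 1))) * h1 +
    (modX (N + 1) (eulerSum 0 1 (N + 1)) * modX (N + 1) (eulerSum 1 (m + 1) (N + 1))) * h2

/-- `(q)_m / (1 - q) = (q^2)_∞ / (q^{m+1})_∞`. -/
theorem modX_poch_mul_invPoch_one (N m : ℕ) :
    modX (N + 1) (poch m * invPoch 1) = modX (N + 1) (eulerSum 1 2 (N + 1)) *
      modX (N + 1) (eulerSum 0 (m + 1) (N + 1)) := by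
  have h1 := modX_eulerSum_one_succ N 1
  have h2 := congrArg (modX (N + 1)) (invPoch_mul_poch 1)
  rw [map_mul, map_one] at h2
  rw [map_mul, modX_poch, h1]
  linear_combination (modX (N + 1) (eulerSum 1 2 (N + 1)) *
      modX (N + 1) (eulerSum 0 (m + 1) (N + 1))) * h2

end Euler

end QSpin


/-! ### Multiple sums graded by weight, and their Nahm data -/

namespace QSpin

/-- Numerical data for a family of products of Euler series: a summation variable `k` with a
quadratic exponent, coupled linearly (through `v`) to `r` summation variables coming from the
expansion of infinite products. -/
structure LayerData (r : ℕ) where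
  κ : ℕ
  δ : Fin r → ℕ
  a : Fin r → ℕ
  v : Fin r → ℤ
  w : Fin r → ℕ
  -- If `flat` holds, the quadratic variable is confined to 0, and negative couplings are harmless
  -- whatever their weight.
  flat : Bool
  one_le_a : ∀ i, 1 ≤ a i
  neg_one_le_v : ∀ i, -1 ≤ v i
  one_le_w : flat = false → ∀ i, v i < 0 → 1 ≤ w i

namespace LayerData

variable {r : ℕ} (P : LayerData r)

/-- The weights of the summation variables. -/
def weight : Fin (r + 1) → ℕ := Fin.cons P.κ P.w

/-- The total weight of a point. -/
def wt (p : Fin (r + 1) → ℕ) : ℕ := ∑ i, P.weight i * p i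

/-- The exponent of the summand at the point `p` in the `n`-th layer. -/
def expo (n : ℤ) (p : Fin (r + 1) → ℕ) : ℤ :=
  (p 0 * (3 * p 0 + 1) / 2 : ℕ) + n * P.κ * p 0 +
    ∑ i : Fin r, (P.δ i * (p i.succ * (p i.succ - 1) / 2 : ℕ) +
      (P.a i + P.v i * p 0 + n * P.w i) * p i.succ)

/-- The admissible points. -/
def points : Set (Fin (r + 1) → ℕ) := {p | P.flat = true → p 0 = 0}

theorem two_mul_pentagonal (k : ℕ) : 2 * (k * (3 * k + 1) / 2) = k * (3 * k + 1) := by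
  refine Nat.mul_div_cancel' ?_
  rcases Nat.even_or_odd' k with ⟨m, rfl | rfl⟩
  · exact ⟨m * (3 * (2 * m) + 1), by ring⟩
  · exact ⟨(2 * m + 1) * (3 * m + 2), by ring⟩

theorem two_mul_triangle (x : ℕ) : 2 * ((x * (x - 1) / 2 : ℕ) : ℤ) = x * (x - 1) := by
  have h := Nat.mul_div_cancel' (even_iff_two_dvd.mp (Nat.even_mul_pred_self x))
  rcases x with _ | x
  · simp
  · have : (2 * ((x + 1) * (x + 1 - 1) / 2 : ℕ) : ℤ) = ((x + 1) * (x + 1 - 1) : ℕ) := by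
      exact_mod_cast h
    rw [this]
    push_cast [Nat.add_sub_cancel]
    ring

theorem wt_eq (p : Fin (r + 1) → ℕ) : P.wt p = P.κ * p 0 + ∑ i : Fin r, P.w i * p i.succ := by
  simp [wt, weight, Fin.sum_univ_succ]

/-- The parameter n enters the exponent only through n times the weight. Hence the points of weight
d change with n by a common power of q, and each weight gives one coefficient of the associated
series. -/
theorem expo_add (m n : ℤ) (p : Fin (r + 1) → ℕ) : P.expo (m + n) p = P.expo m p + n * P.wt p := by
  have h : ∑ i : Fin r, ((P.δ i * (p i.succ * (p i.succ - 1) / 2 : ℕ) : ℤ) +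
      (P.a i + P.v i * p 0 + (m + n) * P.w i) * p i.succ) =
      ∑ i : Fin r, ((P.δ i * (p i.succ * (p i.succ - 1) / 2 : ℕ) : ℤ) +
      (P.a i + P.v i * p 0 + m * P.w i) * p i.succ) + n * ∑ i : Fin r, (P.w i * p i.succ : ℤ) := by
    rw [Finset.mul_sum, ← Finset.sum_add_distrib]
    refine Finset.sum_congr rfl fun i _ => ?_
    ring
  have hw : (P.wt p : ℤ) = P.κ * p 0 + ∑ i : Fin r, (P.w i * p i.succ : ℤ) := by
    simp [wt_eq]
  rw [expo, expo, h, hw]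
  ring

/-- The symmetric matrix of the quadratic form. -/
def matrix : Matrix (Fin (r + 1)) (Fin (r + 1)) ℤ :=
  Matrix.of fun i j => (if i = j then (Fin.cons 3 (fun i => (P.δ i : ℤ)) : Fin (r + 1) → ℤ) i else 0) +
    (if i = 0 then (Fin.cons 0 P.v : Fin (r + 1) → ℤ) j else 0) +
    (if j = 0 then (Fin.cons 0 P.v : Fin (r + 1) → ℤ) i else 0)

/-- The linear form. -/
def linear : Fin (r + 1) → ℤ :=
  Fin.cons (1 - 2 * P.κ) fun i => 2 * P.a i - P.δ i - 2 * P.w i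

/-- The reference layer is n = -1 because stability is measured in powers of q^{n+1}. The doubled
exponent has integral coefficients, which yields the evenness required in `NahmData`. -/
theorem quadratic_eq (p : Fin (r + 1) → ℕ) :
    (∑ i, ∑ j, (p i : ℤ) * P.matrix i j * p j) + ∑ i, P.linear i * (p i : ℤ) =
      2 * P.expo (-1) p := by
  have h1 : ∀ i, ∑ j, (p i : ℤ) * P.matrix i j * p j =
      (Fin.cons 3 (fun i => (P.δ i : ℤ)) : Fin (r + 1) → ℤ) i * p i ^ 2 +
      (if i = 0 then p 0 * ∑ j : Fin r, P.v j * p j.succ else 0) +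
      (Fin.cons 0 P.v : Fin (r + 1) → ℤ) i * p i * p 0 := by
    intro i
    simp only [matrix, Matrix.of_apply, mul_add, add_mul, Finset.sum_add_distrib]
    congr 1
    · congr 1
      · simp
        ring
      · split_ifs with hi
        · rw [Fin.sum_univ_succ, Finset.mul_sum]
          simp [hi, mul_assoc]
        · simp
    · simp only [mul_ite, mul_zero, ite_mul, zero_mul, Finset.sum_ite_eq', Finset.mem_univ, if_true]
      ring
  simp only [h1, Finset.sum_add_distrib, linear]
  rw [Finset.sum_ite_eq' Finset.univ (0 : Fin (r + 1)), if_pos (Finset.mem_univ _)]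
  have h2 : (2 : ℤ) * ((p 0 * (3 * p 0 + 1) / 2 : ℕ) : ℤ) = p 0 * (3 * p 0 + 1) := by
    exact_mod_cast two_mul_pentagonal (p 0)
  have h3 : ∀ i : Fin r, 2 * (P.δ i * ((p i.succ * (p i.succ - 1) / 2 : ℕ) : ℤ) +
      (P.a i + P.v i * p 0 + -1 * P.w i) * p i.succ) =
      P.δ i * p i.succ ^ 2 + p 0 * (P.v i * p i.succ) + P.v i * p i.succ * p 0 +
        (2 * P.a i - P.δ i - 2 * P.w i) * p i.succ := by
    intro i
    linear_combination (P.δ i : ℤ) * two_mul_triangle (p i.succ)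
  simp only [Fin.sum_univ_succ, Fin.cons_zero, Fin.cons_succ, expo]
  rw [mul_add (2 : ℤ), mul_add (2 : ℤ), h2, Finset.mul_sum (s := Finset.univ) (a := (2 : ℤ)),
    Finset.sum_congr rfl fun i _ => h3 i, Finset.sum_add_distrib, Finset.sum_add_distrib,
    Finset.sum_add_distrib, Finset.mul_sum]
  ring

/-- The generalized Nahm sum attached to the data, over a cone. -/
def nahmData {s : ℕ} (ineq : Matrix (Fin s) (Fin (r + 1)) ℤ) : NahmData (r + 1) where
  a := Fin.cons 1 fun i => P.δ i
  A := P.matrix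
  symm := by
    ext i j
    simp only [matrix, Matrix.transpose_apply, Matrix.of_apply]
    rcases eq_or_ne i j with h | h
    · subst h; ring
    · rw [if_neg h, if_neg h.symm]; ring
  b := P.linear
  s := s
  ineq := ineq
  even_exponent n _ := by rw [quadratic_eq]; exact even_two_mul _

theorem exponent_nahmData {s : ℕ} (ineq : Matrix (Fin s) (Fin (r + 1)) ℤ) (p : Fin (r + 1) → ℕ) :
    (P.nahmData ineq).exponent p = P.expo (-1) p := by
  rw [NahmData.exponent]
  have := P.quadratic_eq p
  simp only [nahmData]
  omega

/-- The summand at the point `p` in the `n`-th layer. -/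
noncomputable def term (n : ℤ) (p : Fin (r + 1) → ℕ) : LaurentSeries ℤ :=
  ((-1) ^ (p 0 + ∑ i : Fin r, P.δ i * p i.succ) : ℤ) •
    (qPow (P.expo n p) * HahnSeries.ofPowerSeries ℤ ℤ (∏ i, invPoch (p i)))

theorem term_nahmData {s : ℕ} (ineq : Matrix (Fin s) (Fin (r + 1)) ℤ) (p : Fin (r + 1) → ℕ) :
    (P.nahmData ineq).term p = P.term (-1) p := by
  rw [NahmData.term, exponent_nahmData, term]
  congr 1
  have : ∑ i, (P.nahmData ineq).a i * (p i : ℤ) =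
      ((p 0 + ∑ i : Fin r, P.δ i * p i.succ : ℕ) : ℤ) := by
    simp [nahmData, Fin.sum_univ_succ]
  rw [this, zpow_natCast]
  simp

theorem coeff_qPow_mul (m j : ℤ) (f : LaurentSeries ℤ) : (qPow m * f).coeff j = f.coeff (j - m) := by
  have := HahnSeries.coeff_single_mul_add (r := (1 : ℤ)) (x := f) (a := j - m) (b := m)
  rwa [sub_add_cancel, one_mul] at this

theorem coeff_ofPowerSeries (f : PowerSeries ℤ) (j : ℤ) :
    (HahnSeries.ofPowerSeries ℤ ℤ f).coeff j =
      if j < 0 then 0 else PowerSeries.coeff j.natAbs f :=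
  PowerSeries.coeff_coe _ _

theorem coeff_term (n j : ℤ) (p : Fin (r + 1) → ℕ) :
    (P.term n p).coeff j = (-1) ^ (p 0 + ∑ i : Fin r, P.δ i * p i.succ) *
      (HahnSeries.ofPowerSeries ℤ ℤ (∏ i, invPoch (p i))).coeff (j - P.expo n p) := by
  rw [term, HahnSeries.coeff_smul, coeff_qPow_mul, smul_eq_mul]

theorem coeff_term_of_lt {n j : ℤ} {p : Fin (r + 1) → ℕ} (h : j < P.expo n p) :
    (P.term n p).coeff j = 0 := by
  rw [coeff_term, coeff_ofPowerSeries, if_pos (by omega), mul_zero]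

theorem coeff_term_shift (n j : ℤ) (p : Fin (r + 1) → ℕ) :
    (P.term n p).coeff j = (P.term (-1) p).coeff (j - (n + 1) * P.wt p) := by
  rw [coeff_term, coeff_term]
  have := P.expo_add (-1) (n + 1) p
  rw [show -1 + (n + 1) = n by ring] at this
  rw [this]
  congr 2
  ring

end LayerData

end QSpin


/-! ### Regularity of the layers -/

namespace QSpin

namespace LayerData

variable {r : ℕ} (P : LayerData r)

/-- The sum of the variables coupled negatively to the quadratic variable. -/
def negPart (p : Fin (r + 1) → ℕ) : ℕ := ∑ i : Fin r, if P.v i < 0 then p i.succ else 0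

variable {P}

theorem negPart_le_wt (h : P.flat = false) (p : Fin (r + 1) → ℕ) : P.negPart p ≤ P.wt p := by
  rw [wt_eq, negPart]
  refine le_add_left (Finset.sum_le_sum fun i _ => ?_)
  split_ifs with hv
  · exact Nat.le_mul_of_pos_left _ (P.one_le_w h i hv)
  · exact Nat.zero_le _

theorem le_expo_zero (p : Fin (r + 1) → ℕ) :
    ((p 0 * (3 * p 0 + 1) / 2 : ℕ) : ℤ) + ∑ i : Fin r, (p i.succ : ℤ) ≤
      P.expo 0 p + p 0 * P.negPart p := by
  rw [expo, negPart, zero_mul, zero_mul, add_zero, add_assoc]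
  push_cast [Finset.mul_sum]
  rw [← Finset.sum_add_distrib]
  refine add_le_add le_rfl (Finset.sum_le_sum fun i _ => ?_)
  have ha : (1 : ℤ) ≤ P.a i := by exact_mod_cast P.one_le_a i
  have hv := P.neg_one_le_v i
  have hδ : (0 : ℤ) ≤ P.δ i * ((p i.succ * (p i.succ - 1) / 2 : ℕ) : ℤ) := by positivity
  have hx : (0 : ℤ) ≤ p i.succ := by positivity
  have hk : (0 : ℤ) ≤ p 0 := by positivity
  push_cast at hδ
  have h1 : (p i.succ : ℤ) ≤ P.a i * p i.succ := by nlinarith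
  split_ifs with h
  · have : P.v i = -1 := by omega
    rw [this]
    nlinarith
  · have : 0 ≤ P.v i * (p 0 * p i.succ) := mul_nonneg (by omega) (by positivity)
    nlinarith

theorem expo_eq_zero_add (n : ℤ) (p : Fin (r + 1) → ℕ) :
    P.expo n p = P.expo 0 p + n * P.wt p := by
  simpa using P.expo_add 0 n p

theorem le_two_mul_pentagonal (k : ℕ) :
    3 * (k : ℤ) ^ 2 + k = 2 * ((k * (3 * k + 1) / 2 : ℕ) : ℤ) := by
  have : (2 : ℤ) * ((k * (3 * k + 1) / 2 : ℕ) : ℤ) = k * (3 * k + 1) := by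
    exact_mod_cast two_mul_pentagonal k
  rw [this]
  ring

/-- The only negative contribution is at least `-p 0 * P.wt p`, since variables with negative
coupling have weight at least one. The term 3k²/2 dominates it up to a constant depending on the
weight, so in each layer the exponent bounds all coordinates. -/
theorem sum_le_expo_zero {p : Fin (r + 1) → ℕ} (hp : p ∈ P.points) :
    ((∑ i, p i : ℕ) : ℤ) ≤ P.expo 0 p + (P.wt p + 1) ^ 2 := by
  have h1 := P.le_expo_zero p
  have h2 := le_two_mul_pentagonal (p 0)
  rw [Fin.sum_univ_succ]
  push_cast at h1 h2 ⊢
  generalize ((p 0 : ℤ) * (3 * p 0 + 1) / 2) = e at *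
  have hw : (0 : ℤ) ≤ P.wt p := by positivity
  have hk : (0 : ℤ) ≤ p 0 := by positivity
  cases hf : P.flat
  · have h3 : (P.negPart p : ℤ) ≤ P.wt p := by exact_mod_cast P.negPart_le_wt hf p
    have h4 : (p 0 : ℤ) * P.negPart p ≤ p 0 * P.wt p := mul_le_mul_of_nonneg_left h3 hk
    nlinarith [sq_nonneg ((p 0 : ℤ) - (P.wt p + 1))]
  · have h0 := hp hf
    rw [h0] at h1 h2 ⊢
    push_cast at *
    nlinarith

theorem finite_setOf_sum_le (M : ℕ) : {p : Fin (r + 1) → ℕ | ∑ i, p i ≤ M}.Finite := by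
  refine (Set.finite_Iic (fun _ : Fin (r + 1) => M)).subset fun p hp i => ?_
  exact (Finset.single_le_sum (f := p) (fun _ _ => Nat.zero_le _) (Finset.mem_univ i)).trans hp

variable (P) in
/-- The points of weight `d`. -/
def layer (d : ℕ) : Set (Fin (r + 1) → ℕ) := {p | p ∈ P.points ∧ P.wt p = d}

theorem sum_le_of_mem_layer {d : ℕ} {p : Fin (r + 1) → ℕ} (hp : p ∈ P.layer d) :
    ((∑ i, p i : ℕ) : ℤ) ≤ P.expo (-1) p + d + (d + 1) ^ 2 := by
  have h1 := sum_le_expo_zero hp.1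
  have h2 := P.expo_eq_zero_add (-1) p
  rw [hp.2] at h1 h2
  linarith

theorem finite_layer_le (d : ℕ) (j : ℤ) : {p ∈ P.layer d | P.expo (-1) p ≤ j}.Finite := by
  refine (finite_setOf_sum_le (j + d + (d + 1) ^ 2).toNat).subset fun p hp => ?_
  have h := sum_le_of_mem_layer hp.1
  have := hp.2
  simp only [Set.mem_ofPred_eq]
  omega

theorem regularOn_layer {s : ℕ} (ineq : Matrix (Fin s) (Fin (r + 1)) ℤ) (d : ℕ) :
    (P.nahmData ineq).RegularOn (P.layer d) := by
  refine ⟨⟨-(d + (d + 1) ^ 2), fun p hp => ?_⟩, fun N => ?_⟩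
  · rw [exponent_nahmData]
    have := sum_le_of_mem_layer hp
    have h0 : (0 : ℤ) ≤ (∑ i, p i : ℕ) := by positivity
    linarith
  · refine (P.finite_layer_le d N).subset fun p hp => ⟨hp.1, ?_⟩
    rw [← P.exponent_nahmData ineq, hp.2]

theorem support_layerCoeff (d : ℕ) :
    BddBelow (Function.support fun j : ℤ => ∑ᶠ p ∈ P.layer d, (P.term (-1) p).coeff j) := by
  refine ⟨-(d + (d + 1) ^ 2), fun j hj => ?_⟩
  by_contra hlt
  refine hj (finsum_mem_of_eqOn_zero fun p hp => P.coeff_term_of_lt ?_)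
  have := sum_le_of_mem_layer hp
  have h0 : (0 : ℤ) ≤ (∑ i, p i : ℕ) := by positivity
  linarith

variable (P) in
/-- The sum over the points of weight `d`. -/
noncomputable def layerSum (d : ℕ) : LaurentSeries ℤ :=
  HahnSeries.ofSuppBddBelow (fun j => ∑ᶠ p ∈ P.layer d, (P.term (-1) p).coeff j)
    (P.support_layerCoeff d)

theorem coeff_layerSum (d : ℕ) (j : ℤ) :
    (P.layerSum d).coeff j = ∑ᶠ p ∈ P.layer d, (P.term (-1) p).coeff j := rfl

theorem hasSumOn_layer {s : ℕ} (ineq : Matrix (Fin s) (Fin (r + 1)) ℤ) (d : ℕ) :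
    (P.nahmData ineq).HasSumOn (P.layer d) (P.layerSum d) := by
  refine ⟨P.regularOn_layer ineq d, fun j => ?_⟩
  rw [coeff_layerSum]
  simp only [term_nahmData]

theorem coeff_layerSum_eq_sum {d : ℕ} {j : ℤ} {B : Finset (Fin (r + 1) → ℕ)}
    (hB : ↑B ⊆ P.points) (h : ∀ p ∈ P.layer d, p ∉ B → j < P.expo (-1) p) :
    (P.layerSum d).coeff j = ∑ p ∈ B with P.wt p = d, (P.term (-1) p).coeff j := by
  rw [coeff_layerSum]
  refine finsum_mem_eq_sum_of_inter_support_eq _ ?_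
  ext p
  simp only [Set.mem_inter_iff, Finset.coe_filter, Set.mem_ofPred_eq, Function.mem_support]
  refine and_congr_left fun hp => ⟨fun hl => ⟨?_, hl.2⟩, fun hb => ⟨hB hb.1, hb.2⟩⟩
  by_contra hb
  exact hp (P.coeff_term_of_lt (h p hl hb))

variable (P) in
/-- The inequalities cutting out the admissible points. -/
def pointIneq : Fin (r + 1) → ℤ := Fin.cons (if P.flat = true then -1 else 0) 0

theorem pointIneq_iff (p : Fin (r + 1) → ℕ) :
    0 ≤ ∑ j, P.pointIneq j * (p j : ℤ) ↔ p ∈ P.points := by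
  simp only [pointIneq, Fin.sum_univ_succ, Fin.cons_zero, Fin.cons_succ, points, Set.mem_ofPred_eq]
  split_ifs with h <;> simp [h]

/-- Weights are nonnegative, so the extra inequality `-wt ≥ 0` cuts out exactly the face of weight
zero. -/
theorem isNahmSum_layerSum_zero : IsNahmSum (P.layerSum 0) := by
  refine ⟨r + 1, P.nahmData (s := 2) ![P.pointIneq, fun j => -(P.weight j : ℤ)], ?_⟩
  suffices h : (P.nahmData (s := 2) ![P.pointIneq, fun j => -(P.weight j : ℤ)]).cone =
      P.layer 0 by
    rw [h]
    exact P.hasSumOn_layer _ 0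
  ext p
  simp only [NahmData.cone, nahmData, Fin.forall_fin_two, layer, Set.mem_ofPred_eq]
  refine and_congr ?_ ?_
  · simpa using P.pointIneq_iff p
  · have : ∑ j, -(P.weight j : ℤ) * (p j : ℤ) = -(P.wt p : ℤ) := by
      simp [wt]
    change (0 : ℤ) ≤ ∑ j, -(P.weight j : ℤ) * (p j : ℤ) ↔ _
    rw [this]
    omega

theorem isNahmSeries_layerSum : IsNahmSeries (PowerSeries.mk P.layerSum) := by
  refine ⟨r + 1, P.nahmData (s := 1) ![P.pointIneq], P.weight, fun k => ?_⟩
  rw [PowerSeries.coeff_mk]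
  suffices h : {p ∈ (P.nahmData (s := 1) ![P.pointIneq]).cone | ∑ i, P.weight i * p i = k} =
      P.layer k by
    rw [h]
    exact P.hasSumOn_layer _ k
  ext p
  simp only [NahmData.cone, nahmData, layer, Set.mem_ofPred_eq, wt]
  refine and_congr ?_ Iff.rfl
  simpa using P.pointIneq_iff p

end LayerData

end QSpin


/-! ### Stability of sequences represented by weighted sums -/

namespace QSpin

namespace LayerData

variable {r : ℕ} (P : LayerData r)

/-- The range of the quadratic variable in the `n`-th member of the family. -/
def range (n : ℕ) : ℕ := if P.flat = true then 1 else n / 2 + 1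

/-- The range of summation in a truncation of the `n`-th member of the family. -/
def box (n N : ℕ) : Finset (Fin (r + 1) → ℕ) :=
  Fintype.piFinset (Fin.cons (Finset.range (P.range n)) fun _ => Finset.range N)

/-- The truncated summand at the value `k` of the quadratic variable. -/
noncomputable def slice (n N k : ℕ) : PowerSeries ℤ :=
  (-1) ^ k * PowerSeries.X ^ (k * (3 * k + 1) / 2 + n * P.κ * k) * invPoch k *
    ∏ i, eulerSum (P.δ i) (P.a i + P.v i * k + n * P.w i).toNat N

variable {P}

theorem mem_box {n N : ℕ} {p : Fin (r + 1) → ℕ} :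
    p ∈ P.box n N ↔ p 0 < P.range n ∧ ∀ i : Fin r, p i.succ < N := by
  simp [box, Fin.forall_fin_succ]

theorem box_subset (n N : ℕ) : (P.box n N : Set (Fin (r + 1) → ℕ)) ⊆ P.points := by
  intro p hp h
  have := (mem_box.mp hp).1
  rw [range, if_pos h] at this
  omega

/-- This makes the truncation `toNat` in `slice` harmless: in the range either `k = 0`, or `k ≤ n`
and a coupling -k is compensated by a weight at least one. -/
theorem factor_exponent_nonneg {n k : ℕ} (hk : k < P.range n) (i : Fin r) :
    0 ≤ (P.a i + P.v i * k + n * P.w i : ℤ) := by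
  have ha : (1 : ℤ) ≤ P.a i := by exact_mod_cast P.one_le_a i
  have hv := P.neg_one_le_v i
  have hn : (0 : ℤ) ≤ n * P.w i := by positivity
  rw [range] at hk
  cases hf : P.flat <;> simp only [hf] at hk
  · rcases lt_or_ge (P.v i) 0 with h | h
    · have hw : (1 : ℤ) ≤ P.w i := by exact_mod_cast P.one_le_w hf i h
      have hv1 : P.v i = -1 := by omega
      have hkn : (k : ℤ) ≤ n := by
        simp at hk
        omega
      rw [hv1]
      nlinarith
    · have : (0 : ℤ) ≤ P.v i * k := by positivity
      linarith
  · have : k = 0 := by simpa using hk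
    subst this
    simp
    linarith

theorem expo_eq_natCast {n : ℕ} {p : Fin (r + 1) → ℕ} (hp : p 0 < P.range n) :
    P.expo n p = ((p 0 * (3 * p 0 + 1) / 2 + n * P.κ * p 0 +
      ∑ i : Fin r, (P.δ i * (p i.succ * (p i.succ - 1) / 2) +
        (P.a i + P.v i * p 0 + n * P.w i).toNat * p i.succ) : ℕ) : ℤ) := by
  have h : ∀ i : Fin r, (P.δ i * ((p i.succ * (p i.succ - 1) / 2 : ℕ) : ℤ) +
      (P.a i + P.v i * p 0 + n * P.w i) * p i.succ) =
      ((P.δ i * (p i.succ * (p i.succ - 1) / 2) +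
        (P.a i + P.v i * p 0 + n * P.w i).toNat * p i.succ : ℕ) : ℤ) := by
    intro i
    rw [Nat.cast_add, Nat.cast_mul, Nat.cast_mul, Int.toNat_of_nonneg (factor_exponent_nonneg hp i)]
  rw [expo, Finset.sum_congr rfl fun i _ => h i, Nat.cast_add, Nat.cast_add, Nat.cast_sum,
    Nat.cast_mul, Nat.cast_mul]

theorem term_eq_ofPowerSeries {n e : ℕ} {p : Fin (r + 1) → ℕ} (he : P.expo n p = e) :
    P.term n p = HahnSeries.ofPowerSeries ℤ ℤ ((-1) ^ (p 0 + ∑ i : Fin r, P.δ i * p i.succ) *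
      PowerSeries.X ^ e * ∏ i, invPoch (p i)) := by
  rw [term, he, map_mul, map_mul, map_pow, map_neg, map_one, HahnSeries.ofPowerSeries_X_pow, qPow,
    zsmul_eq_mul]
  push_cast
  ring

theorem slice_eq (n N k : ℕ) (hk : k < P.range n) :
    HahnSeries.ofPowerSeries ℤ ℤ (P.slice n N k) =
      ∑ x ∈ Fintype.piFinset fun _ : Fin r => Finset.range N, P.term n (Fin.cons k x) := by
  simp only [slice, eulerSum]
  rw [Finset.prod_univ_sum, Finset.mul_sum, map_sum]
  refine Finset.sum_congr rfl fun x _ => ?_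
  rw [term_eq_ofPowerSeries (expo_eq_natCast (p := Fin.cons k x) (by simpa using hk))]
  congr 1
  simp only [Fin.cons_zero, Fin.cons_succ, Finset.prod_mul_distrib, Fin.prod_univ_succ, pow_add,
    Finset.prod_pow_eq_pow_sum]
  simp only [← Finset.prod_pow_eq_pow_sum, pow_add, Finset.prod_mul_distrib]
  ring

theorem sum_box (n N : ℕ) : ∑ p ∈ P.box n N, P.term n p =
    HahnSeries.ofPowerSeries ℤ ℤ (∑ k ∈ Finset.range (P.range n), P.slice n N k) := by
  rw [map_sum, Finset.sum_congr rfl fun k hk => slice_eq n N k (Finset.mem_range.mp hk),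
    Finset.sum_sigma']
  refine Finset.sum_nbij' (fun p => ⟨p 0, Fin.tail p⟩) (fun s => Fin.cons s.1 s.2) ?_ ?_ ?_ ?_ ?_
  · intro p hp
    have := mem_box.mp hp
    simpa [Fin.tail] using this
  · intro s hs
    rw [mem_box]
    simpa using hs
  · intro p _
    simp
  · rintro ⟨k, x⟩ _
    simp
  · intro p _
    simp

/-- The error allowed in the estimates. -/
def slack (K : ℕ) : ℤ := 4 * (K + 1) ^ 2 + 1

/-- In the box `2 * p 0 ≤ n`, so the negative coupling costs at most half of n times `negPart`. If
`negPart ≤ 2(K+1)`, the quadratic term absorbs the cost; otherwise the weight exceeds 2(K+1) and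
half of n times the weight suffices. -/
theorem le_expo_of_mem_box {n N K : ℕ} {p : Fin (r + 1) → ℕ} (hp : p ∈ P.box n N)
    (hK : K + 1 ≤ P.wt p) : (K + 1) * n - slack K ≤ P.expo n p := by
  have h1 := P.le_expo_zero p
  have h2 := le_two_mul_pentagonal (p 0)
  have h3 := P.expo_eq_zero_add n p
  have h4 := (mem_box.mp hp).1
  rw [range] at h4
  have hx : (0 : ℤ) ≤ ∑ i : Fin r, (p i.succ : ℤ) := by positivity
  have hK' : (K : ℤ) + 1 ≤ P.wt p := by exact_mod_cast hK
  have hn : (0 : ℤ) ≤ n := by positivity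
  have hk : (0 : ℤ) ≤ p 0 := by positivity
  have hI : (0 : ℤ) ≤ P.negPart p := by positivity
  rw [slack]
  generalize ((p 0 * (3 * p 0 + 1) / 2 : ℕ) : ℤ) = e at *
  have h5 : (n : ℤ) * (K + 1) ≤ n * P.wt p := mul_le_mul_of_nonneg_left hK' hn
  cases hf : P.flat
  · simp only [hf] at h4
    have h6 : 2 * (p 0 : ℤ) ≤ n := by
      simp at h4
      omega
    have h7 : (P.negPart p : ℤ) ≤ P.wt p := by exact_mod_cast P.negPart_le_wt hf p
    rcases le_or_gt (P.negPart p : ℤ) (2 * (K + 1)) with h | h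
    · have h8 : (p 0 : ℤ) * P.negPart p ≤ p 0 * (2 * (K + 1)) := mul_le_mul_of_nonneg_left h hk
      nlinarith [sq_nonneg ((p 0 : ℤ) - (K + 1))]
    · have h8 : 2 * (p 0 : ℤ) * P.negPart p ≤ n * P.negPart p := mul_le_mul_of_nonneg_right h6 hI
      have h9 : (n : ℤ) * P.negPart p ≤ n * P.wt p := mul_le_mul_of_nonneg_left h7 hn
      have h10 : (n : ℤ) * (2 * (K + 1)) ≤ n * P.wt p :=
        mul_le_mul_of_nonneg_left (by linarith) hn
      nlinarith [sq_nonneg (p 0 : ℤ)]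
  · simp only [hf, if_true, Nat.lt_one_iff] at h4
    rw [h4] at h1 h2
    push_cast at h1 h2
    nlinarith

/-- Beyond k = n/2 the quadratic exponent alone exceeds (K+1)n, even after the loss K k from the
coupling. -/
theorem lt_pentagonal {n K k : ℕ} (h : n < 2 * k) :
    (K + 1) * n - slack K ≤ ((k * (3 * k + 1) / 2 : ℕ) : ℤ) - K * k := by
  have h2 := le_two_mul_pentagonal k
  generalize ((k * (3 * k + 1) / 2 : ℕ) : ℤ) = e at *
  have h6 : (n : ℤ) ≤ 2 * k := by exact_mod_cast h.le
  have hK : (0 : ℤ) ≤ K := by positivity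
  have hk : (0 : ℤ) ≤ k := by positivity
  have h7 : ((K : ℤ) + 1) * n ≤ (K + 1) * (2 * k) := mul_le_mul_of_nonneg_left h6 (by positivity)
  rw [slack]
  nlinarith [sq_nonneg ((k : ℤ) - (K + 1))]

/-- A point leaves the box either through its quadratic variable, where `lt_pentagonal` applies, or
through another variable exceeding (K+1)n, which contributes at least its own value to the exponent.
-/
theorem le_expo_of_not_mem_box {n K : ℕ} {p : Fin (r + 1) → ℕ} (hp : p ∈ P.points)
    (hK : P.wt p ≤ K) (hb : p ∉ P.box n ((K + 1) * n + 1)) :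
    (K + 1) * n - slack K ≤ P.expo n p := by
  have h1 := P.le_expo_zero p
  have h3 := P.expo_eq_zero_add n p
  have hx : (0 : ℤ) ≤ ∑ i : Fin r, (p i.succ : ℤ) := by positivity
  have hn : (0 : ℤ) ≤ n * P.wt p := by positivity
  have hk : (0 : ℤ) ≤ p 0 := by positivity
  have hI : (p 0 : ℤ) * P.negPart p ≤ K * p 0 := by
    cases hf : P.flat
    · have h7 : (P.negPart p : ℤ) ≤ K := by exact_mod_cast (P.negPart_le_wt hf p).trans hK
      rw [mul_comm]
      exact mul_le_mul_of_nonneg_right h7 hk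
    · simp [hp hf]
  rw [mem_box] at hb
  by_cases h : p 0 < P.range n
  · have : ∃ i : Fin r, (K + 1) * n + 1 ≤ p i.succ := by
      by_contra! hc
      exact hb ⟨h, fun i => hc i⟩
    obtain ⟨i, hi⟩ := this
    have h4 : (p i.succ : ℤ) ≤ ∑ i : Fin r, (p i.succ : ℤ) :=
      Finset.single_le_sum (f := fun i : Fin r => (p i.succ : ℤ)) (fun _ _ => by positivity)
        (Finset.mem_univ i)
    have h5 : ((K : ℤ) + 1) * n + 1 ≤ p i.succ := by exact_mod_cast hi
    have h2 := le_two_mul_pentagonal (p 0)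
    generalize ((p 0 * (3 * p 0 + 1) / 2 : ℕ) : ℤ) = e at *
    rw [slack]
    nlinarith [sq_nonneg ((p 0 : ℤ) - (K + 1)), sq_nonneg (p 0 : ℤ)]
  · have h4 : n < 2 * p 0 := by
      rw [range] at h
      cases hf : P.flat
      · simp [hf] at h
        omega
      · simp [hf, hp hf] at h
    have := lt_pentagonal (K := K) h4
    linarith

/-- A sequence whose members are, up to a controlled error, the truncated sums of the family. -/
def Represents (P : LayerData r) (f : ℕ → PowerSeries ℤ) : Prop :=
  ∀ n N j : ℕ, j < N → (∀ k, n < 2 * k → j < k * (3 * k + 1) / 2) →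
    PowerSeries.coeff j (f n) =
      PowerSeries.coeff j (∑ k ∈ Finset.range (P.range n), P.slice n N k)

/-- Below degree (K+1)n - `slack K`, points of the box of weight above K are invisible, and so are
points outside the box of weight at most K. Hence the finite sum over the box and the first K + 1
complete layers agree. -/
theorem Represents.coeff_eq {f : ℕ → PowerSeries ℤ} (hf : P.Represents f) (K n : ℕ) {j : ℤ}
    (hj : j < (K + 1) * n - slack K) :
    (HahnSeries.ofPowerSeries ℤ ℤ (f n)).coeff j =
      ∑ d ∈ Finset.range (K + 1), (P.layerSum d).coeff (j - d * (n + 1)) := by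
  set N := (K + 1) * n + 1 with hN
  have hs : 0 ≤ slack K := by rw [slack]; positivity
  have h1 : (HahnSeries.ofPowerSeries ℤ ℤ (f n)).coeff j =
      ∑ p ∈ P.box n N, (P.term n p).coeff j := by
    have h := congrArg (HahnSeries.coeff · j) (P.sum_box n N)
    simp only [HahnSeries.coeff_sum] at h
    rw [h, coeff_ofPowerSeries, coeff_ofPowerSeries]
    split_ifs with h0
    · rfl
    · lift j to ℕ using not_lt.mp h0
      rw [Int.natAbs_natCast]
      refine hf n N j ?_ fun k hk => ?_
      · have : (j : ℤ) < (N : ℕ) := by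
          rw [hN]
          push_cast
          linarith
        exact_mod_cast this
      · have h3 := lt_pentagonal (K := K) hk
        have h4 : (0 : ℤ) ≤ K * k := by positivity
        have : (j : ℤ) < ((k * (3 * k + 1) / 2 : ℕ) : ℤ) := by linarith
        exact_mod_cast this
  have h2 : ∀ d ∈ Finset.range (K + 1), (P.layerSum d).coeff (j - d * (n + 1)) =
      ∑ p ∈ P.box n N with P.wt p = d, (P.term n p).coeff j := by
    intro d hd
    rw [Finset.mem_range] at hd
    rw [coeff_layerSum_eq_sum (P.box_subset n N)]
    · refine Finset.sum_congr rfl fun p hp => ?_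
      rw [P.coeff_term_shift n, (Finset.mem_filter.mp hp).2, mul_comm]
    · intro p hp hb
      have h3 := P.expo_add (-1) (n + 1) p
      rw [neg_add_cancel_comm_assoc, hp.2] at h3
      have h4 := le_expo_of_not_mem_box (K := K) hp.1 (by rw [hp.2]; omega) hb
      linarith
  rw [h1, Finset.sum_congr rfl h2, Finset.sum_comm' (t' := (P.box n N).filter (P.wt · < K + 1))
    (s' := fun p => {P.wt p})]
  · simp only [Finset.sum_singleton]
    rw [Finset.sum_filter]
    refine Finset.sum_congr rfl fun p hp => ?_
    split_ifs with h
    · rfl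
    · refine P.coeff_term_of_lt (lt_of_lt_of_le hj (le_expo_of_mem_box hp (by omega)))
  · intro d p
    simp only [Finset.mem_range, Finset.mem_filter, Finset.mem_singleton]
    constructor
    · rintro ⟨h, hp, rfl⟩
      exact ⟨rfl, hp, h⟩
    · rintro ⟨rfl, hp, h⟩
      exact ⟨h, hp, rfl⟩

/-- After division by q^{K(n+1)} the remainder starts at degree n - `slack K` - K, which tends to
infinity. -/
theorem Represents.hasStableLimits {f : ℕ → PowerSeries ℤ} (hf : P.Represents f) (K : ℕ) :
    HasStableLimits f K P.layerSum := by
  have key : ∀ n : ℕ, ∀ i : ℤ, i < n - slack K - K →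
      (qPow (-((K : ℤ) * (n + 1))) * (HahnSeries.ofPowerSeries ℤ ℤ (f n) -
        ∑ j ∈ Finset.range (K + 1), P.layerSum j * qPow ((j : ℤ) * (n + 1)))).coeff i = 0 := by
    intro n i hi
    rw [coeff_qPow_mul, HahnSeries.coeff_sub, hf.coeff_eq K n (by linarith), HahnSeries.coeff_sum,
      sub_eq_zero]
    refine Finset.sum_congr rfl fun d _ => ?_
    rw [mul_comm (P.layerSum d), coeff_qPow_mul]
  refine ⟨⟨-slack K - K, fun n i hi => key n i ?_⟩, fun i => ?_⟩
  · have : (0 : ℤ) ≤ n := by positivity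
    linarith
  · rw [HahnSeries.coeff_zero]
    refine tendsto_const_nhds.congr' ?_
    filter_upwards [Filter.eventually_gt_atTop (i + slack K + K).toNat] with n hn
    refine (key n i ?_).symm
    have := Int.self_le_toNat (i + slack K + K)
    have h2 : ((i + slack K + K).toNat : ℤ) < n := by exact_mod_cast hn
    linarith

theorem Represents.isAssociatedSeries {f : ℕ → PowerSeries ℤ} (hf : P.Represents f) :
    IsAssociatedSeries f (PowerSeries.mk P.layerSum) := by
  intro k
  simp only [PowerSeries.coeff_mk]
  exact hf.hasStableLimits k

end LayerData

end QSpin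


namespace QSpin

/-! ### q-multinomial coefficients -/

section Multinomial

open Polynomial

/-- The `q`-Pochhammer polynomial `(q)_n`. -/
noncomputable def pochPoly (n : ℕ) : ℤ[X] := ∏ i ∈ Finset.range n, (1 - X ^ (i + 1))

theorem pochPoly_succ (n : ℕ) : pochPoly (n + 1) = pochPoly n * (1 - X ^ (n + 1)) := by
  simp [pochPoly, Finset.prod_range_succ]

theorem pochPoly_zero : pochPoly 0 = 1 := by simp [pochPoly]

theorem coe_pochPoly (n : ℕ) : (pochPoly n : PowerSeries ℤ) = poch n := by
  induction n with
  | zero => simp [pochPoly_zero, poch_zero]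
  | succ n ih => rw [pochPoly_succ, poch_succ, Polynomial.coe_mul, ih]; simp

theorem coeff_zero_pochPoly (n : ℕ) : (pochPoly n).coeff 0 = 1 := by
  rw [coeff_zero_eq_eval_zero, pochPoly, eval_prod]
  exact Finset.prod_eq_one fun i _ => by simp

/-- The q-Pascal rule, from 1 - q^{m+n+2} = (1 - q^{m+1}) + q^{m+1}(1 - q^{n+1}). -/
theorem exists_qBinomial (m n : ℕ) : ∃ P : ℤ[X], P * (pochPoly m * pochPoly n) = pochPoly (m + n) := by
  induction m generalizing n with
  | zero => exact ⟨1, by simp [pochPoly_zero]⟩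
  | succ m ihm =>
    induction n with
    | zero => exact ⟨1, by simp [pochPoly_zero]⟩
    | succ n ihn =>
      obtain ⟨P, hP⟩ := ihm (n + 1)
      obtain ⟨Q, hQ⟩ := ihn
      refine ⟨P + X ^ (m + 1) * Q, ?_⟩
      have e1 : m + 1 + (n + 1) = (m + (n + 1)) + 1 := by ring
      have e2 : m + 1 + n = m + (n + 1) := by ring
      rw [e2] at hQ
      rw [e1, pochPoly_succ (m + (n + 1))]
      have h1 := pochPoly_succ m
      have h2 := pochPoly_succ n
      linear_combination (1 - X ^ (m + 1)) * hP + (X ^ (m + 1) * (1 - X ^ (n + 1))) * hQ +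
        P * pochPoly (n + 1) * h1 + X ^ (m + 1) * Q * pochPoly (m + 1) * h2

theorem exists_qMultinomial (l : List ℕ) :
    ∃ P : ℤ[X], P * (l.map pochPoly).prod = pochPoly l.sum := by
  induction l with
  | nil => exact ⟨1, by simp [pochPoly_zero]⟩
  | cons m l ih =>
    obtain ⟨P, hP⟩ := ih
    obtain ⟨Q, hQ⟩ := exists_qBinomial m l.sum
    refine ⟨Q * P, ?_⟩
    rw [List.map_cons, List.prod_cons, List.sum_cons, ← hQ]
    linear_combination Q * pochPoly m * hP

/-- The `q`-multinomial coefficient `(q)_{l_1 + ⋯ + l_s} / ((q)_{l_1} ⋯ (q)_{l_s})`. -/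
noncomputable def qMultinomial (l : List ℕ) : ℤ[X] := (exists_qMultinomial l).choose

theorem qMultinomial_mul (l : List ℕ) :
    qMultinomial l * (l.map pochPoly).prod = pochPoly l.sum :=
  (exists_qMultinomial l).choose_spec

theorem coeff_zero_prod_pochPoly (l : List ℕ) : ((l.map pochPoly).prod).coeff 0 = 1 := by
  induction l with
  | nil => simp
  | cons m l ih =>
    rw [List.map_cons, List.prod_cons, mul_coeff_zero, coeff_zero_pochPoly, one_mul, ih]

theorem coeff_zero_qMultinomial (l : List ℕ) : (qMultinomial l).coeff 0 = 1 := by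
  have h := congrArg (fun P : ℤ[X] => P.coeff 0) (qMultinomial_mul l)
  simpa [mul_coeff_zero, coeff_zero_prod_pochPoly, coeff_zero_pochPoly] using h

theorem coe_qMultinomial (l : List ℕ) :
    (qMultinomial l : PowerSeries ℤ) = poch l.sum * (l.map invPoch).prod := by
  have h := congrArg (fun P : ℤ[X] => (P : PowerSeries ℤ)) (qMultinomial_mul l)
  have h1 : ∀ l : List ℕ,
      (((l.map pochPoly).prod : ℤ[X]) : PowerSeries ℤ) * (l.map invPoch).prod = 1 := by
    intro l
    induction l with
    | nil => simp
    | cons m l ih =>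
      rw [List.map_cons, List.prod_cons, List.map_cons, List.prod_cons, Polynomial.coe_mul,
        coe_pochPoly, mul_mul_mul_comm, ih, poch_mul_invPoch, one_mul]
  simp only [Polynomial.coe_mul, coe_pochPoly] at h
  rw [← h, mul_assoc, h1, mul_one]

variable {K : Type*} [Field K]

/-- `n(n-1)/2`, as an integer. -/
def tri (n : ℤ) : ℤ := n * (n - 1) / 2

theorem two_mul_tri (n : ℤ) : 2 * tri n = n * (n - 1) :=
  Int.mul_ediv_cancel' (even_iff_two_dvd.mp (by simpa using Int.even_mul_pred_self n))

theorem tri_add_one (n : ℤ) : tri (n + 1) = tri n + n := by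
  have h1 := two_mul_tri n
  have h2 := two_mul_tri (n + 1)
  linarith [show (n + 1) * (n + 1 - 1) = n * (n - 1) + 2 * n by ring]

theorem aeval_pochPoly {t : K} (h : Generic t) (n : ℕ) :
    aeval (t ^ 2) (pochPoly n) = t ^ tri n * (1 - t ^ 2) ^ n * qFact t n := by
  have h0 := h.ne_zero
  have h2 : 1 - t ^ 2 ≠ 0 := sub_ne_zero.mpr (h.pow_ne_one 2 (by norm_num)).symm
  have h3 := h.sub_inv_ne_zero
  induction n with
  | zero => simp [pochPoly_zero, qFact_zero, tri]
  | succ n ih =>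
    rw [pochPoly_succ, map_mul, ih, qFact_succ]
    push_cast
    rw [tri_add_one, zpow_add₀ h0, qi]
    have e1 : t ^ (-((n : ℤ) + 1)) = (t ^ (n + 1))⁻¹ := by
      rw [zpow_neg, ← Nat.cast_succ, zpow_natCast]
    have e2 : t ^ ((n : ℤ) + 1) = t ^ (n + 1) := by
      rw [← Nat.cast_succ, zpow_natCast]
    rw [e1, e2, zpow_natCast]
    simp only [map_sub, map_one, map_pow, aeval_X]
    have h5 : t ^ 2 - 1 ≠ 0 := by
      intro h6
      apply h2
      linear_combination -h6
    field_simp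
    ring

theorem aeval_prod_pochPoly {t : K} (h : Generic t) (l : List ℕ) :
    aeval (t ^ 2) (l.map pochPoly).prod =
      t ^ (l.map fun n : ℕ => tri n).sum * (1 - t ^ 2) ^ l.sum * (l.map (qFact t)).prod := by
  induction l with
  | nil => simp
  | cons n l ih =>
    simp only [List.map_cons, List.prod_cons, List.sum_cons, map_mul, ih, aeval_pochPoly h,
      zpow_add₀ h.ne_zero, pow_add]
    ring

/-- The powers of 1 - t² cancel because the parts add up to the top entry; only the powers of t
between the two normalizations of the factorials remain. -/
theorem qFact_sum {t : K} (h : Generic t) (l : List ℕ) :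
    t ^ tri l.sum * qFact t l.sum = aeval (t ^ 2) (qMultinomial l) *
      (t ^ (l.map fun n : ℕ => tri n).sum * (l.map (qFact t)).prod) := by
  have h1 := congrArg (aeval (t ^ 2)) (qMultinomial_mul l)
  have h2 : 1 - t ^ 2 ≠ 0 := sub_ne_zero.mpr (h.pow_ne_one 2 (by norm_num)).symm
  rw [map_mul, aeval_prod_pochPoly h, aeval_pochPoly h] at h1
  apply mul_left_cancel₀ (pow_ne_zero l.sum h2)
  linear_combination -h1

end Multinomial

end QSpin


/-! ### The Racah sum as a polynomial with constant term 1 -/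

namespace QSpin

/-- The distances from the smallest of the three quadrilateral half sums of a coloring of the
tetrahedron to the two other ones (`A₁`, `A₂`) and to the triangle half sums (`B₁`, …, `B₄`). -/
structure TetShape where
  A₁ : ℕ
  A₂ : ℕ
  B₁ : ℕ
  B₂ : ℕ
  B₃ : ℕ
  B₄ : ℕ

namespace TetShape

open Polynomial

variable (G : TetShape)

/-- The smallest quadrilateral half sum. -/
def S : ℕ := G.A₁ + G.A₂ + G.B₁ + G.B₂ + G.B₃ + G.B₄

/-- The range of the summation variable. -/
def InRange (n k : ℕ) : Prop := k ≤ n * G.B₁ ∧ k ≤ n * G.B₂ ∧ k ≤ n * G.B₃ ∧ k ≤ n * G.B₄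

instance (n k : ℕ) : Decidable (G.InRange n k) := by unfold InRange; infer_instance

/-- The parts of the multinomial coefficient. -/
def parts (n k : ℕ) : List ℕ :=
  -- The denominators of the Racah term add up to z = nS - k while its numerator is [z+1]!. The part
  -- 1, with [1]! = 1, makes up the difference.
  [1, k, n * G.A₁ + k, n * G.A₂ + k, n * G.B₁ - k, n * G.B₂ - k, n * G.B₃ - k, n * G.B₄ - k]

/-- The evaluation of the `n`-th multiple of the coloring, divided by its lowest monomial. -/
noncomputable def poly (n : ℕ) : ℤ[X] :=
  ∑ k ∈ Finset.range (n * G.S + 1), if G.InRange n k then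
    (-1) ^ k * X ^ (k * (3 * k + 1) / 2 + n * (G.A₁ + G.A₂) * k) * qMultinomial (G.parts n k)
  else 0

variable {G}

theorem sum_parts {n k : ℕ} (h : G.InRange n k) : (G.parts n k).sum = n * G.S - k + 1 := by
  obtain ⟨h1, h2, h3, h4⟩ := h
  simp only [parts, List.sum_cons, List.sum_nil, S, mul_add]
  omega

/-- For k > 0 the monomial has positive degree, so only the multinomial coefficient at k = 0
contributes. -/
theorem coeff_zero_poly (n : ℕ) : (G.poly n).coeff 0 = 1 := by
  rw [poly, finsetSum_coeff, Finset.sum_eq_single 0]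
  · simp [InRange, coeff_zero_qMultinomial]
  · intro k _ hk
    split_ifs
    · have h1 := LayerData.two_mul_pentagonal k
      have h2 : 1 ≤ k * (3 * k + 1) := Nat.mul_pos (by omega) (by omega)
      rw [mul_coeff_zero, mul_coeff_zero, coeff_X_pow, if_neg (by omega)]
      simp
    · simp
  · simp

variable {K : Type*} [Field K]

/-- The exponent of the lowest monomial. -/
def lowExponent (G : TetShape) (n : ℕ) : ℤ :=
  tri (n * G.A₁) + tri (n * G.A₂) + tri (n * G.B₁) + tri (n * G.B₂) + tri (n * G.B₃) +
    tri (n * G.B₄) - tri (n * G.S + 1)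

/-- The power of t between the symmetric and the q-normalized multinomial coefficient. Its
dependence on k is 3k² + k + 2n(A₁+A₂)k, so the lowest monomial comes from k = 0. -/
theorem tri_parts {n k : ℕ} (h : G.InRange n k) :
    ((G.parts n k).map fun m : ℕ => tri m).sum - tri ((G.parts n k).sum : ℕ) =
      G.lowExponent n + 2 * (k * (3 * k + 1) / 2 + n * (G.A₁ + G.A₂) * k : ℕ) := by
  have hk : k ≤ n * G.S := by
    have := h.1
    simp only [S, mul_add]
    omega
  have hs : ((n * G.S : ℕ) : ℤ) = n * G.A₁ + n * G.A₂ + n * G.B₁ + n * G.B₂ + n * G.B₃ +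
      n * G.B₄ := by
    simp only [S]
    push_cast
    ring
  rw [sum_parts h]
  obtain ⟨h1, h2, h3, h4⟩ := h
  simp only [parts, List.map_cons, List.map_nil, List.sum_cons, List.sum_nil, lowExponent]
  push_cast [h1, h2, h3, h4, hk] at hs ⊢
  have hp : (k : ℤ) * (3 * k + 1) / 2 * 2 = k * (3 * k + 1) := by
    have := LayerData.two_mul_pentagonal k
    zify at this
    linarith
  generalize (k : ℤ) * (3 * k + 1) / 2 = e at *
  have t1 : tri 1 = 0 := rfl
  have := two_mul_tri k
  have := two_mul_tri (n * G.A₁ + k)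
  have := two_mul_tri (n * G.A₂ + k)
  have := two_mul_tri (n * G.B₁ - k)
  have := two_mul_tri (n * G.B₂ - k)
  have := two_mul_tri (n * G.B₃ - k)
  have := two_mul_tri (n * G.B₄ - k)
  have := two_mul_tri (n * G.A₁)
  have := two_mul_tri (n * G.A₂)
  have := two_mul_tri (n * G.B₁)
  have := two_mul_tri (n * G.B₂)
  have := two_mul_tri (n * G.B₃)
  have := two_mul_tri (n * G.B₄)
  have u1 := two_mul_tri (n * G.S - k + 1)
  have u2 := two_mul_tri (n * G.S + 1)
  rw [hs] at *
  rw [t1]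
  linarith

/-- The index is reflected to z = nS - k. The `T` conditions become k ≤ nB_i, and the convention for
`iF` gives zero outside `InRange`. -/
theorem racahTerm_eq {t : K} (h : Generic t) {n k : ℕ} (hk : k ≤ n * G.S) :
    racahTerm t (n * G.S - n * G.B₁) (n * G.S - n * G.B₂) (n * G.S - n * G.B₃)
      (n * G.S - n * G.B₄) (n * G.S) (n * G.S + n * G.A₁) (n * G.S + n * G.A₂) (n * G.S - k) =
    (-1) ^ (n * G.S) * t ^ G.lowExponent n * aeval (t ^ 2) (if G.InRange n k then
      (-1) ^ k * X ^ (k * (3 * k + 1) / 2 + n * (G.A₁ + G.A₂) * k) * qMultinomial (G.parts n k)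
      else 0) := by
  have hz : ((n * G.S - k : ℕ) : ℤ) = n * G.S - k := by
    push_cast [hk]
    ring
  rw [racahTerm, hz]
  have e1 : ∀ B : ℕ, (n * G.S - k - (n * G.S - n * B) : ℤ) = (n * B : ℕ) - k := by
    intro B; push_cast; ring
  have e2 : ∀ A : ℕ, (n * G.S + n * A - (n * G.S - k) : ℤ) = (n * A + k : ℕ) := by
    intro A; push_cast; ring
  rw [e1, e1, e1, e1, e2, e2, sub_sub_cancel]
  split_ifs with hr
  · have h0 := h.ne_zero
    have hq := qFact_sum h (G.parts n k)
    have ht := tri_parts hr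
    rw [sum_parts hr] at hq ht
    have hsgn : (-1 : K) ^ (n * G.S - k) = (-1) ^ (n * G.S) * (-1) ^ k := by
      rw [← pow_add]
      exact neg_one_pow_congr (by rw [Nat.even_sub hk, Nat.even_add])
    have hz1 : (n * G.S - k + 1 : ℤ) = (n * G.S - k + 1 : ℕ) := by
      rw [Nat.cast_add_one, hz]
    obtain ⟨h1, h2, h3, h4⟩ := hr
    rw [hz1, qF_natCast, hsgn, ← Nat.cast_sub h1, ← Nat.cast_sub h2, ← Nat.cast_sub h3,
      ← Nat.cast_sub h4]
    simp only [iF_natCast]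
    generalize hE : (k * (3 * k + 1) / 2 + n * (G.A₁ + G.A₂) * k : ℕ) = E at *
    generalize n * G.S - k + 1 = s at *
    have hpow : t ^ ((G.parts n k).map fun m : ℕ => tri m).sum =
        t ^ tri (s : ℤ) * (t ^ G.lowExponent n * (t ^ 2) ^ E) := by
      rw [← pow_mul, ← zpow_natCast, ← zpow_add₀ h0, ← zpow_add₀ h0]
      congr 1
      push_cast
      linarith
    rw [hpow, mul_assoc (t ^ tri (s : ℤ)), mul_left_comm] at hq
    have hq' := mul_left_cancel₀ (zpow_ne_zero _ h0) hq
    rw [hq']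
    simp only [map_mul, map_pow, map_neg, map_one, aeval_X]
    have hl : ((G.parts n k).map (qFact t)).prod * ((qFact t (n * G.B₁ - k))⁻¹ *
        (qFact t (n * G.B₂ - k))⁻¹ * (qFact t (n * G.B₃ - k))⁻¹ * (qFact t (n * G.B₄ - k))⁻¹ *
        ((qFact t k)⁻¹ * (qFact t (n * G.A₁ + k))⁻¹ * (qFact t (n * G.A₂ + k))⁻¹)) = 1 := by
      have hf := h.qFact_ne_zero
      have hf1 : qFact t 1 = 1 := by
        have h1 : qi t 1 = 1 := by
          rw [qi, zpow_neg, zpow_one, div_self h.sub_inv_ne_zero]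
        simp [qFact, qInt_eq_qi, h1]
      simp only [parts, List.map_cons, List.map_nil, List.prod_cons, List.prod_nil, hf1]
      have := hf k
      have := hf (n * G.A₁ + k)
      have := hf (n * G.A₂ + k)
      have := hf (n * G.B₁ - k)
      have := hf (n * G.B₂ - k)
      have := hf (n * G.B₃ - k)
      have := hf (n * G.B₄ - k)
      field_simp
    linear_combination ((-1) ^ (n * G.S) * (-1) ^ k * t ^ G.lowExponent n * (t ^ 2) ^ E *
      aeval (t ^ 2) (qMultinomial (G.parts n k))) * hl
  · rw [map_zero, mul_zero]
    simp only [InRange, not_and_or, not_le] at hr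
    rcases hr with hr | hr | hr | hr
    · rw [iF_of_neg t (n := (n * G.B₁ : ℕ) - k) (by omega)]; ring
    · rw [iF_of_neg t (n := (n * G.B₂ : ℕ) - k) (by omega)]; ring
    · rw [iF_of_neg t (n := (n * G.B₃ : ℕ) - k) (by omega)]; ring
    · rw [iF_of_neg t (n := (n * G.B₄ : ℕ) - k) (by omega)]; ring

theorem sum_racahTerm {t : K} (h : Generic t) (G : TetShape) {n N : ℕ} (hN : n * G.S < N) :
    ∑ z ∈ Finset.range N, racahTerm t (n * G.S - n * G.B₁) (n * G.S - n * G.B₂)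
      (n * G.S - n * G.B₃) (n * G.S - n * G.B₄) (n * G.S) (n * G.S + n * G.A₁)
      (n * G.S + n * G.A₂) z =
    (-1) ^ (n * G.S) * t ^ G.lowExponent n * aeval (t ^ 2) (G.poly n) := by
  rw [← Finset.sum_subset (Finset.range_subset_range.mpr (show n * G.S + 1 ≤ N from hN)),
    ← Finset.sum_range_reflect, poly, map_sum, Finset.mul_sum]
  · refine Finset.sum_congr rfl fun k hk => ?_
    rw [Finset.mem_range] at hk
    rw [← racahTerm_eq h (show k ≤ n * G.S by omega), add_tsub_cancel_right]
  · intro z _ hz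
    rw [Finset.mem_range, not_lt] at hz
    have hneg : (n * G.S - z : ℤ) < 0 := by
      have : ((n * G.S + 1 : ℕ) : ℤ) ≤ z := by exact_mod_cast hz
      push_cast at this
      linarith
    rw [racahTerm, iF_of_neg t hneg]
    ring

end TetShape

end QSpin


/-! ### Expansion of the polynomials by Euler's series -/

namespace QSpin

namespace TetShape

variable (G : TetShape)

/-- The exponential sums whose members are, up to a small error, the polynomials of a shape. -/
def layerData : LayerData 14 where
  κ := G.A₁ + G.A₂
  -- The factors in order: (q²)_∞; six copies of 1/(q)_∞; 1/(q^{nS-k+2})_∞; two factors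
  -- (q^{nA_j+k+1})_∞; four factors (q^{nB_i-k+1})_∞. The remaining 1/(q)_k belongs to the quadratic
  -- variable.
  δ := ![1, 0, 0, 0, 0, 0, 0, 0, 1, 1, 1, 1, 1, 1]
  a := ![2, 1, 1, 1, 1, 1, 1, 2, 1, 1, 1, 1, 1, 1]
  v := ![0, 0, 0, 0, 0, 0, 0, -1, 1, 1, -1, -1, -1, -1]
  w := ![0, 0, 0, 0, 0, 0, 0, G.S, G.A₁, G.A₂, G.B₁, G.B₂, G.B₃, G.B₄]
  flat := decide (G.B₁ = 0 ∨ G.B₂ = 0 ∨ G.B₃ = 0 ∨ G.B₄ = 0)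
  one_le_a := by decide
  neg_one_le_v := by decide
  one_le_w h := by
    simp only [decide_eq_false_iff_not, not_or] at h
    obtain ⟨h1, h2, h3, h4⟩ := h
    have : 1 ≤ G.S := by simp only [S]; omega
    simp only [Fin.forall_fin_succ]
    simp
    omega

theorem coe_poly (n : ℕ) : (G.poly n : PowerSeries ℤ) =
    ∑ k ∈ Finset.range (n * G.S + 1), if G.InRange n k then
      PowerSeries.X ^ (k * (3 * k + 1) / 2 + n * (G.A₁ + G.A₂) * k) *
        ((-1) ^ k * (qMultinomial (G.parts n k) : PowerSeries ℤ)) else 0 := by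
  rw [poly, ← Polynomial.coeToPowerSeries.ringHom_apply, map_sum]
  refine Finset.sum_congr rfl fun k _ => ?_
  split_ifs
  · simp only [map_mul, map_pow, map_neg, map_one, Polynomial.coeToPowerSeries.ringHom_apply,
      Polynomial.coe_X]
    ring
  · simp

variable {G}

theorem inRange_of_lt {n k : ℕ} (hk : k < G.layerData.range n) : G.InRange n k := by
  by_cases h : G.B₁ = 0 ∨ G.B₂ = 0 ∨ G.B₃ = 0 ∨ G.B₄ = 0
  · have : k = 0 := by simpa [LayerData.range, layerData, h] using hk
    simp [this, InRange]
  · have hk' : k ≤ n := by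
      simp [LayerData.range, layerData, h] at hk
      omega
    simp only [not_or] at h
    obtain ⟨h1, h2, h3, h4⟩ := h
    exact ⟨hk'.trans (Nat.le_mul_of_pos_right _ (by omega)),
      hk'.trans (Nat.le_mul_of_pos_right _ (by omega)),
      hk'.trans (Nat.le_mul_of_pos_right _ (by omega)),
      hk'.trans (Nat.le_mul_of_pos_right _ (by omega))⟩

/-- The terms of the polynomial omitted by `layerData` have k > n/2, so they start beyond the
degrees tested in `Represents`. -/
theorem lt_two_mul_of_inRange {n k : ℕ} (h : G.InRange n k) (hk : G.layerData.range n ≤ k) :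
    n < 2 * k := by
  by_cases hf : G.B₁ = 0 ∨ G.B₂ = 0 ∨ G.B₃ = 0 ∨ G.B₄ = 0
  · obtain ⟨h1, h2, h3, h4⟩ := h
    have : k = 0 := by
      rcases hf with hf | hf | hf | hf <;> simp only [hf] at * <;> omega
    simp [LayerData.range, layerData, hf] at hk
    omega
  · simp [LayerData.range, layerData, hf] at hk
    omega

/-- The numerator (q)_{nS-k+1}/(1-q) and the six denominators other than (q)_k are each written as a
quotient of infinite products, expanded by Euler's series modulo q^{N+1}. -/
theorem modX_slice (N : ℕ) {n k : ℕ} (h : G.InRange n k) :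
    modX (N + 1) (PowerSeries.X ^ (k * (3 * k + 1) / 2 + n * (G.A₁ + G.A₂) * k) *
        ((-1) ^ k * (qMultinomial (G.parts n k) : PowerSeries ℤ))) =
      modX (N + 1) (G.layerData.slice n (N + 1) k) := by
  have hk : k ≤ n * G.S := by
    have := h.1
    simp only [S, mul_add]
    omega
  rw [coe_qMultinomial, sum_parts h]
  obtain ⟨h1, h2, h3, h4⟩ := h
  have t1 : (2 + -1 * (k : ℤ) + n * G.S).toNat = n * G.S - k + 1 + 1 := by
    rw [show (2 + -1 * (k : ℤ) + n * G.S) = ((n * G.S - k + 1 + 1 : ℕ) : ℤ) by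
      push_cast [hk]; ring, Int.toNat_natCast]
  have t2 : ∀ A : ℕ, (1 + 1 * (k : ℤ) + n * A).toNat = n * A + k + 1 := by
    intro A
    rw [show (1 + 1 * (k : ℤ) + n * A) = ((n * A + k + 1 : ℕ) : ℤ) by
      push_cast; ring, Int.toNat_natCast]
  have t3 : ∀ B : ℕ, k ≤ n * B → (1 + -1 * (k : ℤ) + n * B).toNat = n * B - k + 1 := by
    intro B hB
    rw [show (1 + -1 * (k : ℤ) + n * B) = ((n * B - k + 1 : ℕ) : ℤ) by
      push_cast [hB]; ring, Int.toNat_natCast]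
  have hprod : ∏ i, eulerSum (G.layerData.δ i)
      (G.layerData.a i + G.layerData.v i * k + n * G.layerData.w i).toNat (N + 1) =
      (eulerSum 1 2 (N + 1) * eulerSum 0 (n * G.S - k + 1 + 1) (N + 1)) *
      ((eulerSum 0 1 (N + 1) * eulerSum 1 (n * G.A₁ + k + 1) (N + 1)) *
      (eulerSum 0 1 (N + 1) * eulerSum 1 (n * G.A₂ + k + 1) (N + 1)) *
      (eulerSum 0 1 (N + 1) * eulerSum 1 (n * G.B₁ - k + 1) (N + 1)) *
      (eulerSum 0 1 (N + 1) * eulerSum 1 (n * G.B₂ - k + 1) (N + 1)) *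
      (eulerSum 0 1 (N + 1) * eulerSum 1 (n * G.B₃ - k + 1) (N + 1)) *
      (eulerSum 0 1 (N + 1) * eulerSum 1 (n * G.B₄ - k + 1) (N + 1))) := by
    rw [← t1, ← t2, ← t2, ← t3 _ h1, ← t3 _ h2, ← t3 _ h3, ← t3 _ h4]
    simp only [layerData, Fin.prod_univ_succ]
    simp
    ring
  rw [LayerData.slice, hprod]
  simp only [map_mul]
  rw [← modX_poch_mul_invPoch_one]
  simp only [← modX_invPoch]
  simp only [← map_mul]
  congr 1
  simp only [parts, List.map_cons, List.map_nil, List.prod_cons, List.prod_nil, layerData]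
  ring

theorem represents : G.layerData.Represents fun n => (G.poly n : PowerSeries ℤ) := by
  intro n N j hj hlt
  obtain ⟨N, rfl⟩ : ∃ M, N = M + 1 := ⟨N - 1, by omega⟩
  have hsub : Finset.range (G.layerData.range n) ⊆ Finset.range (n * G.S + 1) := by
    intro k hk
    have := (inRange_of_lt (Finset.mem_range.mp hk)).1
    rw [Finset.mem_range]
    simp only [S, mul_add]
    omega
  beta_reduce
  rw [coe_poly, map_sum, map_sum, ← Finset.sum_subset hsub]
  · refine Finset.sum_congr rfl fun k hk => ?_
    have hr := inRange_of_lt (Finset.mem_range.mp hk)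
    rw [if_pos hr]
    exact modX_eq_iff.mp (modX_slice N hr) j hj
  · intro k _ hk
    rw [Finset.mem_range, not_lt] at hk
    split_ifs with hr
    · have := hlt k (lt_two_mul_of_inRange hr hk)
      rw [PowerSeries.coeff_X_pow_mul', if_neg (by omega)]
    · simp

end TetShape

end QSpin


/-! ### From admissible colorings to shapes, and the theorem -/

namespace QSpin

theorem generic_ratFuncX : Generic (RatFunc.X : RatFunc ℚ) where
  ne_zero := RatFunc.X_ne_zero
  pow_ne_one n hn h := by
    have h1 : algebraMap (Polynomial ℚ) (RatFunc ℚ) (Polynomial.X ^ n) =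
        algebraMap (Polynomial ℚ) (RatFunc ℚ) 1 := by
      rw [map_pow, RatFunc.algebraMap_X, h, map_one]
    have h2 := congrArg Polynomial.natDegree (RatFunc.algebraMap_injective ℚ h1)
    rw [Polynomial.natDegree_X_pow, Polynomial.natDegree_one] at h2
    exact hn h2

theorem AdmissibleTriple.exists_strands {i j k : ℕ} (h : AdmissibleTriple i j k) :
    ∃ x y z, i = x + y ∧ j = x + z ∧ k = y + z := by
  obtain ⟨⟨m, hm⟩, h1, h2, h3⟩ := h
  exact ⟨m - k, m - j, m - i, by omega, by omega, by omega⟩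

theorem TetStrands.smul {a b c d e f ab ae be ac af cf cd ce de bd bf df : ℕ}
    (H : TetStrands a b c d e f ab ae be ac af cf cd ce de bd bf df) (n : ℕ) :
    TetStrands (n * a) (n * b) (n * c) (n * d) (n * e) (n * f) (n * ab) (n * ae) (n * be)
      (n * ac) (n * af) (n * cf) (n * cd) (n * ce) (n * de) (n * bd) (n * bf) (n * df) := by
  constructor <;> rw [← mul_add]
  exacts [congrArg _ H.abe_a, congrArg _ H.abe_b, congrArg _ H.abe_e, congrArg _ H.acf_a,
    congrArg _ H.acf_c, congrArg _ H.acf_f, congrArg _ H.cde_c, congrArg _ H.cde_d,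
    congrArg _ H.cde_e, congrArg _ H.bdf_b, congrArg _ H.bdf_d, congrArg _ H.bdf_f]

theorem Admissible.exists_tetStrands {a b c d e f : ℕ} (h : Admissible a b c d e f) :
    ∃ ab ae be ac af cf cd ce de bd bf df : ℕ,
      TetStrands a b c d e f ab ae be ac af cf cd ce de bd bf df := by
  obtain ⟨h1, h2, h3, h4⟩ := h
  obtain ⟨ab, ae, be, e1, e2, e3⟩ := h1.exists_strands
  obtain ⟨ac, af, cf, e4, e5, e6⟩ := h2.exists_strands
  obtain ⟨cd, ce, de, e7, e8, e9⟩ := h3.exists_strands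
  obtain ⟨bd, bf, df, e10, e11, e12⟩ := h4.exists_strands
  exact ⟨ab, ae, be, ac, af, cf, cd, ce, de, bd, bf, df, by constructor <;> omega⟩

theorem racahTerm_swap_left {K : Type*} [Field K] (t : K) (T₁ T₂ T₃ T₄ S₁ S₂ S₃ : ℤ) (z : ℕ) :
    racahTerm t T₁ T₂ T₃ T₄ S₁ S₂ S₃ z = racahTerm t T₁ T₂ T₃ T₄ S₂ S₁ S₃ z := by
  simp only [racahTerm]
  ring

theorem racahTerm_rotate {K : Type*} [Field K] (t : K) (T₁ T₂ T₃ T₄ S₁ S₂ S₃ : ℤ) (z : ℕ) :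
    racahTerm t T₁ T₂ T₃ T₄ S₁ S₂ S₃ z = racahTerm t T₁ T₂ T₃ T₄ S₃ S₁ S₂ z := by
  simp only [racahTerm]
  ring

theorem TetShape.sum_racahTerm_natCast {K : Type*} [Field K] {t : K} (h : Generic t)
    (G : TetShape) {T₁ T₂ T₃ T₄ U V W n N : ℕ} (h₁ : U = G.B₁ + T₁) (h₂ : U = G.B₂ + T₂)
    (h₃ : U = G.B₃ + T₃) (h₄ : U = G.B₄ + T₄) (hV : V = U + G.A₁) (hW : W = U + G.A₂)
    (hU : U = G.S) (hN : n * U < N) :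
    ∑ z ∈ Finset.range N, racahTerm t (n * T₁ : ℕ) (n * T₂ : ℕ) (n * T₃ : ℕ) (n * T₄ : ℕ)
      (n * U : ℕ) (n * V : ℕ) (n * W : ℕ) z =
    (-1) ^ (n * G.S) * t ^ G.lowExponent n * Polynomial.aeval (t ^ 2) (G.poly n) := by
  rw [← G.sum_racahTerm h (hU ▸ hN), ← hU]
  have hsub : ∀ {B T : ℕ}, U = B + T → ((n * T : ℕ) : ℤ) = n * U - n * B := by
    intro B T h
    rw [h]
    push_cast
    ring
  rw [hsub h₁, hsub h₂, hsub h₃, hsub h₄, hV, hW]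
  push_cast
  simp only [mul_add]

/-- The evaluations of the multiples of an admissible coloring, in terms of a shape. -/
theorem exists_tetShape {a b c d e f : ℕ} (hγ : Admissible a b c d e f) :
    ∃ G : TetShape, ∀ {K : Type} [Field K] {t : K}, Generic t → ∀ n : ℕ,
      tetEval t (n * a) (n * b) (n * c) (n * d) (n * e) (n * f) =
        (-1) ^ (n * G.S) * t ^ G.lowExponent n * Polynomial.aeval (t ^ 2) (G.poly n) := by
  obtain ⟨ab, ae, be, ac, af, cf, cd, ce, de, bd, bf, df, H⟩ := hγ.exists_tetStrands
  have hT : ∀ {K : Type} [Field K] {t : K}, Generic t → ∀ n N : ℕ,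
      n * (ab + ae + be + df) < N →
      tetEval t (n * a) (n * b) (n * c) (n * d) (n * e) (n * f) =
      ∑ z ∈ Finset.range N, racahTerm t ((n * (ab + ae + be) : ℕ) : ℤ) ((n * (ce + de + cd) : ℕ) : ℤ)
        ((n * (ac + af + cf) : ℕ) : ℤ) ((n * (bd + bf + df) : ℕ) : ℤ)
        ((n * (ab + ae + be + cd) : ℕ) : ℤ) ((n * (ab + ae + be + df) : ℕ) : ℤ)
        ((n * (ab + ae + be + cf) : ℕ) : ℤ) z := by
    intro K _ t ht n N hN
    refine tetEval_eq ht (H.smul n) ?_ ?_ ?_ ?_ ?_ ?_ ?_ (by exact_mod_cast hN) <;>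
      push_cast <;> ring
  obtain ⟨a1, a2, a3, a4, a5, a6, a7, a8, a9, a10, a11, a12⟩ := H
  have hlt : ∀ {n x y : ℕ}, x ≤ y → n * x < n * y + 1 := fun h =>
    Nat.lt_succ_of_le (Nat.mul_le_mul_left _ h)
  -- The three quadrilateral half sums exceed T₁ by cd, df and cf. The Racah sum is symmetric in
  -- them, so the smallest may be moved to the first place.
  have hmin : (cd ≤ df ∧ cd ≤ cf) ∨ (df ≤ cd ∧ df ≤ cf) ∨ (cf ≤ cd ∧ cf ≤ df) := by omega
  rcases hmin with ⟨m1, m2⟩ | ⟨m1, m2⟩ | ⟨m1, m2⟩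
  · refine ⟨⟨df - cd, cf - cd, cd, ab, bd, ac⟩, fun ht n => ?_⟩
    rw [hT ht n (n * (ab + ae + be + cd + df + cf) + 1) (hlt (by omega))]
    refine TetShape.sum_racahTerm_natCast ht _ ?_ ?_ ?_ ?_ ?_ ?_ ?_ (hlt ?_) <;>
      (try simp only [TetShape.S]) <;> omega
  · refine ⟨⟨cd - df, cf - df, df, af, de, ae⟩, fun ht n => ?_⟩
    rw [hT ht n (n * (ab + ae + be + cd + df + cf) + 1) (hlt (by omega)),
      Finset.sum_congr rfl fun z _ => racahTerm_swap_left _ _ _ _ _ _ _ _ z]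
    refine TetShape.sum_racahTerm_natCast ht _ ?_ ?_ ?_ ?_ ?_ ?_ ?_ (hlt ?_) <;>
      (try simp only [TetShape.S]) <;> omega
  · refine ⟨⟨cd - cf, df - cf, cf, bf, be, ce⟩, fun ht n => ?_⟩
    rw [hT ht n (n * (ab + ae + be + cd + df + cf) + 1) (hlt (by omega)),
      Finset.sum_congr rfl fun z _ => racahTerm_rotate _ _ _ _ _ _ _ _ z]
    refine TetShape.sum_racahTerm_natCast ht _ ?_ ?_ ?_ ?_ ?_ ?_ ?_ (hlt ?_) <;>
      (try simp only [TetShape.S]) <;> omega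

theorem TetShape.isLowestMonomialQuotient (G : TetShape) {n : ℕ} {g : RatFunc ℚ}
    (h : g = (-1) ^ (n * G.S) * RatFunc.X ^ G.lowExponent n *
      Polynomial.aeval (RatFunc.X ^ 2) (G.poly n)) : IsLowestMonomialQuotient g (G.poly n) := by
  refine ⟨G.coeff_zero_poly n, (-1) ^ (n * G.S), G.lowExponent n, by simp, ?_⟩
  rw [h]
  push_cast
  rfl

end QSpin

theorem theorem1p11 (a b c d e f : ℕ) (hγ : QSpin.Admissible a b c d e f) :
    ∃ Jhat : ℕ → Polynomial ℤ,
      (∀ n : ℕ, QSpin.IsLowestMonomialQuotient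
        (QSpin.J (n * a) (n * b) (n * c) (n * d) (n * e) (n * f)) (Jhat n)) ∧
      QSpin.IsStable (fun n => (Jhat n : PowerSeries ℤ)) ∧
      ∃ F : PowerSeries (LaurentSeries ℤ),
        QSpin.IsAssociatedSeries (fun n => (Jhat n : PowerSeries ℤ)) F ∧
        QSpin.IsNahmSum (PowerSeries.coeff 0 F) ∧
        QSpin.IsNahmSeries F := by
  obtain ⟨G, hG⟩ := QSpin.exists_tetShape hγ
  refine ⟨G.poly, fun n => G.isLowestMonomialQuotient ?_,
    fun k => ⟨_, G.represents.hasStableLimits k⟩, PowerSeries.mk G.layerData.layerSum,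
    G.represents.isAssociatedSeries, ?_, QSpin.LayerData.isNahmSeries_layerSum⟩
  · rw [QSpin.J, hG QSpin.generic_ratFuncX]
    congr! <;> exact Subsingleton.elim _ _
  · rw [PowerSeries.coeff_mk]
    exact QSpin.LayerData.isNahmSum_layerSum_zero
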